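/- A finitely generated group $G$ with finite generating tuple $x_1,\dots,x_n$ has \emph{solvable membership problem} if there is an algorithm which, given words $u,w_1,\dots,w_k$ in the letters $x_1^{\pm1},\dots,x_n^{\pm1}$, decides whether the element of $G$ represented by $u$ belongs to the subgroup generated by the elements represented by $w_1,\dots,w_k$. The group $G$ is \emph{effectively coherent} if there is an algorithm which, given finitely many words $w_1,\dots,w_k$ in the letters $x_1^{\pm1},\dots,x_n^{\pm1}$, produces a finite presentation of the subgroup $U\le G$ generated by the elements represented by $w_1,\dots,w_k$, that is, words $y_1,\dots,y_m$ representing generators of $U$ together with finitely many words $r_1,\dots,r_l$ in $m$ letters and their inverses, such that the kernel of the homomorphism from the free group on the $m$ letters onto $U$ sending the $i$-th letter to the element represented by $y_i$ is the normal closure of $r_1,\dots,r_l$. (Neither property depends on the choice of the finite generating tuple.) Let $\mathbb A$ be a finite graph of finitely generated groups such that all edge groups are finite and all vertex groups have solvable membership problem, let $v_0$ be a vertex of $\mathbb A$, and let $G=\pi_1(\mathbb A,v_0)$ be the group of equivalence classes of $\mathbb A$-paths from $v_0$ to $v_0$. Then $G$ is finitely generated and has solvable membership problem. If, in addition, every vertex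 group of $\mathbb A$ is effectively coherent, then $G$ is effectively coherent: there is an algorithm which, given a finite subset $S$ of $G$ (as words in a finite generating tuple of $G$), produces a finite presentation of the subgroup $\langle S\rangle\le G$. -/

import Mathlib

universe u₁ u₂ u₃ u₄

/-! ### Words, and the two algorithmic properties of groups -/

/-- The element of `G` represented by a word in the letters `x i` and their inverses:
`(i, true)` stands for `x i` and `(i, false)` for `(x i)⁻¹`. -/
def wordEval {G : Type u₁} [Group G] {ι : Type u₂} (x : ι → G) (w : List (ι × Bool)) : G :=
  FreeGroup.lift x (FreeGroup.mk w)

/-- The subgroup of `G` generated by the elements that a finite family of words represents. -/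
def wordSubgroup {G : Type u₁} [Group G] {ι : Type u₂} (x : ι → G)
    (S : List (List (ι × Bool))) : Subgroup G :=
  Subgroup.closure {g | ∃ w ∈ S, wordEval x w = g}

/-- There is an algorithm that, given words `u, w₁, …, wₖ` in the letters `x₁^±1, …, xₙ^±1`, decides
whether the element represented by `u` lies in the subgroup generated by those of `w₁, …, wₖ`. -/
def MembershipDecidable {G : Type u₁} [Group G] {n : ℕ} (x : Fin n → G) : Prop :=
  ComputablePred fun p : List (Fin n × Bool) × List (List (Fin n × Bool)) =>
    wordEval x p.1 ∈ wordSubgroup x p.2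

/-- `G` is finitely generated and has solvable (uniform) membership problem. The choice of the
finite generating tuple does not matter, see `HasSolvableMembershipProblem.membershipDecidable`. -/
def HasSolvableMembershipProblem (G : Type u₁) [Group G] : Prop :=
  ∃ (n : ℕ) (x : Fin n → G), Subgroup.closure (Set.range x) = ⊤ ∧ MembershipDecidable x

/-- The pair `P = (Y, R)` is a finite presentation of the subgroup `U` of `G`: `Y = (y₀, …, yₘ₋₁)` is
a finite list of words in the letters `x i` representing generators of `U`, `R` is a finite list of
words in the letters `0, …, m - 1` and their inverses, and the kernel of the homomorphism from
the free group on `m` letters onto `U` that sends the letter `i` to the element represented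
by `yᵢ` is the normal closure of `R`; that is, `U = ⟨y₀, …, yₘ₋₁ | R⟩`. -/
def IsFinitePresentationOf {G : Type u₁} [Group G] {ι : Type u₂} (x : ι → G)
    (P : List (List (ι × Bool)) × List (List (ℕ × Bool))) (U : Subgroup G) : Prop :=
  (FreeGroup.lift fun i : Fin P.1.length => wordEval x (P.1.get i)).range = U ∧
  ∃ R : List (List (Fin P.1.length × Bool)),
    P.2 = R.map (List.map (Prod.map Fin.val id)) ∧
    (FreeGroup.lift fun i : Fin P.1.length => wordEval x (P.1.get i)).ker =
      Subgroup.normalClosure {r | ∃ w ∈ R, FreeGroup.mk w = r}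

/-- There is an algorithm that, given finitely many words in the letters `x₁^±1, …, xₙ^±1`,
produces a finite presentation of the subgroup generated by the elements they represent. -/
def PresentationsComputable {G : Type u₁} [Group G] {n : ℕ} (x : Fin n → G) : Prop :=
  ∃ f : List (List (Fin n × Bool)) → List (List (Fin n × Bool)) × List (List (ℕ × Bool)),
    Computable f ∧ ∀ S, IsFinitePresentationOf x (f S) (wordSubgroup x S)

/-- `G` is finitely generated and effectively coherent: finite presentations of its finitely
generated subgroups can be computed from finite generating sets. The choice of the finite generating
tuple of `G` does not matter, see `EffectivelyCoherent.presentationsComputable`. -/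
def EffectivelyCoherent (G : Type u₁) [Group G] : Prop :=
  ∃ (n : ℕ) (x : Fin n → G), Subgroup.closure (Set.range x) = ⊤ ∧ PresentationsComputable x

/-! ### Independence of the finite generating tuple -/

theorem wordEval_nil {G : Type u₁} [Group G] {ι : Type u₂} (x : ι → G) : wordEval x [] = 1 := by
  simp [wordEval]

theorem wordEval_append {G : Type u₁} [Group G] {ι : Type u₂} (x : ι → G)
    (w w' : List (ι × Bool)) : wordEval x (w ++ w') = wordEval x w * wordEval x w' := by
  simp [wordEval, List.prod_append]

/-- Words in one finite generating tuple are computably rewritten as words in another. -/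
theorem exists_word_translation {G : Type u₁} [Group G] {m n : ℕ} (x : Fin m → G) (y : Fin n → G)
    (hy : Subgroup.closure (Set.range y) = ⊤) :
    ∃ T : List (Fin m × Bool) → List (Fin n × Bool),
      Primrec T ∧ ∀ w, wordEval y (T w) = wordEval x w := by
  have hsurj : ∀ g : G, ∃ w, wordEval y w = g := by
    intro g
    have hg : g ∈ (FreeGroup.lift y).range := by
      rw [FreeGroup.range_lift_eq_closure, hy]; trivial
    obtain ⟨a, ha⟩ := hg
    exact ⟨a.toWord, by simp only [wordEval, FreeGroup.mk_toWord]; exact ha⟩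
  choose W hW using hsurj
  refine ⟨fun w => w.flatMap fun l => W (wordEval x [l]), ?_, ?_⟩
  · refine Primrec.list_flatMap Primrec.id ?_
    exact (Primrec.dom_finite (fun l : Fin m × Bool => W (wordEval x [l]))).comp Primrec.snd
  · intro w
    induction w with
    | nil => simp [wordEval_nil]
    | cons l w ih =>
      simp only [List.flatMap_cons, wordEval_append, hW] at ih ⊢
      rw [ih, ← wordEval_append]; rfl

theorem wordSubgroup_map {G : Type u₁} [Group G] {m n : ℕ} {x : Fin m → G} {y : Fin n → G}
    {T : List (Fin m × Bool) → List (Fin n × Bool)} (hT : ∀ w, wordEval y (T w) = wordEval x w)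
    (S : List (List (Fin m × Bool))) : wordSubgroup y (S.map T) = wordSubgroup x S := by
  simp [wordSubgroup, hT]

theorem HasSolvableMembershipProblem.membershipDecidable {G : Type u₁} [Group G]
    (h : HasSolvableMembershipProblem G) {m : ℕ} (x : Fin m → G) : MembershipDecidable x := by
  obtain ⟨n, y, hy, hdec⟩ := h
  obtain ⟨T, hT, hTe⟩ := exists_word_translation x y hy
  have hf : Computable fun p : List (Fin m × Bool) × List (List (Fin m × Bool)) =>
      (T p.1, p.2.map T) :=
    (Primrec.pair (hT.comp Primrec.fst)
      (Primrec.list_map Primrec.snd (hT.comp Primrec.snd).to₂)).to_comp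
  refine (ComputablePred.computable_iff.1 hdec).elim fun d hd => ?_
  refine ComputablePred.computable_iff.2 ⟨fun p => d (T p.1, p.2.map T), hd.1.comp hf, ?_⟩
  funext p
  have := congrFun hd.2 (T p.1, p.2.map T)
  simp only [hTe, wordSubgroup_map hTe] at this
  exact this

theorem IsFinitePresentationOf.map {G : Type u₁} [Group G] {m n : ℕ} {x : Fin m → G}
    {y : Fin n → G} {T : List (Fin m × Bool) → List (Fin n × Bool)}
    (hT : ∀ w, wordEval y (T w) = wordEval x w)
    {P : List (List (Fin m × Bool)) × List (List (ℕ × Bool))} {U : Subgroup G}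
    (h : IsFinitePresentationOf x P U) : IsFinitePresentationOf y (P.1.map T, P.2) U := by
  have key : ∀ (k : ℕ) (Y : Fin k → G),
      ∀ (l : ℕ) (Z : Fin l → G) (e : k = l), (∀ i, Z (Fin.cast e i) = Y i) →
      ((FreeGroup.lift Y).range = U ∧ ∃ R : List (List (Fin k × Bool)),
        P.2 = R.map (List.map (Prod.map Fin.val id)) ∧
        (FreeGroup.lift Y).ker = Subgroup.normalClosure {r | ∃ w ∈ R, FreeGroup.mk w = r}) →
      ((FreeGroup.lift Z).range = U ∧ ∃ R : List (List (Fin l × Bool)),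
        P.2 = R.map (List.map (Prod.map Fin.val id)) ∧
        (FreeGroup.lift Z).ker = Subgroup.normalClosure {r | ∃ w ∈ R, FreeGroup.mk w = r}) := by
    intro k Y l Z e hZ hY
    subst e
    obtain rfl : Z = Y := funext hZ
    exact hY
  refine key _ _ _ _ (by simp) ?_ h
  intro i
  simp [hT]

theorem EffectivelyCoherent.presentationsComputable {G : Type u₁} [Group G]
    (h : EffectivelyCoherent G) {m : ℕ} (x : Fin m → G)
    (hx : Subgroup.closure (Set.range x) = ⊤) : PresentationsComputable x := by
  obtain ⟨n, y, hy, f, hf, hfe⟩ := h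
  obtain ⟨T, hT, hTe⟩ := exists_word_translation x y hy
  obtain ⟨T', hT', hTe'⟩ := exists_word_translation y x hx
  refine ⟨fun S => ((f (S.map T)).1.map T', (f (S.map T)).2), ?_, fun S => ?_⟩
  · have h1 : Computable fun S : List (List (Fin m × Bool)) => f (S.map T) :=
      hf.comp (Primrec.list_map Primrec.id (hT.comp Primrec.snd).to₂).to_comp
    have h2 : Primrec fun p : List (List (Fin n × Bool)) × List (List (ℕ × Bool)) =>
        (p.1.map T', p.2) :=
      Primrec.pair (Primrec.list_map Primrec.fst (hT'.comp Primrec.snd).to₂) Primrec.snd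
    exact h2.to_comp.comp h1
  · have := (hfe (S.map T)).map hTe'
    rwa [wordSubgroup_map hTe] at this

/-! ### Graphs of groups and their fundamental groups -/

set_option linter.checkUnivs false in
/-- A graph of groups on the graph with vertex set `V` whose set of edges is `E ⊔ E⁻¹`: the type `E`
holds one edge of each pair `e, e⁻¹`, so that `o(e⁻¹) = t(e)`, and the inverse edge `e⁻¹` has the
same group as `e`, with the two boundary monomorphisms interchanged. -/
structure GraphOfGroups (V : Type u₁) (E : Type u₂) where
  /-- the initial vertex -/
  o : E → V
  /-- the terminal vertex -/
  t : E → V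
  /-- the vertex groups -/
  vertexGroup : V → Type u₃
  /-- the edge groups -/
  edgeGroup : E → Type u₄
  [groupVertexGroup : ∀ v, Group (vertexGroup v)]
  [groupEdgeGroup : ∀ e, Group (edgeGroup e)]
  /-- the boundary monomorphism into the group of the initial vertex -/
  α : ∀ e, edgeGroup e →* vertexGroup (o e)
  /-- the boundary monomorphism into the group of the terminal vertex -/
  ω : ∀ e, edgeGroup e →* vertexGroup (t e)
  α_injective : ∀ e, Function.Injective (α e)
  ω_injective : ∀ e, Function.Injective (ω e)

namespace GraphOfGroups

attribute [instance] groupVertexGroup groupEdgeGroup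

variable {V : Type u₁} {E : Type u₂}

/-- `A.Path v w` is the type of sequences `a₀, e₁, a₁, …, eₖ, aₖ`, where `e₁, …, eₖ` is an edge path
from `v` to `w`, `a₀` lies in the group of `v`, and `aᵢ` in the group of the terminal vertex
of `eᵢ`. -/
inductive Path (A : GraphOfGroups.{u₁, u₂, u₃, u₄} V E) : V → V → Type (max u₁ u₂ u₃)
  /-- the path `a` of length zero -/
  | nil {v : V} (a : A.vertexGroup v) : Path A v v
  /-- the path `a, e, p` -/
  | fwd {w : V} (e : E) (a : A.vertexGroup (A.o e)) (p : Path A (A.t e) w) : Path A (A.o e) w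
  /-- the path `a, e⁻¹, p` -/
  | bwd {w : V} (e : E) (a : A.vertexGroup (A.t e)) (p : Path A (A.o e) w) : Path A (A.t e) w

variable {A : GraphOfGroups.{u₁, u₂, u₃, u₄} V E}

namespace Path

/-- Multiplies the first group element of a path by `b` on the left. -/
def mulLeft {v w : V} (b : A.vertexGroup v) : A.Path v w → A.Path v w
  | nil a => nil (b * a)
  | fwd e a p => fwd e (b * a) p
  | bwd e a p => bwd e (b * a) p

/-- Concatenation `(…, eₖ, aₖ)(b₀, f₁, …) = (…, eₖ, aₖ b₀, f₁, …)`. -/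
def concat {u v w : V} : A.Path u v → A.Path v w → A.Path u w
  | nil a, q => q.mulLeft a
  | fwd e a p, q => fwd e a (p.concat q)
  | bwd e a p, q => bwd e a (p.concat q)

/-- The inverse path `aₖ⁻¹, eₖ⁻¹, …, e₁⁻¹, a₀⁻¹`. -/
def reverse {v w : V} : A.Path v w → A.Path w v
  | nil a => nil a⁻¹
  | fwd e a p => p.reverse.concat (bwd e 1 (nil a⁻¹))
  | bwd e a p => p.reverse.concat (fwd e 1 (nil a⁻¹))

/-- The equivalence relation on paths generated, modulo concatenation, by
`a, e, ω_e(c), e⁻¹, a' ∼ a α_e(c) a'` for all oriented edges `e`. -/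
inductive Rel : ∀ {v w : V}, A.Path v w → A.Path v w → Prop
  | fwd_bwd (e : E) (a a' : A.vertexGroup (A.o e)) (c : A.edgeGroup e) :
      Rel (fwd e a (bwd e (A.ω e c) (nil a'))) (nil (a * A.α e c * a'))
  | bwd_fwd (e : E) (a a' : A.vertexGroup (A.t e)) (c : A.edgeGroup e) :
      Rel (bwd e a (fwd e (A.α e c) (nil a'))) (nil (a * A.ω e c * a'))
  | concat {u v w : V} {p p' : A.Path u v} {q q' : A.Path v w} :
      Rel p p' → Rel q q' → Rel (p.concat q) (p'.concat q')
  | refl {v w : V} (p : A.Path v w) : Rel p p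
  | symm {v w : V} {p q : A.Path v w} : Rel p q → Rel q p
  | trans {v w : V} {p q r : A.Path v w} : Rel p q → Rel q r → Rel p r

theorem mulLeft_one {v w : V} (p : A.Path v w) : p.mulLeft 1 = p := by
  cases p <;> simp [mulLeft]

theorem mulLeft_mulLeft {v w : V} (a b : A.vertexGroup v) (p : A.Path v w) :
    (p.mulLeft b).mulLeft a = p.mulLeft (a * b) := by
  cases p <;> simp [mulLeft, mul_assoc]

theorem mulLeft_concat {u v w : V} (a : A.vertexGroup u) (p : A.Path u v) (q : A.Path v w) :
    (p.mulLeft a).concat q = (p.concat q).mulLeft a := by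
  cases p with
  | nil b => exact (mulLeft_mulLeft a b q).symm
  | fwd e b p => rfl
  | bwd e b p => rfl

theorem concat_assoc {s u v w : V} (p : A.Path s u) (q : A.Path u v) (r : A.Path v w) :
    (p.concat q).concat r = p.concat (q.concat r) := by
  induction p with
  | nil a => simp [concat, mulLeft_concat]
  | fwd e a p ih => simp [concat, ih]
  | bwd e a p ih => simp [concat, ih]

theorem concat_nil_one {v w : V} (p : A.Path v w) : p.concat (nil 1) = p := by
  induction p with
  | nil a => simp [concat, mulLeft]
  | fwd e a p ih => simp [concat, ih]
  | bwd e a p ih => simp [concat, ih]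

theorem reverse_mulLeft {v w : V} (a : A.vertexGroup v) (p : A.Path v w) :
    (p.mulLeft a).reverse = p.reverse.concat (nil a⁻¹) := by
  cases p <;> simp [mulLeft, concat, reverse, concat_assoc]

theorem reverse_concat {u v w : V} (p : A.Path u v) (q : A.Path v w) :
    (p.concat q).reverse = q.reverse.concat p.reverse := by
  induction p with
  | nil a => simp [concat, reverse, reverse_mulLeft]
  | fwd e a p ih => simp [concat, reverse, ih, concat_assoc]
  | bwd e a p ih => simp [concat, reverse, ih, concat_assoc]

theorem Rel.reverse {v w : V} {p q : A.Path v w} (h : Rel p q) : Rel p.reverse q.reverse := by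
  induction h with
  | fwd_bwd e a a' c =>
    have := Rel.fwd_bwd e a'⁻¹ a⁻¹ c⁻¹
    simpa [Path.reverse, Path.concat, mulLeft, mul_assoc] using this
  | bwd_fwd e a a' c =>
    have := Rel.bwd_fwd e a'⁻¹ a⁻¹ c⁻¹
    simpa [Path.reverse, Path.concat, mulLeft, mul_assoc] using this
  | concat _ _ ih₁ ih₂ => rw [reverse_concat, reverse_concat]; exact ih₂.concat ih₁
  | refl p => exact .refl _
  | symm _ ih => exact ih.symm
  | trans _ _ ih₁ ih₂ => exact ih₁.trans ih₂

theorem rel_reverse_concat {v w : V} (p : A.Path v w) :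
    Rel (p.reverse.concat p) (nil 1) := by
  induction p with
  | nil a => simpa [Path.reverse, Path.concat, mulLeft] using Rel.refl _
  | fwd e a p ih =>
    refine Rel.trans ?_ ih
    have h := Rel.bwd_fwd (A := A) e 1 1 1
    have h' := ((Rel.refl p.reverse).concat h).concat (Rel.refl p)
    simp only [Path.concat, concat_assoc, map_one, mul_one, mulLeft_one] at h'
    simpa [Path.reverse, Path.concat, mulLeft, concat_assoc] using h'
  | bwd e a p ih =>
    refine Rel.trans ?_ ih
    have h := Rel.fwd_bwd (A := A) e 1 1 1
    have h' := ((Rel.refl p.reverse).concat h).concat (Rel.refl p)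
    simp only [Path.concat, concat_assoc, map_one, mul_one, mulLeft_one] at h'
    simpa [Path.reverse, Path.concat, mulLeft, concat_assoc] using h'

/-- The equivalence of paths from `v` to `w`. -/
def setoid (A : GraphOfGroups.{u₁, u₂, u₃, u₄} V E) (v w : V) : Setoid (A.Path v w) where
  r := Rel
  iseqv := ⟨Rel.refl, Rel.symm, Rel.trans⟩

end Path

/-- The fundamental group `π₁(A, v₀)`: equivalence classes of paths from `v₀` to `v₀`. -/
def FundamentalGroup (A : GraphOfGroups.{u₁, u₂, u₃, u₄} V E) (v₀ : V) : Type (max u₁ u₂ u₃) :=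
  Quotient (Path.setoid A v₀ v₀)

/-- The multiplication of `π₁(A, v₀)` is induced by concatenation. -/
instance instGroupFundamentalGroup (v₀ : V) : Group (A.FundamentalGroup v₀) where
  mul := Quotient.map₂ Path.concat fun _ _ h _ _ h' => Path.Rel.concat h h'
  one := Quotient.mk _ (Path.nil 1)
  inv := Quotient.map Path.reverse fun _ _ h => Path.Rel.reverse h
  mul_assoc := by
    rintro ⟨p⟩ ⟨q⟩ ⟨r⟩
    exact congrArg (Quotient.mk (Path.setoid A v₀ v₀)) (Path.concat_assoc p q r)
  one_mul := by
    rintro ⟨p⟩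
    exact congrArg (Quotient.mk (Path.setoid A v₀ v₀)) (Path.mulLeft_one p)
  mul_one := by
    rintro ⟨p⟩
    exact congrArg (Quotient.mk (Path.setoid A v₀ v₀)) (Path.concat_nil_one p)
  inv_mul_cancel := by
    rintro ⟨p⟩
    exact Quotient.sound (s := Path.setoid A v₀ v₀) (Path.rel_reverse_concat p)

end GraphOfGroups

-- Write G for the fundamental group and U for the subgroup generated by the given words S. Both
-- algorithms are unbounded searches; no folding and no normal forms are used. Since the vertex
-- groups have decidable word problem and the edge groups are finite, `ker_lift_pathGenerator` gives
-- a recursive presentation of G, so triviality of words and membership in U are semidecidable. It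
-- remains to certify that an element lies outside U, and that a finite list of relations of U
-- defines U.
--
-- A certificate refers to an auxiliary group L with elements yᵢ, one for each word Sᵢ. For every
-- vertex v it describes an (L × G_v)-set, as a union of coset spaces with finitely many listed
-- stabilizer generators, together with finitely many pairs of points joined by edges. If L acts
-- freely and the pairs generate equivariant partial bijections, `GraphOfGroups.exists_completion`
-- extends the data to an action of the whole graph of groups on larger sets, by an equivariant
-- Schröder–Bernstein argument. Thus G acts on the right on the set at v₀, commuting with L. Suppose
-- that each Sᵢ leads a point p to yᵢ p. The pairs (l, g) with p g = l p form a subgroup containing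
-- all (yᵢ, Sᵢ). Hence U keeps p in its L-orbit, so a word leading p to another orbit is not in U
-- (`EdgesValid.not_mem_wordSubgroup`; trivial L suffices). Moreover a word that is trivial in the
-- Sᵢ is trivial in the yᵢ, because L acts freely (`EdgesValid.wordEval_eq_one`). If L is defined by
-- relators that hold in U, then yᵢ ↦ Sᵢ is therefore an isomorphism from L to U.
--
-- Certificates exist because G acts freely on the classes of paths starting at v₀, commuting with
-- the vertex groups. Tracing finitely many words there involves finitely many edges and finitely
-- many stabilizer elements, and these depend on only finitely many relations of U
-- (`Certificate.exists_blocks`, `Coordinates.exists_certificate`).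
--
-- Certificates can be recognized: finite edge groups leave finitely many elements to test for each
-- pair of edges, the membership problem of the vertex groups certifies that orbits differ, and
-- effective coherence certifies freeness. Indeed, if the L-coordinates of stabilizer generators
-- satisfy the relators of a presentation of the projection to G_v, the stabilizer is the graph of a
-- homomorphism from that projection to L (`BlocksPresented.faithful`).

universe u₅ u₆
set_option autoImplicit false
set_option synthInstance.maxSize 2000

/-! ### Primitive recursive functions and semidecidable predicates -/

attribute [fun_prop] Primrec

section PrimrecRules

variable {α β γ σ : Type*} [Primcodable α] [Primcodable β] [Primcodable γ] [Primcodable σ]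

theorem primrec_fun_id : Primrec (fun a : α => a) := Primrec.id

theorem primrec_fun_comp {f : β → γ} {g : α → β} (hf : Primrec f) (hg : Primrec g) :
    Primrec (fun a => f (g a)) := hf.comp hg

theorem primrec_fun_const (b : β) : Primrec (fun _ : α => b) := Primrec.const b

theorem primrec_fun_pair {f : α → β} {g : α → γ} (hf : Primrec f) (hg : Primrec g) :
    Primrec (fun a => (f a, g a)) := hf.pair hg

theorem primrec_fun_fst {f : α → β × γ} (hf : Primrec f) : Primrec (fun a => (f a).1) :=
  Primrec.fst.comp hf

theorem primrec_fun_snd {f : α → β × γ} (hf : Primrec f) : Primrec (fun a => (f a).2) :=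
  Primrec.snd.comp hf

theorem primrec_fun_append {f g : α → List β} (hf : Primrec f) (hg : Primrec g) :
    Primrec (fun a => f a ++ g a) := Primrec.list_append.comp hf hg

theorem primrec_fun_cons {f : α → β} {g : α → List β} (hf : Primrec f) (hg : Primrec g) :
    Primrec (fun a => f a :: g a) := Primrec.list_cons.comp hf hg

theorem primrec_fun_map {f : α → List β} {g : α → β → γ} (hf : Primrec f)
    (hg : Primrec (fun p : α × β => g p.1 p.2)) : Primrec (fun a => (f a).map (g a)) :=
  Primrec.list_map hf hg

theorem primrec_fun_flatMap {f : α → List β} {g : α → β → List γ} (hf : Primrec f)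
    (hg : Primrec (fun p : α × β => g p.1 p.2)) : Primrec (fun a => (f a).flatMap (g a)) :=
  Primrec.list_flatMap hf hg

theorem primrec_fun_reverse {f : α → List β} (hf : Primrec f) :
    Primrec (fun a => (f a).reverse) := Primrec.list_reverse.comp hf

theorem primrec_fun_length {f : α → List β} (hf : Primrec f) :
    Primrec (fun a => (f a).length) := Primrec.list_length.comp hf

theorem primrec_fun_range {f : α → ℕ} (hf : Primrec f) :
    Primrec (fun a => List.range (f a)) := Primrec.list_range.comp hf

theorem primrec_fun_getD {f : α → List β} {g : α → ℕ} (d : β) (hf : Primrec f) (hg : Primrec g) :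
    Primrec (fun a => (f a).getD (g a) d) := (Primrec.list_getD d).comp hf hg

theorem primrec_fun_not {f : α → Bool} (hf : Primrec f) : Primrec (fun a => !(f a)) :=
  Primrec.not.comp hf

theorem primrec_fun_bif {c : α → Bool} {f g : α → β} (hc : Primrec c) (hf : Primrec f)
    (hg : Primrec g) : Primrec (fun a => bif c a then f a else g a) := Primrec.cond hc hf hg

attribute [fun_prop] primrec_fun_id primrec_fun_comp primrec_fun_const primrec_fun_pair
  primrec_fun_fst primrec_fun_snd primrec_fun_append primrec_fun_cons primrec_fun_map
  primrec_fun_flatMap primrec_fun_reverse primrec_fun_length primrec_fun_range primrec_fun_getD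
  primrec_fun_not primrec_fun_bif

end PrimrecRules

/-- A predicate is semidecidable if it is the projection of a primitive recursive one. -/
def Semidecidable {α : Type*} [Primcodable α] (p : α → Prop) : Prop :=
  ∃ q : α × ℕ → Prop, PrimrecPred q ∧ ∀ a, p a ↔ ∃ n, q (a, n)

namespace Semidecidable

variable {α β ι : Type*} [Primcodable α] [Primcodable β] [Primcodable ι]

theorem of_eq {p q : α → Prop} (hp : Semidecidable p) (h : ∀ a, q a ↔ p a) :
    Semidecidable q := by
  rwa [show q = p from funext fun a => propext (h a)]

theorem of_primrecPred {p : α → Prop} (hp : PrimrecPred p) : Semidecidable p :=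
  ⟨fun x => p x.1, hp.comp Primrec.fst, fun _ => by simp⟩

theorem comp {p : β → Prop} (hp : Semidecidable p) {f : α → β} (hf : Primrec f) :
    Semidecidable fun a => p (f a) := by
  obtain ⟨q, hq, h⟩ := hp
  exact ⟨fun x => q (f x.1, x.2), hq.comp (by fun_prop), fun a => h (f a)⟩

theorem eq {f g : α → β} (hf : Primrec f) (hg : Primrec g) :
    Semidecidable fun a => f a = g a := by
  classical
  exact of_primrecPred (Primrec.eq.comp hf hg)

theorem ne {f g : α → β} (hf : Primrec f) (hg : Primrec g) :
    Semidecidable fun a => f a ≠ g a := by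
  classical
  exact of_primrecPred (Primrec.eq.comp hf hg).not

theorem le {f g : α → ℕ} (hf : Primrec f) (hg : Primrec g) :
    Semidecidable fun a => f a ≤ g a :=
  of_primrecPred (Primrec.nat_le.comp hf hg)

theorem mem {f : α → β} {l : α → List β} (hf : Primrec f) (hl : Primrec l) :
    Semidecidable fun a => f a ∈ l a := by
  classical
  refine (of_primrecPred (PrimrecRel.comp (PrimrecRel.exists_mem_list
    (Primrec.eq (α := β))) hl hf)).of_eq fun a => ?_
  simp

theorem and {p q : α → Prop} (hp : Semidecidable p) (hq : Semidecidable q) :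
    Semidecidable fun a => p a ∧ q a := by
  obtain ⟨p', hp', h⟩ := hp
  obtain ⟨q', hq', h'⟩ := hq
  have hu : Primrec Nat.unpair := Primrec.unpair
  refine ⟨fun x => p' (x.1, x.2.unpair.1) ∧ q' (x.1, x.2.unpair.2), ?_, fun a => ?_⟩
  · exact (hp'.comp (by fun_prop)).and (hq'.comp (by fun_prop))
  · simp only [h, h']
    constructor
    · rintro ⟨⟨n, hn⟩, m, hm⟩
      exact ⟨Nat.pair n m, by simpa using ⟨hn, hm⟩⟩
    · rintro ⟨n, hn, hm⟩
      exact ⟨⟨_, hn⟩, _, hm⟩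

theorem or {p q : α → Prop} (hp : Semidecidable p) (hq : Semidecidable q) :
    Semidecidable fun a => p a ∨ q a := by
  obtain ⟨p', hp', h⟩ := hp
  obtain ⟨q', hq', h'⟩ := hq
  exact ⟨fun x => p' x ∨ q' x, hp'.or hq', fun a => by simp only [h, h', exists_or]⟩

theorem exists' {p : α × β → Prop} (hp : Semidecidable p) :
    Semidecidable fun a => ∃ b, p (a, b) := by
  classical
  obtain ⟨q, hq, h⟩ := hp
  obtain ⟨dq, hq⟩ := hq
  have hu : Primrec Nat.unpair := Primrec.unpair
  have hd : Primrec (Encodable.decode : ℕ → Option β) := Primrec.decode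
  have key : Primrec fun x : α × ℕ =>
      Option.casesOn (motive := fun _ => Bool) (Encodable.decode (α := β) x.2.unpair.1) false
        fun b => decide (q ((x.1, b), x.2.unpair.2)) := by
    refine Primrec.option_casesOn (by fun_prop) (Primrec.const false) ?_
    refine Primrec.to₂ (f := fun z : (α × ℕ) × β => decide (q ((z.1.1, z.2), z.1.2.unpair.2))) ?_
    exact hq.comp (f := fun z => decide (q z))
      (g := fun z : (α × ℕ) × β => ((z.1.1, z.2), z.1.2.unpair.2)) (by fun_prop)
  refine ⟨fun x => Option.casesOn (motive := fun _ => Bool)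
    (Encodable.decode (α := β) x.2.unpair.1) false
      (fun b => decide (q ((x.1, b), x.2.unpair.2))) = true,
    PrimrecPred.comp (p := fun b : Bool => b = true)
      (Primrec.eq.comp Primrec.id (Primrec.const true)) key, fun a => ?_⟩
  simp only [h]
  constructor
  · rintro ⟨b, n, hn⟩
    exact ⟨Nat.pair (Encodable.encode b) n, by simp [hn]⟩
  · rintro ⟨n, hn⟩
    cases hb : (Encodable.decode (α := β) n.unpair.1) with
    | none => simp [hb] at hn
    | some b => exact ⟨b, _, by simpa [hb] using hn⟩

theorem ex {p : α → β → Prop} (hp : Semidecidable fun x : α × β => p x.1 x.2) :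
    Semidecidable fun a => ∃ b, p a b := hp.exists'

/-- The members of a finite list have a common bound for their witnesses, and quantifiers bounded by
this number keep the predicate primitive recursive. -/
theorem forall_mem {l : α → List β} {p : α → β → Prop} (hl : Primrec l)
    (hp : Semidecidable fun x : α × β => p x.1 x.2) :
    Semidecidable fun a => ∀ b ∈ l a, p a b := by
  obtain ⟨q, hq, h⟩ := hp
  have h1 : PrimrecRel fun (n : ℕ) (y : α × β) => ∃ m ∈ List.range n, q (y, m) :=
    (PrimrecRel.exists_mem_list (R := fun (m : ℕ) (y : α × β) => q (y, m))
      (hq.comp (f := fun z : ℕ × α × β => (z.2, z.1)) (by fun_prop))).comp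
      (f := fun z : ℕ × α × β => List.range z.1) (g := fun z : ℕ × α × β => z.2)
      (by fun_prop) (by fun_prop)
  simp only [List.mem_range] at h1
  have h2 : PrimrecRel fun (b : β) (y : α × ℕ) => ∃ m < y.2, q ((y.1, b), m) :=
    PrimrecRel.comp h1 (f := fun z : β × α × ℕ => z.2.2)
      (g := fun z : β × α × ℕ => (z.2.1, z.1)) (by fun_prop) (by fun_prop)
  refine ⟨fun x => ∀ b ∈ l x.1, ∃ m < x.2, q ((x.1, b), m),
    PrimrecRel.comp (PrimrecRel.forall_mem_list h2) (f := fun x : α × ℕ => l x.1)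
      (g := fun x : α × ℕ => x) (by fun_prop) (by fun_prop), fun a => ?_⟩
  constructor
  · intro H
    replace H : ∀ b ∈ l a, ∃ n, q ((a, b), n) := fun b hb => (h (a, b)).1 (H b hb)
    choose! f hf using H
    refine ⟨((l a).map f).sum + 1, fun b hb => ⟨f b, ?_, hf b hb⟩⟩
    exact Nat.lt_succ_of_le (List.le_sum_of_mem (List.mem_map_of_mem hb))
  · rintro ⟨n, H⟩ b hb
    rw [show p a b ↔ _ from h (a, b)]
    obtain ⟨m, -, hm⟩ := H b hb
    exact ⟨m, hm⟩

theorem exists_mem {l : α → List β} {p : α → β → Prop} (hl : Primrec l)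
    (hp : Semidecidable fun x : α × β => p x.1 x.2) :
    Semidecidable fun a => ∃ b ∈ l a, p a b :=
  ex (p := fun a b => b ∈ l a ∧ p a b) ((mem (by fun_prop) (by fun_prop)).and hp)

/-- Running a code for `f` with a bound on the number of steps is primitive recursive; the bound is
the witness. -/
theorem of_computable {f : α → Bool} (hf : Computable f) :
    Semidecidable fun a => f a = true := by
  classical
  obtain ⟨c, hc⟩ := Nat.Partrec.Code.exists_code.1 (Partrec.nat_iff.1
    (Computable.partrec (Computable.encode_iff.2 (Computable.option_map
      (Computable.decode (α := α)) (hf.comp Computable.snd).to₂))))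
  have hev := Nat.Partrec.Code.primrec_evaln
  have key : Primrec fun x : α × ℕ =>
      Nat.Partrec.Code.evaln x.2 c (Encodable.encode x.1) :=
    hev.comp (g := fun x : α × ℕ => ((x.2, c), Encodable.encode x.1))
      (((Primrec.snd).pair (Primrec.const c)).pair (Primrec.encode.comp Primrec.fst))
  refine ⟨_, Primrec.eq.comp key (Primrec.const (some (Encodable.encode (some true)))), fun a => ?_⟩
  have := fun x => Nat.Partrec.Code.evaln_complete (c := c) (n := Encodable.encode a) (x := x)
  simp only [hc, PFun.coe_val, Encodable.encodek, Option.map_some, Part.mem_some_iff] at this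
  have h1 := this (Encodable.encode (some true))
  simp only [Option.mem_def] at h1
  rw [← h1]
  constructor
  · rintro h; rw [h]
  · intro h
    simpa using (Encodable.encode_injective h).symm

/-- Finitely many algorithms, chosen separately, combine into one by a case distinction on the
index. -/
theorem of_finite [Finite ι] {p : ι → α → Prop} (hp : ∀ i, Semidecidable (p i)) :
    Semidecidable fun x : ι × α => p x.1 x.2 := by
  classical
  cases nonempty_fintype ι
  have key : ∀ l : List ι, Semidecidable fun x : ι × α => x.1 ∈ l ∧ p x.1 x.2 := by
    intro l
    induction l with
    | nil =>
      refine (ne (f := fun _ : ι × α => 0) (g := fun _ => 0) (by fun_prop)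
        (by fun_prop)).of_eq fun a => by simp
    | cons i l ih =>
      refine (((eq (f := fun x : ι × α => x.1) (g := fun _ => i) (by fun_prop) (by fun_prop)).and
        ((hp i).comp (f := fun x : ι × α => x.2) (by fun_prop))).or ih).of_eq fun a => ?_
      constructor
      · rintro ⟨h, h'⟩
        rcases List.mem_cons.1 h with h | h
        · exact Or.inl ⟨h, h ▸ h'⟩
        · exact Or.inr ⟨h, h'⟩
      · rintro (⟨rfl, h⟩ | ⟨h, h'⟩)
        · exact ⟨by simp, h⟩
        · exact ⟨by simp [h], h'⟩
  exact (key Finset.univ.toList).of_eq fun a => by simp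

theorem reflTransGen {r : α → β → β → Prop}
    (hr : Semidecidable fun x : α × β × β => r x.1 x.2.1 x.2.2) :
    Semidecidable fun x : α × β × β => Relation.ReflTransGen (r x.1) x.2.1 x.2.2 := by
  -- The witness is the list of steps. The default value `(c, c)` past its end forces the last step
  -- to end in `c`, and the empty list to mean `b = c`.
  have key : ∀ (s : β → β → Prop) (b c : β), Relation.ReflTransGen s b c ↔
      ∃ l : List (β × β), (∀ n ∈ List.range l.length,
        (l.getD n (c, c)).2 = (l.getD (n + 1) (c, c)).1) ∧
        (l.getD 0 (c, c)).1 = b ∧ ∀ e ∈ l, s e.1 e.2 := by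
    intro s b c
    constructor
    · intro h
      induction h using Relation.ReflTransGen.head_induction_on with
      | refl => exact ⟨[], by simp⟩
      | @head b d hbd _ ih =>
        obtain ⟨l, h1, h2, h3⟩ := ih
        refine ⟨(b, d) :: l, ?_, rfl, ?_⟩
        · intro n hn
          cases n with
          | zero => simpa using h2.symm
          | succ n => simpa using h1 n (by simpa using hn)
        · simpa using ⟨hbd, fun x y h => h3 (x, y) h⟩
    · rintro ⟨l, h1, h2, h3⟩
      induction l generalizing b with
      | nil => simp at h2; subst h2; exact .refl
      | cons e l ih =>
        simp at h2
        subst h2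
        refine Relation.ReflTransGen.head (h3 e (by simp)) (ih _ ?_ ?_ fun e he => h3 e (by simp [he]))
        · intro n hn
          simpa using h1 (n + 1) (by simpa using hn)
        · simpa using (h1 0 (by simp)).symm
  refine Semidecidable.of_eq ?_ fun x => key (r x.1) x.2.1 x.2.2
  have hg : Primrec fun z : List (β × β) × ℕ × (β × β) => z.1.getD z.2.1 z.2.2 := by
    simp only [List.getD_eq_getElem?_getD]
    exact Primrec.option_getD.comp
      (Primrec.list_getElem?.comp (by fun_prop) (by fun_prop)) (by fun_prop)
  have hg' : ∀ {δ : Type _} [Primcodable δ] {f : δ → List (β × β)} {n : δ → ℕ} {d : δ → β × β},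
      Primrec f → Primrec n → Primrec d → Primrec fun a => (f a).getD (n a) (d a) :=
    fun hf hn hd => hg.comp (hf.pair (hn.pair hd))
  refine ex (and ?_ (and ?_ ?_))
  · refine forall_mem (by fun_prop) (eq ?_ ?_)
    · exact Primrec.snd.comp (hg' (by fun_prop) (by fun_prop) (by fun_prop))
    · exact Primrec.fst.comp (hg' (by fun_prop) (Primrec.succ.comp (by fun_prop)) (by fun_prop))
  · refine eq (Primrec.fst.comp (hg' (by fun_prop) (by fun_prop) (by fun_prop))) (by fun_prop)
  · refine forall_mem (by fun_prop) (hr.comp (f := fun x : ((α × β × β) × List (β × β)) × β × β =>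
      (x.1.1.1, x.2.1, x.2.2)) (by fun_prop))

/-- Unbounded search for a witness of a semidecidable relation. -/
theorem exists_computable {p : α × β → Prop} (hp : Semidecidable p) (h : ∀ a, ∃ b, p (a, b)) :
    ∃ f : α → β, Computable f ∧ ∀ a, p (a, f a) := by
  classical
  obtain ⟨q, ⟨dq, hq⟩, hpq⟩ := hp
  have hu : Primrec Nat.unpair := Primrec.unpair
  let g : α → ℕ → Option β := fun a n =>
    Option.casesOn (motive := fun _ => Option β) (Encodable.decode (α := β) n.unpair.1) none
      fun b => bif decide (q ((a, b), n.unpair.2)) then some b else none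
  have hg : Primrec₂ g := by
    have hd : Primrec (Encodable.decode : ℕ → Option β) := Primrec.decode
    refine Primrec.option_casesOn (by fun_prop) (Primrec.const none) ?_
    refine Primrec.cond (hq.comp (f := fun z => decide (q z))
      (g := fun z : (α × ℕ) × β => ((z.1.1, z.2), z.1.2.unpair.2)) (by fun_prop))
      (Primrec.option_some.comp (by fun_prop)) (Primrec.const none)
  have hdom : ∀ a, (Nat.rfindOpt (g a)).Dom := by
    intro a
    obtain ⟨b, hb⟩ := h a
    obtain ⟨n, hn⟩ := (hpq _).1 hb
    exact Nat.rfindOpt_dom.2 ⟨Nat.pair (Encodable.encode b) n, b, by simp [g, hn]⟩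
  refine ⟨fun a => (Nat.rfindOpt (g a)).get (hdom a),
    Partrec.of_eq_tot (Partrec.rfindOpt hg.to_comp) fun a => Part.get_mem _, fun a => ?_⟩
  obtain ⟨n, hn⟩ := Nat.rfindOpt_spec (Part.get_mem (hdom a))
  rw [hpq]
  refine ⟨n.unpair.2, ?_⟩
  beta_reduce
  generalize (Nat.rfindOpt (g a)).get (hdom a) = b at hn
  cases hb : (Encodable.decode (α := β) n.unpair.1) with
  | none => simp [g, hb] at hn
  | some b' =>
    simp only [g, hb, Option.mem_def] at hn
    by_cases hq' : q ((a, b'), n.unpair.2)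
    · simp only [hq', decide_true, cond_true, Option.some.injEq] at hn
      subst hn
      exact hq'
    · simp [hq'] at hn

/-- Post's theorem: search for a witness of either alternative. -/
theorem computablePred {p : α → Prop} (hp : Semidecidable p) (hn : Semidecidable fun a => ¬ p a) :
    ComputablePred p := by
  classical
  obtain ⟨f, hf, h⟩ := exists_computable (α := α) (β := Bool)
    (p := fun x => (x.2 = true ∧ p x.1) ∨ (x.2 = false ∧ ¬ p x.1))
    (((eq (by fun_prop) (by fun_prop)).and (hp.comp (by fun_prop))).or
      ((eq (by fun_prop) (by fun_prop)).and (hn.comp (f := Prod.fst) (by fun_prop))))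
    fun a => by by_cases ha : p a <;> simp [ha]
  refine ComputablePred.computable_iff.2 ⟨f, hf, funext fun a => ?_⟩
  have := h a
  cases hfa : f a <;> simp_all

theorem of_computablePred {p : α → Prop} (hp : ComputablePred p) : Semidecidable p := by
  obtain ⟨f, hf, rfl⟩ := ComputablePred.computable_iff.1 hp
  exact of_computable hf

theorem graph {f : α → β} (hf : Computable f) : Semidecidable fun x : α × β => f x.1 = x.2 := by
  classical
  refine (of_computable (f := fun x : α × β => decide (f x.1 = x.2)) ?_).of_eq (by simp)
  have : Primrec fun x : β × β => decide (x.1 = x.2) := by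
    exact (Primrec.eq (α := β)).decide
  exact this.to_comp.comp ((hf.comp Computable.fst).pair Computable.snd)

end Semidecidable

/-! ### Extending partial equivariant bijections -/

section EquivariantBijections

variable {P X Y I : Type*} [Group P]

/-- The points at which the Schröder–Bernstein bijection of `f` and `g` takes the value of `f`. -/
inductive SchroederBernsteinSet (f : X → Y) (g : Y → X) : X → Prop
  | base {x : X} : (∀ y, g y ≠ x) → SchroederBernsteinSet f g x
  | step {x : X} : SchroederBernsteinSet f g x → SchroederBernsteinSet f g (g (f x))

theorem SchroederBernsteinSet.smul {f : X → Y} {g : Y → X} {a : P →* Equiv.Perm X}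
    {b : P →* Equiv.Perm Y} (hf : ∀ p x, f (a p x) = b p (f x)) (hg : ∀ p y, g (b p y) = a p (g y))
    {x : X} (h : SchroederBernsteinSet f g x) (p : P) : SchroederBernsteinSet f g (a p x) := by
  induction h with
  | @base x h =>
    refine .base fun y hy => h (b p⁻¹ y) ?_
    rw [hg, hy]
    simp
  | @step x _ ih =>
    rw [← hg, ← hf]
    exact .step ih

/-- The Schröder–Bernstein bijection uses `f` on `SchroederBernsteinSet f g` and the inverse of `g`
elsewhere; it is equivariant since this set is invariant. The last clause of the conclusion makes it
possible to prescribe values. -/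
theorem exists_equivariant_equiv (a : P →* Equiv.Perm X) (b : P →* Equiv.Perm Y) {f : X → Y}
    {g : Y → X} (hf : f.Injective) (hg : g.Injective) (hfe : ∀ p x, f (a p x) = b p (f x))
    (hge : ∀ p y, g (b p y) = a p (g y)) :
    ∃ e : X ≃ Y, (∀ p x, e (a p x) = b p (e x)) ∧ ∀ x, e x = f x ∨ g (e x) = x := by
  classical
  have hex : ∀ x, ∃ y, (SchroederBernsteinSet f g x ∧ y = f x) ∨
      (¬ SchroederBernsteinSet f g x ∧ g y = x) := by
    intro x
    by_cases hx : SchroederBernsteinSet f g x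
    · exact ⟨f x, Or.inl ⟨hx, rfl⟩⟩
    · have : ∃ y, g y = x := by
        by_contra h
        exact hx (.base fun y hy => h ⟨y, hy⟩)
      obtain ⟨y, hy⟩ := this
      exact ⟨y, Or.inr ⟨hx, hy⟩⟩
  choose e he using hex
  have hinj : e.Injective := by
    intro x x' hxx'
    rcases he x with ⟨h1, h2⟩ | ⟨h1, h2⟩ <;> rcases he x' with ⟨h1', h2'⟩ | ⟨h1', h2'⟩
    · exact hf (h2.symm.trans (hxx'.trans h2'))
    · exact absurd (by rw [← h2', ← hxx', h2]; exact .step h1) h1'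
    · exact absurd (by rw [← h2, hxx', h2']; exact .step h1') h1
    · exact h2.symm.trans ((congrArg g hxx').trans h2')
  have hsurj : e.Surjective := by
    intro y
    by_cases hy : SchroederBernsteinSet f g (g y)
    · generalize hx : g y = x at hy
      cases hy with
      | base h => exact absurd hx (h y)
      | @step x hx' =>
        refine ⟨x, ?_⟩
        rcases he x with ⟨-, h2⟩ | ⟨h1, -⟩
        · exact h2.trans (hg hx).symm
        · exact absurd hx' h1
    · refine ⟨g y, ?_⟩
      rcases he (g y) with ⟨h1, -⟩ | ⟨-, h2⟩
      · exact absurd h1 hy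
      · exact hg h2
  refine ⟨Equiv.ofBijective e ⟨hinj, hsurj⟩, fun p x => ?_, fun x => ?_⟩
  · change e (a p x) = b p (e x)
    rcases he x with ⟨h1, h2⟩ | ⟨h1, h2⟩
    · rcases he (a p x) with ⟨h1', h2'⟩ | ⟨h1', h2'⟩
      · rw [h2', h2, hfe]
      · exact absurd (h1.smul hfe hge p) h1'
    · rcases he (a p x) with ⟨h1', h2'⟩ | ⟨h1', h2'⟩
      · have := h1'.smul hfe hge p⁻¹
        rw [← Equiv.Perm.mul_apply, ← map_mul, inv_mul_cancel, map_one] at this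
        exact absurd this h1
      · exact hg (by rw [h2', hge, h2])
  · rcases he x with ⟨-, h2⟩ | ⟨-, h2⟩
    · exact Or.inl h2
    · exact Or.inr h2

/-- An equivariant injection can be modified on given orbits, provided that it avoids
their prescribed images. -/
theorem exists_equivariant_injective (a : P →* Equiv.Perm X) (b : P →* Equiv.Perm Y)
    {x : I → X} {y : I → Y} (hxy : ∀ i j p, a p (x i) = x j ↔ b p (y i) = y j) {f : X → Y}
    (hf : f.Injective) (hfe : ∀ p x, f (a p x) = b p (f x)) (hfy : ∀ p x i, f x ≠ b p (y i)) :
    ∃ f' : X → Y, f'.Injective ∧ (∀ p x, f' (a p x) = b p (f' x)) ∧ ∀ i, f' (x i) = y i := by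
  classical
  -- The rule `a p (x i) ↦ b p (y i)` is thus well defined and injective on the given orbits.
  have hxy' : ∀ i j p q, a p (x i) = a q (x j) ↔ b p (y i) = b q (y j) := by
    intro i j p q
    have := hxy i j (q⁻¹ * p)
    rwa [map_mul, map_mul, map_inv, map_inv, Equiv.Perm.mul_apply, Equiv.Perm.mul_apply,
      Equiv.Perm.inv_eq_iff_eq, Equiv.Perm.inv_eq_iff_eq] at this
  have hex : ∀ z, ∃ w, (∀ p i, z = a p (x i) → w = b p (y i)) ∧
      ((∀ p i, z ≠ a p (x i)) → w = f z) := by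
    intro z
    by_cases hz : ∃ p i, z = a p (x i)
    · obtain ⟨p, i, rfl⟩ := hz
      exact ⟨b p (y i), fun q j h => (hxy' _ _ _ _).1 h, fun h => absurd rfl (h p i)⟩
    · push Not at hz
      exact ⟨f z, fun p i h => absurd h (hz p i), fun _ => rfl⟩
  choose f' h1 h2 using hex
  refine ⟨f', ?_, ?_, ?_⟩
  · intro z z' h
    by_cases hz : ∃ p i, z = a p (x i) <;> by_cases hz' : ∃ p i, z' = a p (x i)
    · obtain ⟨p, i, hz⟩ := hz
      obtain ⟨q, j, hz'⟩ := hz'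
      rw [h1 z p i hz, h1 z' q j hz', ← hxy'] at h
      rw [hz, hz', h]
    · obtain ⟨p, i, hz⟩ := hz
      push Not at hz'
      rw [h1 z p i hz, h2 z' hz'] at h
      exact absurd h.symm (hfy _ _ _)
    · obtain ⟨p, i, hz'⟩ := hz'
      push Not at hz
      rw [h1 z' p i hz', h2 z hz] at h
      exact absurd h (hfy _ _ _)
    · push Not at hz hz'
      rw [h2 z hz, h2 z' hz'] at h
      exact hf h
  · intro p z
    by_cases hz : ∃ p i, z = a p (x i)
    · obtain ⟨q, i, hz⟩ := hz
      rw [h1 z q i hz, h1 (a p z) (p * q) i (by rw [hz]; simp)]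
      simp
    · push Not at hz
      rw [h2 z hz, h2 (a p z), hfe]
      intro q i h
      refine hz (p⁻¹ * q) i ?_
      rw [map_mul, Equiv.Perm.mul_apply, ← h]
      simp
  · intro i
    simpa using h1 (x i) 1 i (by simp)

/-- After `f` and `g` are modified to exchange `x i` and `y i`, both alternatives for the
Schröder–Bernstein bijection send `x i` to `y i`. -/
theorem exists_equivariant_equiv_extending (a : P →* Equiv.Perm X) (b : P →* Equiv.Perm Y)
    {x : I → X} {y : I → Y} (hxy : ∀ i j p, a p (x i) = x j ↔ b p (y i) = y j)
    {f : X → Y} (hf : f.Injective) (hfe : ∀ p x, f (a p x) = b p (f x))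
    (hfy : ∀ p x i, f x ≠ b p (y i))
    {g : Y → X} (hg : g.Injective) (hge : ∀ p y, g (b p y) = a p (g y))
    (hgx : ∀ p y i, g y ≠ a p (x i)) :
    ∃ e : X ≃ Y, (∀ p x, e (a p x) = b p (e x)) ∧ ∀ i, e (x i) = y i := by
  obtain ⟨f', hf', hfe', hfx'⟩ := exists_equivariant_injective a b hxy hf hfe hfy
  obtain ⟨g', hg', hge', hgx'⟩ :=
    exists_equivariant_injective b a (fun i j p => (hxy i j p).symm) hg hge hgx
  obtain ⟨e, he, h⟩ := exists_equivariant_equiv a b hf' hg' hfe' hge'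
  refine ⟨e, he, fun i => ?_⟩
  rcases h (x i) with h | h
  · rw [h, hfx']
  · exact hg' (by rw [h, hgx'])

/-- Every action of `P` embeds into a disjoint union of copies of the action of `Q ≥ P` on its
subsets by translations. -/
theorem exists_equivariant_embedding {Q Θ : Type*} [Group Q] (a : P →* Equiv.Perm X) (b : P →* Q)
    (hb : Function.Injective b) {code : X → Θ} (hcode : code.Injective) :
    ∃ f : X → Θ × Set Q, f.Injective ∧
      ∀ p x, f (a p x) = ((f x).1, (fun q => b p * q) '' (f x).2) := by
  let s : Setoid X :=
    { r := fun x y => ∃ p, a p x = y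
      iseqv := ⟨fun x => ⟨1, by simp⟩, by
        rintro x y ⟨p, rfl⟩
        exact ⟨p⁻¹, by simp⟩, by
        rintro x y z ⟨p, rfl⟩ ⟨q, rfl⟩
        exact ⟨q * p, by simp⟩⟩ }
  let r : X → X := fun x => (Quotient.mk s x).out
  have hr : ∀ x, ∃ p, a p (r x) = x := fun x => Quotient.mk_out (s := s) x
  have hr' : ∀ p x, r (a p x) = r x := fun p x =>
    congrArg Quotient.out (Quotient.sound (s := s) ⟨p⁻¹, by simp⟩)
  -- The code of a representative names the orbit. The point itself is recorded by the set of group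
  -- elements that carry the representative to it, on which `P` acts by left translation.
  refine ⟨fun x => (code (r x), b '' {p | a p (r x) = x}), ?_, ?_⟩
  · intro x x' h
    obtain ⟨h1, h2⟩ := Prod.ext_iff.1 h
    have h1 : r x = r x' := hcode h1
    obtain ⟨p, hp⟩ := hr x
    have h3 : b p ∈ b '' {p | a p (r x) = x} := ⟨p, hp, rfl⟩
    change b '' {p | a p (r x) = x} = b '' {p | a p (r x') = x'} at h2
    rw [h2] at h3
    obtain ⟨p', hp', hpp'⟩ := h3
    rw [← hp, ← show a p' (r x') = x' from hp', hb hpp', h1]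
  · intro p x
    refine Prod.ext (by simp [hr']) ?_
    ext q
    constructor
    · rintro ⟨p', hp', rfl⟩
      refine ⟨b (p⁻¹ * p'), ⟨p⁻¹ * p', ?_, rfl⟩, by simp⟩
      change a (p⁻¹ * p') (r x) = x
      change a p' (r (a p x)) = a p x at hp'
      rw [map_mul, Equiv.Perm.mul_apply, ← hr' p x, hp']
      simp
    · rintro ⟨_, ⟨p', hp', rfl⟩, rfl⟩
      refine ⟨p * p', ?_, by simp⟩
      change a (p * p') (r (a p x)) = a p x
      change a p' (r x) = x at hp'
      rw [hr', map_mul, Equiv.Perm.mul_apply, hp']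

end EquivariantBijections

/-- The disjoint union of a `Q`-set `Z` and `Θ` copies of the action of `Q` on its subsets. -/
def AbsorbingExtension (Q : Type*) (Z : Type*) (Θ : Type*) := Z ⊕ Θ × Set Q

instance {Q Z Θ : Type*} [Group Q] [MulAction Q Z] : MulAction Q (AbsorbingExtension Q Z Θ) where
  smul q z := Sum.map (fun z => q • z) (fun w => (w.1, (fun r => q * r) '' w.2)) z
  one_smul := by
    rintro (z | ⟨θ, s⟩)
    · exact congrArg Sum.inl (one_smul Q z)
    · exact congrArg Sum.inr (Prod.ext rfl (by simp))
  mul_smul := by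
    rintro p q (z | ⟨θ, s⟩)
    · exact congrArg Sum.inl (mul_smul p q z)
    · refine congrArg Sum.inr (Prod.ext rfl ?_)
      simp only [Set.image_image, mul_assoc]

/-! ### Actions of a graph of groups and completion of partial actions -/

namespace GraphOfGroups

variable {V : Type u₁} {E : Type u₂} (A : GraphOfGroups.{u₁, u₂, u₃, u₄} V E)

/-- An action of a graph of groups on a family of sets, commuting with an action of `L`. -/
structure EquivariantAction (L : Type u₅) [Group L] where
  /-- the sets on which the vertex groups act -/
  carrier : V → Type u₆
  [mulAction : ∀ v, MulAction (L × A.vertexGroup v) (carrier v)]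
  /-- the bijections given by the edges -/
  τ : ∀ e, carrier (A.o e) ≃ carrier (A.t e)
  τ_smul : ∀ (e : E) (l : L) (c : A.edgeGroup e) (z : carrier (A.o e)),
    τ e ((l, A.α e c) • z) = (l, A.ω e c) • τ e z

attribute [instance] EquivariantAction.mulAction

variable {A}

/-- The hypothesis `h` says that the assignment `x e i ↦ y e i` generates a partial bijection
equivariant under `L` and the edge group. To extend it to all points, the sets are first enlarged
until the two ends of every edge embed into the new part of each other; then the equivariant
Schröder–Bernstein argument applies to each edge separately. -/
theorem exists_completion {L : Type u₅} [Group L] (Z : V → Type u₆)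
    [∀ v, MulAction (L × A.vertexGroup v) (Z v)] {I : E → Type*}
    (x : ∀ e, I e → Z (A.o e)) (y : ∀ e, I e → Z (A.t e))
    (h : ∀ (e : E) (i j : I e) (l : L) (c : A.edgeGroup e), (l, A.α e c) • x e i = x e j ↔ (l, A.ω e c) • y e i = y e j) :
    ∃ (B : EquivariantAction.{u₁, u₂, u₃, u₄, u₅, max u₁ u₃ u₅ u₆} A L) (ι : ∀ v, Z v → B.carrier v),
      (∀ v, Function.Injective (ι v)) ∧ (∀ v (q : L × A.vertexGroup v) z, ι v (q • z) = q • ι v z) ∧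
      ∀ e i, B.τ e (ι _ (x e i)) = ι _ (y e i) := by
  -- Lists are used so that the enlarged sets, whose definition involves `Θ`, embed into `Θ` again:
  -- a new point `(θ, s)` is encoded by putting `s` in front of `θ`.
  let Θ := List ((Σ v, Z v) ⊕ (Σ v, Set (L × A.vertexGroup v)))
  let Z' := fun v => AbsorbingExtension (L × A.vertexGroup v) (Z v) Θ
  let code : ∀ v, Z' v → Θ := fun v z => Sum.elim (fun z => [Sum.inl ⟨v, z⟩])
    (fun w => Sum.inr ⟨v, w.2⟩ :: w.1) z
  have hcode : ∀ v, Function.Injective (code v) := by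
    rintro v (z | ⟨θ, s⟩) (z' | ⟨θ', s'⟩) h
    all_goals cases h <;> rfl
  let a : ∀ e, L × A.edgeGroup e →* L × A.vertexGroup (A.o e) := fun e =>
    (MonoidHom.id L).prodMap (A.α e)
  let b : ∀ e, L × A.edgeGroup e →* L × A.vertexGroup (A.t e) := fun e =>
    (MonoidHom.id L).prodMap (A.ω e)
  have ha : ∀ e, Function.Injective (a e) := fun e =>
    Function.Injective.prodMap Function.injective_id (A.α_injective e)
  have hb : ∀ e, Function.Injective (b e) := fun e =>
    Function.Injective.prodMap Function.injective_id (A.ω_injective e)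
  have key : ∀ e, ∃ τ : Z' (A.o e) ≃ Z' (A.t e), (∀ p z, τ (a e p • z) = b e p • τ z) ∧
      ∀ i, τ (Sum.inl (x e i)) = Sum.inl (y e i) := by
    intro e
    let pa := (MulAction.toPermHom (L × A.vertexGroup (A.o e)) (Z' (A.o e))).comp (a e)
    let pb := (MulAction.toPermHom (L × A.vertexGroup (A.t e)) (Z' (A.t e))).comp (b e)
    obtain ⟨f, hf, hfe⟩ := exists_equivariant_embedding pa (b e) (hb e) (hcode _)
    obtain ⟨g, hg, hge⟩ := exists_equivariant_embedding pb (a e) (ha e) (hcode _)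
    -- Both embeddings take values in the new summand, so they avoid the orbits of the prescribed
    -- points, which lie in the old one.
    refine exists_equivariant_equiv_extending pa pb
      (x := fun i => Sum.inl (x e i)) (y := fun i => Sum.inl (y e i)) ?_
      (f := fun z => Sum.inr (f z)) (Sum.inr_injective.comp hf) ?_ ?_
      (g := fun z => Sum.inr (g z)) (Sum.inr_injective.comp hg) ?_ ?_
    · rintro i j ⟨l, c⟩
      exact (Sum.inl_injective.eq_iff).trans ((h e i j l c).trans Sum.inl_injective.eq_iff.symm)
    · exact fun p z => congrArg Sum.inr (hfe p z)
    · exact fun p z i h => by cases h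
    · exact fun p z => congrArg Sum.inr (hge p z)
    · exact fun p z i h => by cases h
  choose τ hτ hτx using key
  exact ⟨{ carrier := Z', τ := τ, τ_smul := fun e l c z => hτ e (l, c) z }, fun v z => Sum.inl z,
    fun v => Sum.inl_injective, fun v q z => rfl, fun e i => hτx e i⟩

namespace EquivariantAction

variable {L : Type*} [Group L] (B : EquivariantAction A L)

/-- The right action of paths. -/
def act : ∀ {v w : V}, A.Path v w → B.carrier v → B.carrier w
  | v, _, .nil a, z => ((1, a⁻¹) : L × A.vertexGroup v) • z
  | _, _, .fwd e a p, z => act p (B.τ e (((1, a⁻¹) : L × A.vertexGroup (A.o e)) • z))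
  | _, _, .bwd e a p, z => act p ((B.τ e).symm (((1, a⁻¹) : L × A.vertexGroup (A.t e)) • z))

theorem act_mulLeft {v w : V} (b : A.vertexGroup v) (p : A.Path v w) (z : B.carrier v) :
    B.act (p.mulLeft b) z = B.act p (((1, b⁻¹) : L × A.vertexGroup v) • z) := by
  cases p <;> simp [Path.mulLeft, act, smul_smul]

theorem act_concat {u v w : V} (p : A.Path u v) (q : A.Path v w) (z : B.carrier u) :
    B.act (p.concat q) z = B.act q (B.act p z) := by
  induction p with
  | nil a => simp [Path.concat, act, act_mulLeft]
  | fwd e a p ih => simp [Path.concat, act, ih]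
  | bwd e a p ih => simp [Path.concat, act, ih]

theorem τ_symm_smul (e : E) (l : L) (c : A.edgeGroup e) (z : B.carrier (A.t e)) :
    (B.τ e).symm ((l, A.ω e c) • z) = (l, A.α e c) • (B.τ e).symm z := by
  rw [Equiv.symm_apply_eq, B.τ_smul, Equiv.apply_symm_apply]

theorem act_smul {v w : V} (p : A.Path v w) (l : L) (z : B.carrier v) :
    B.act p (((l, 1) : L × A.vertexGroup v) • z) = ((l, 1) : L × A.vertexGroup w) • B.act p z := by
  induction p with
  | nil a => simp [act, smul_smul]
  | fwd e a p ih =>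
    simp only [act, smul_smul, Prod.mk_mul_mk, one_mul, mul_one, ← ih]
    rw [← map_one (A.ω e), ← B.τ_smul]
    simp [smul_smul]
  | bwd e a p ih =>
    simp only [act, smul_smul, Prod.mk_mul_mk, one_mul, mul_one, ← ih]
    rw [← map_one (A.α e), ← B.τ_symm_smul]
    simp [smul_smul]

theorem act_eq_of_rel {v w : V} {p q : A.Path v w} (h : Path.Rel p q) (z : B.carrier v) :
    B.act p z = B.act q z := by
  induction h with
  | fwd_bwd e a a' c =>
    simp only [act, ← map_inv, B.τ_symm_smul, Equiv.symm_apply_apply, smul_smul]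
    simp [mul_assoc]
  | bwd_fwd e a a' c =>
    simp only [act, ← map_inv, B.τ_smul, Equiv.apply_symm_apply, smul_smul]
    simp [mul_assoc]
  | concat _ _ ih₁ ih₂ => rw [act_concat, act_concat, ih₁, ih₂]
  | refl p => rfl
  | symm _ ih => exact (ih z).symm
  | trans _ _ ih₁ ih₂ => exact (ih₁ z).trans (ih₂ z)

/-- The right action of the fundamental group. -/
def rightAct {v₀ : V} (g : A.FundamentalGroup v₀) (z : B.carrier v₀) : B.carrier v₀ :=
  Quotient.lift (fun p => B.act p z) (fun _ _ h => B.act_eq_of_rel h z) g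

theorem rightAct_one {v₀ : V} (z : B.carrier v₀) :
    B.rightAct (1 : A.FundamentalGroup v₀) z = z := by
  change B.act (Path.nil 1) z = z
  simp [act, ← Prod.one_eq_mk]

theorem rightAct_mul {v₀ : V} (g h : A.FundamentalGroup v₀) (z : B.carrier v₀) :
    B.rightAct (g * h) z = B.rightAct h (B.rightAct g z) := by
  induction g using Quotient.inductionOn
  induction h using Quotient.inductionOn
  exact B.act_concat _ _ z

theorem rightAct_smul {v₀ : V} (g : A.FundamentalGroup v₀) (l : L) (z : B.carrier v₀) :
    B.rightAct g (((l, 1) : L × A.vertexGroup v₀) • z) =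
      ((l, 1) : L × A.vertexGroup v₀) • B.rightAct g z := by
  induction g using Quotient.inductionOn
  exact B.act_smul _ l z

end EquivariantAction

end GraphOfGroups

/-! ### Words in semidecidably presented groups -/

section Rewriting

variable {X : Type*}

/-- The insertion or the deletion of one of the words in `R`, or of `x x⁻¹` or `x⁻¹ x`. -/
def RewriteStep (R : List (X × Bool) → Prop) (w w' : List (X × Bool)) : Prop :=
  ∃ a b r : List (X × Bool), (R r ∨ ∃ x, r = [x, (x.1, !x.2)]) ∧
    ((w = a ++ r ++ b ∧ w' = a ++ b) ∨ (w = a ++ b ∧ w' = a ++ r ++ b))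

variable {R : List (X × Bool) → Prop}

theorem RewriteStep.symm {w w' : List (X × Bool)} (h : RewriteStep R w w') :
    RewriteStep R w' w := by
  obtain ⟨a, b, r, hr, h | h⟩ := h
  · exact ⟨a, b, r, hr, Or.inr ⟨h.2, h.1⟩⟩
  · exact ⟨a, b, r, hr, Or.inl ⟨h.2, h.1⟩⟩

theorem RewriteStep.append {w w' : List (X × Bool)} (h : RewriteStep R w w')
    (c d : List (X × Bool)) : RewriteStep R (c ++ w ++ d) (c ++ w' ++ d) := by
  obtain ⟨a, b, r, hr, ⟨rfl, rfl⟩ | ⟨rfl, rfl⟩⟩ := h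
  · exact ⟨c ++ a, b ++ d, r, hr, Or.inl ⟨by simp, by simp⟩⟩
  · exact ⟨c ++ a, b ++ d, r, hr, Or.inr ⟨by simp, by simp⟩⟩

theorem rewrites_append {w w' : List (X × Bool)} (h : Relation.ReflTransGen (RewriteStep R) w w')
    (c d : List (X × Bool)) :
    Relation.ReflTransGen (RewriteStep R) (c ++ w ++ d) (c ++ w' ++ d) :=
  Relation.ReflTransGen.lift (fun v => c ++ v ++ d) (fun _ _ h => RewriteStep.append h c d) _ _ h

theorem rewrites_symm {w w' : List (X × Bool)} (h : Relation.ReflTransGen (RewriteStep R) w w') :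
    Relation.ReflTransGen (RewriteStep R) w' w := by
  have : Std.Symm (RewriteStep R) := ⟨fun _ _ h => h.symm⟩
  exact Relation.ReflTransGen.stdSymm.symm _ _ h

theorem rewrites_of_red {w w' : List (X × Bool)} (h : FreeGroup.Red w w') :
    Relation.ReflTransGen (RewriteStep R) w w' := by
  refine Relation.ReflTransGen.mono (fun a b h => ?_) _ _ h
  cases h with
  | @not L₁ L₂ x b => exact ⟨L₁, L₂, _, Or.inr ⟨(x, b), rfl⟩, Or.inl ⟨by simp, rfl⟩⟩

theorem rewrites_of_mk_eq {w w' : List (X × Bool)} (h : FreeGroup.mk w = FreeGroup.mk w') :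
    Relation.ReflTransGen (RewriteStep R) w w' := by
  obtain ⟨c, h1, h2⟩ := FreeGroup.Red.exact.1 h
  exact (rewrites_of_red h1).trans (rewrites_symm (rewrites_of_red h2))

/-- The elements all of whose words rewrite to the empty word form a normal subgroup containing the
relators. Conversely, inserting or deleting a relator multiplies by a conjugate of it or of its
inverse. -/
theorem mk_mem_normalClosure_iff_rewrites (w : List (X × Bool)) :
    FreeGroup.mk w ∈ Subgroup.normalClosure {g | ∃ r, R r ∧ FreeGroup.mk r = g} ↔
      Relation.ReflTransGen (RewriteStep R) w [] := by
  classical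
  constructor
  · let K : Subgroup (FreeGroup X) :=
      { carrier := {g | ∀ w, FreeGroup.mk w = g → Relation.ReflTransGen (RewriteStep R) w []}
        one_mem' := fun w hw => rewrites_of_mk_eq hw
        mul_mem' := by
          intro g h hg hh w hw
          have h1 := hg g.toWord FreeGroup.mk_toWord
          have h2 := hh h.toWord FreeGroup.mk_toWord
          refine (rewrites_of_mk_eq (w' := [] ++ g.toWord ++ h.toWord) ?_).trans
            ((rewrites_append h1 _ _).trans h2)
          rw [hw, List.nil_append, ← FreeGroup.mul_mk, FreeGroup.mk_toWord, FreeGroup.mk_toWord]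
        inv_mem' := by
          intro g hg w hw
          have h1 := hg g.toWord FreeGroup.mk_toWord
          have h2 := rewrites_append (rewrites_symm h1) w []
          simp only [List.append_nil] at h2
          refine h2.trans (rewrites_of_mk_eq ?_)
          rw [← FreeGroup.mul_mk, FreeGroup.mk_toWord, hw]
          simp [FreeGroup.one_eq_mk] }
    have hK : Subgroup.normalClosure {g | ∃ r, R r ∧ FreeGroup.mk r = g} ≤ K := by
      have : K.Normal := by
        refine ⟨fun g hg h w hw => ?_⟩
        have h1 := rewrites_append (hg g.toWord FreeGroup.mk_toWord) h.toWord (h⁻¹).toWord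
        refine (rewrites_of_mk_eq ?_).trans (h1.trans (rewrites_of_mk_eq ?_))
        · rw [hw]
          simp only [← FreeGroup.mul_mk, FreeGroup.mk_toWord]
        · simp only [← FreeGroup.mul_mk, FreeGroup.mk_toWord, ← FreeGroup.one_eq_mk, mul_one,
            mul_inv_cancel]
      refine Subgroup.normalClosure_le_normal ?_
      rintro g ⟨r, hr, rfl⟩ w hw
      refine (rewrites_of_mk_eq hw).trans (Relation.ReflTransGen.single ?_)
      exact ⟨[], [], r, Or.inl hr, Or.inl ⟨by simp, rfl⟩⟩
    exact fun h => hK h w rfl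
  · intro h
    induction h using Relation.ReflTransGen.head_induction_on with
    | refl => exact one_mem _
    | head h _ ih =>
      have hmem : ∀ r, (R r ∨ ∃ x, r = [x, (x.1, !x.2)]) → FreeGroup.mk r ∈
          Subgroup.normalClosure {g | ∃ r, R r ∧ FreeGroup.mk r = g} := by
        rintro r (hr | ⟨⟨x, b⟩, rfl⟩)
        · exact Subgroup.subset_normalClosure ⟨r, hr, rfl⟩
        · have : FreeGroup.mk [(x, b), (x, !b)] = 1 :=
            Quot.sound (FreeGroup.Red.Step.not (L₁ := []) (L₂ := []))
          simp only [this, one_mem]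
      have hiff : ∀ a b r, (R r ∨ ∃ x, r = [x, (x.1, !x.2)]) →
          (FreeGroup.mk (a ++ r ++ b) ∈ Subgroup.normalClosure {g | ∃ r, R r ∧ FreeGroup.mk r = g} ↔
          FreeGroup.mk (a ++ b) ∈ Subgroup.normalClosure {g | ∃ r, R r ∧ FreeGroup.mk r = g}) := by
        intro a b r hr
        have hc := Subgroup.normalClosure_normal.conj_mem _ (hmem r hr) (FreeGroup.mk a)
        have : FreeGroup.mk (a ++ r ++ b) =
            (FreeGroup.mk a * FreeGroup.mk r * (FreeGroup.mk a)⁻¹) * FreeGroup.mk (a ++ b) := by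
          simp only [← FreeGroup.mul_mk]; group
        rw [this, Subgroup.mul_mem_cancel_left _ hc]
      obtain ⟨a, b, r, hr, ⟨rfl, rfl⟩ | ⟨rfl, rfl⟩⟩ := h
      · exact (hiff a b r hr).2 ih
      · exact (hiff a b r hr).1 ih

/-- A finite sequence of rewriting steps is the witness. The parameter in `σ` lets the set of
relators be part of the input. -/
theorem Semidecidable.mem_normalClosure {σ : Type*} [Primcodable σ] [Primcodable X]
    {R : σ → List (X × Bool) → Prop} (hR : Semidecidable fun x : σ × List (X × Bool) => R x.1 x.2) :
    Semidecidable fun x : σ × List (X × Bool) => FreeGroup.mk x.2 ∈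
      Subgroup.normalClosure {g | ∃ r, R x.1 r ∧ FreeGroup.mk r = g} := by
  have hstep : Semidecidable fun x : σ × List (X × Bool) × List (X × Bool) =>
      RewriteStep (R x.1) x.2.1 x.2.2 := by
    refine ex (ex (ex (and (or ?_ (ex ?_)) (or (and ?_ ?_) (and ?_ ?_)))))
    · exact hR.comp (f := fun x : (((σ × List (X × Bool) × List (X × Bool)) × List (X × Bool)) ×
        List (X × Bool)) × List (X × Bool) => (x.1.1.1.1, x.2)) (by fun_prop)
    all_goals exact eq (by fun_prop) (by fun_prop)
  exact ((reflTransGen (r := fun s => RewriteStep (R s)) hstep).comp (f := fun x : σ × List (X × Bool) => (x.1, x.2, []))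
    (by fun_prop)).of_eq fun x => mk_mem_normalClosure_iff_rewrites _

end Rewriting

/-! ### Evaluation of words -/

theorem wordEval_eq_one_iff_mem {G : Type*} [Group G] {ι : Type*} (x : ι → G)
    (w : List (ι × Bool)) : wordEval x w = 1 ↔ wordEval x w ∈ wordSubgroup x [] := by
  simp [wordSubgroup]

theorem exists_wordEval_eq {G : Type*} [Group G] {ι : Type*} {x : ι → G}
    (hx : Subgroup.closure (Set.range x) = ⊤) (g : G) : ∃ w, wordEval x w = g := by
  classical
  have hg : g ∈ (FreeGroup.lift x).range := by
    rw [FreeGroup.range_lift_eq_closure, hx]; trivial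
  obtain ⟨a, ha⟩ := hg
  exact ⟨a.toWord, by simp only [wordEval, FreeGroup.mk_toWord]; exact ha⟩

theorem wordEval_invRev {G : Type*} [Group G] {ι : Type*} (x : ι → G) (w : List (ι × Bool)) :
    wordEval x (FreeGroup.invRev w) = (wordEval x w)⁻¹ := by
  rw [wordEval, ← FreeGroup.inv_mk, map_inv, wordEval]

theorem map_wordEval {G H : Type*} [Group G] [Group H] {ι : Type*} (f : G →* H) (x : ι → G)
    (w : List (ι × Bool)) : f (wordEval x w) = wordEval (fun i => f (x i)) w := by
  have : f.comp (FreeGroup.lift x) = FreeGroup.lift fun i => f (x i) := by ext i; simp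
  exact DFunLike.congr_fun this (FreeGroup.mk w)

theorem wordEval_map_letters {G : Type*} [Group G] {ι κ : Type*} (x : κ → G) (f : ι → κ)
    (w : List (ι × Bool)) :
    wordEval x (w.map fun t => (f t.1, t.2)) = wordEval (fun i => x (f i)) w := by
  induction w with
  | nil => simp [wordEval_nil]
  | cons t w ih =>
    rw [List.map_cons, ← List.singleton_append, wordEval_append, ih, ← List.singleton_append,
      wordEval_append]
    simp [wordEval]

theorem wordEval_singleton {G : Type*} [Group G] {ι : Type*} (x : ι → G) (i : ι) (b : Bool) :
    wordEval x [(i, b)] = bif b then x i else (x i)⁻¹ := by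
  cases b <;> simp [wordEval]

namespace GraphOfGroups

variable {V : Type u₁} {E : Type u₂} (A : GraphOfGroups.{u₁, u₂, u₃, u₄} V E)

/-! ### The fundamental groupoid -/

/-- Equivalence classes of paths from `v` to `w`. -/
def PathClass (v w : V) : Type (max u₁ u₂ u₃) := Quotient (Path.setoid A v w)

variable {A}

namespace PathClass

/-- The class of a path. -/
def ofPath {v w : V} (p : A.Path v w) : A.PathClass v w := Quotient.mk _ p

/-- Composition of classes of paths. -/
def comp {u v w : V} : A.PathClass u v → A.PathClass v w → A.PathClass u w :=
  Quotient.map₂ Path.concat fun _ _ h _ _ h' => Path.Rel.concat h h'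

/-- The class of a path of length zero. -/
def ofVertex {v : V} (a : A.vertexGroup v) : A.PathClass v v := ofPath (.nil a)

/-- The class of the inverse path. -/
def inv {v w : V} : A.PathClass v w → A.PathClass w v :=
  Quotient.map Path.reverse fun _ _ h => Path.Rel.reverse h

theorem ofPath_surjective {v w : V} : Function.Surjective (ofPath : A.Path v w → A.PathClass v w) :=
  Quotient.mk_surjective

theorem ofPath_eq_ofPath {v w : V} {p q : A.Path v w} : ofPath p = ofPath q ↔ Path.Rel p q :=
  Quotient.eq (r := Path.setoid A v w)

theorem ofPath_concat {u v w : V} (p : A.Path u v) (q : A.Path v w) :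
    ofPath (p.concat q) = (ofPath p).comp (ofPath q) := rfl

theorem ofPath_reverse {v w : V} (p : A.Path v w) : ofPath p.reverse = (ofPath p).inv := rfl

theorem comp_assoc {s u v w : V} (p : A.PathClass s u) (q : A.PathClass u v)
    (r : A.PathClass v w) : (p.comp q).comp r = p.comp (q.comp r) := by
  obtain ⟨p, rfl⟩ := ofPath_surjective p
  obtain ⟨q, rfl⟩ := ofPath_surjective q
  obtain ⟨r, rfl⟩ := ofPath_surjective r
  simp only [← ofPath_concat, Path.concat_assoc]

@[simp] theorem ofVertex_one_comp {v w : V} (p : A.PathClass v w) :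
    (ofVertex 1).comp p = p := by
  obtain ⟨p, rfl⟩ := ofPath_surjective p
  exact congrArg ofPath (Path.mulLeft_one p)

@[simp] theorem comp_ofVertex_one {v w : V} (p : A.PathClass v w) :
    p.comp (ofVertex 1) = p := by
  obtain ⟨p, rfl⟩ := ofPath_surjective p
  exact congrArg ofPath (Path.concat_nil_one p)

@[simp] theorem inv_comp {v w : V} (p : A.PathClass v w) : p.inv.comp p = ofVertex 1 := by
  obtain ⟨p, rfl⟩ := ofPath_surjective p
  exact ofPath_eq_ofPath.2 (Path.rel_reverse_concat p)

@[simp] theorem comp_inv {v w : V} (p : A.PathClass v w) : p.comp p.inv = ofVertex 1 := by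
  have h : p.inv.inv.comp p.inv = ofVertex 1 := inv_comp p.inv
  have h' : p.inv.inv = p := by
    rw [← comp_ofVertex_one p.inv.inv, ← inv_comp p, ← comp_assoc, inv_comp, ofVertex_one_comp]
  rwa [h'] at h

@[simp] theorem comp_inv_comp {u v w : V} (p : A.PathClass u v) (q : A.PathClass u w) :
    p.comp (p.inv.comp q) = q := by
  rw [← comp_assoc, comp_inv, ofVertex_one_comp]

@[simp] theorem inv_comp_comp {u v w : V} (p : A.PathClass v u) (q : A.PathClass u w) :
    p.inv.comp (p.comp q) = q := by
  rw [← comp_assoc, inv_comp, ofVertex_one_comp]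

@[simp] theorem ofVertex_mul {v : V} (a b : A.vertexGroup v) :
    ofVertex (a * b) = (ofVertex a).comp (ofVertex b) := rfl

/-- The class of an edge. -/
def ofEdge (e : E) : A.PathClass (A.o e) (A.t e) := ofPath (.fwd e 1 (.nil 1))

theorem ofPath_fwd {w : V} (e : E) (a : A.vertexGroup (A.o e)) (p : A.Path (A.t e) w) :
    ofPath (.fwd e a p) = (ofVertex a).comp ((ofEdge e).comp (ofPath p)) := by
  simp only [ofVertex, ofEdge, ← ofPath_concat, Path.concat, Path.mulLeft_one]
  simp only [Path.mulLeft, mul_one]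

theorem inv_ofEdge (e : E) :
    (ofEdge e).inv = (ofPath (.bwd e 1 (.nil 1)) : A.PathClass (A.t e) (A.o e)) := by
  simp [ofEdge, ← ofPath_reverse, Path.reverse, Path.concat, Path.mulLeft]

theorem ofPath_bwd {w : V} (e : E) (a : A.vertexGroup (A.t e)) (p : A.Path (A.o e) w) :
    ofPath (.bwd e a p) = (ofVertex a).comp ((ofEdge e).inv.comp (ofPath p)) := by
  rw [inv_ofEdge]
  simp only [ofVertex, ← ofPath_concat, Path.concat, Path.mulLeft_one]
  simp only [Path.mulLeft, mul_one]

theorem ofVertex_α_comp_ofEdge (e : E) (c : A.edgeGroup e) :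
    (ofVertex (A.α e c)).comp (ofEdge e) = (ofEdge e).comp (ofVertex (A.ω e c)) := by
  have h : ofPath (.fwd e 1 (.bwd e (A.ω e c) (.nil 1))) = ofVertex (A.α e c) := by
    rw [ofVertex, ofPath_eq_ofPath]
    simpa using Path.Rel.fwd_bwd (A := A) e 1 1 c
  rw [← h, ofPath_fwd, ofPath_bwd]
  simp only [comp_assoc]
  change (ofVertex 1).comp ((ofEdge e).comp ((ofVertex (A.ω e c)).comp
    ((ofEdge e).inv.comp ((ofVertex 1).comp (ofEdge e))))) = _
  simp

/-- The element of the fundamental group given by a class of loops. -/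
def toGroup {v₀ : V} (p : A.PathClass v₀ v₀) : A.FundamentalGroup v₀ := p

theorem toGroup_mul {v₀ : V} (p q : A.PathClass v₀ v₀) :
    toGroup p * toGroup q = toGroup (p.comp q) := rfl

theorem toGroup_one {v₀ : V} : toGroup (ofVertex 1 : A.PathClass v₀ v₀) = 1 := rfl

end PathClass

/-! ### A presentation of the fundamental group -/

section Presentation

variable {N : ℕ} (x : ∀ v, Fin N → A.vertexGroup v) (W : ∀ v, A.vertexGroup v → List (Fin N × Bool))

/-- A word in the generators of a vertex group as a word in the letters for all vertex groups
and edges. -/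
def vertexWord (v : V) (w : List (Fin N × Bool)) : List (((V × Fin N) ⊕ E) × Bool) :=
  w.map fun t => (Sum.inl (v, t.1), t.2)

/-- A word that spells a path. -/
def pathWord : ∀ {v w : V}, A.Path v w → List (((V × Fin N) ⊕ E) × Bool)
  | v, _, .nil a => vertexWord v (W v a)
  | _, _, .fwd e a p => vertexWord (A.o e) (W _ a) ++ [(Sum.inr e, true)] ++ pathWord p
  | _, _, .bwd e a p => vertexWord (A.t e) (W _ a) ++ [(Sum.inr e, false)] ++ pathWord p

/-- The relators of the vertex groups and of the edges, and a set `F` of further relators. -/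
def PathRelator (F : Set (List (((V × Fin N) ⊕ E) × Bool))) (r : List (((V × Fin N) ⊕ E) × Bool)) :
    Prop :=
  (∃ v w, wordEval (x v) w = 1 ∧ r = vertexWord v w) ∨
  (∃ e c, r = [(Sum.inr e, true)] ++ vertexWord (A.t e) (W _ (A.ω e c)) ++ [(Sum.inr e, false)] ++
    vertexWord (A.o e) (W _ (A.α e c)⁻¹)) ∨ r ∈ F

theorem wordEval_vertexWord {Γ : Type*} [Group Γ] (y : (V × Fin N) ⊕ E → Γ) (v : V)
    (w : List (Fin N × Bool)) :
    wordEval y (vertexWord v w) = wordEval (fun i => y (Sum.inl (v, i))) w :=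
  wordEval_map_letters y (fun i => Sum.inl (v, i)) w

variable {x W}

section

variable {F : Set (List (((V × Fin N) ⊕ E) × Bool))} {Γ : Type*} [Group Γ]
  {y : (V × Fin N) ⊕ E → Γ}

theorem wordEval_vertexWord_eq (hy : ∀ r, PathRelator x W F r → wordEval y r = 1) {v : V}
    {w w' : List (Fin N × Bool)} (h : wordEval (x v) w = wordEval (x v) w') :
    wordEval y (vertexWord v w) = wordEval y (vertexWord v w') := by
  have := hy (vertexWord v (w ++ FreeGroup.invRev w'))
    (Or.inl ⟨v, _, by rw [wordEval_append, wordEval_invRev, h, mul_inv_cancel], rfl⟩)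
  simp only [wordEval_vertexWord, wordEval_append, wordEval_invRev] at this ⊢
  exact mul_inv_eq_one.1 this

variable (hW : ∀ v a, wordEval (x v) (W v a) = a)

include hW

theorem wordEval_pathWord_mulLeft (hy : ∀ r, PathRelator x W F r → wordEval y r = 1) {v w : V}
    (b : A.vertexGroup v) (p : A.Path v w) :
    wordEval y (pathWord W (p.mulLeft b)) =
      wordEval y (vertexWord v (W v b)) * wordEval y (pathWord W p) := by
  have key : ∀ {v : V} (b a : A.vertexGroup v), wordEval y (vertexWord v (W v (b * a))) =
      wordEval y (vertexWord v (W v b)) * wordEval y (vertexWord v (W v a)) := by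
    intro v b a
    rw [← wordEval_append]
    have : vertexWord v (W v b) ++ vertexWord v (W v a) =
      (vertexWord v (W v b ++ W v a) : List (((V × Fin N) ⊕ E) × Bool)) := by simp [vertexWord]
    rw [this]
    exact wordEval_vertexWord_eq hy (by rw [wordEval_append, hW, hW, hW])
  cases p with
  | nil a => exact key b a
  | fwd e a p => simp only [Path.mulLeft, pathWord, wordEval_append, key, mul_assoc]
  | bwd e a p => simp only [Path.mulLeft, pathWord, wordEval_append, key, mul_assoc]

theorem wordEval_pathWord_concat (hy : ∀ r, PathRelator x W F r → wordEval y r = 1) {u v w : V}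
    (p : A.Path u v) (q : A.Path v w) :
    wordEval y (pathWord W (p.concat q)) =
      wordEval y (pathWord W p) * wordEval y (pathWord W q) := by
  induction p with
  | nil a => exact wordEval_pathWord_mulLeft hW hy a q
  | fwd e a p ih => simp only [Path.concat, pathWord, wordEval_append, ih, mul_assoc]
  | bwd e a p ih => simp only [Path.concat, pathWord, wordEval_append, ih, mul_assoc]

/-- In any group where the relators hold, spelling paths is thus a functor on the fundamental
groupoid; the edge relators account for the elementary equivalences. -/
theorem wordEval_pathWord_eq_of_rel (hy : ∀ r, PathRelator x W F r → wordEval y r = 1) {v w : V}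
    {p q : A.Path v w} (h : Path.Rel p q) :
    wordEval y (pathWord W p) = wordEval y (pathWord W q) := by
  have hv : ∀ {v : V} (a b : A.vertexGroup v), wordEval y (pathWord W (.nil (a * b))) =
      wordEval y (pathWord W (.nil a)) * wordEval y (pathWord W (.nil b)) :=
    fun a b => wordEval_pathWord_mulLeft hW hy a (.nil b)
  have hv1 : ∀ v : V, wordEval y (pathWord W (.nil (1 : A.vertexGroup v))) = 1 := by
    intro v
    simpa using hv (1 : A.vertexGroup v) 1
  have he : ∀ e c, wordEval y [(Sum.inr e, true)] * wordEval y (pathWord W (.nil (A.ω e c))) *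
      wordEval y [(Sum.inr e, false)] = wordEval y (pathWord W (.nil (A.α e c))) := by
    intro e c
    have := hy _ (Or.inr (Or.inl ⟨e, c, rfl⟩))
    rw [wordEval_append, wordEval_append, wordEval_append, mul_eq_one_iff_eq_inv] at this
    refine this.trans (inv_eq_of_mul_eq_one_left ?_)
    change wordEval y (pathWord W (.nil (A.α e c))) * wordEval y (pathWord W (.nil (A.α e c)⁻¹)) = 1
    rw [← hv, mul_inv_cancel, hv1]
  induction h with
  | fwd_bwd e a a' c =>
    rw [hv, hv, ← he]
    simp only [pathWord, wordEval_append, mul_assoc]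
  | bwd_fwd e a a' c =>
    have : wordEval y (pathWord W (.nil (A.ω e c))) = wordEval y [(Sum.inr e, false)] *
        (wordEval y (pathWord W (.nil (A.α e c))) * wordEval y [(Sum.inr e, true)]) := by
      rw [← he]
      simp only [wordEval_singleton, cond_true, cond_false]
      group
    rw [hv, hv, this]
    simp only [pathWord, wordEval_append, mul_assoc]
  | concat _ _ ih₁ ih₂ =>
    rw [wordEval_pathWord_concat hW hy, wordEval_pathWord_concat hW hy, ih₁, ih₂]
  | refl p => rfl
  | symm _ ih => exact ih.symm
  | trans _ _ ih₁ ih₂ => exact ih₁.trans ih₂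

end

open PathClass

/-- Arbitrary paths to the vertices replace a maximal tree. Preceding each by the reverse of the
path chosen for `v₀` makes the one at `v₀` trivial, as both choices at `v₀` are the same path by
proof irrelevance. -/
theorem exists_base_paths (A : GraphOfGroups.{u₁, u₂, u₃, u₄} V E) (v₀ : V) :
    ∃ q : ∀ v, Nonempty (A.Path v₀ v) → A.Path v₀ v, ∀ h, ofPath (q v₀ h) = ofVertex 1 := by
  refine ⟨fun v h => (Classical.choice (⟨.nil 1⟩ : Nonempty (A.Path v₀ v₀))).reverse.concat
    (Classical.choice h), fun h => ?_⟩
  simp [ofPath_concat, ofPath_reverse]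

open Classical in
/-- The loops at `v₀` that correspond to the generators of the vertex groups and to the edges. -/
noncomputable def pathGenerator {v₀ : V} (x : ∀ v, Fin N → A.vertexGroup v)
    (q : ∀ v, Nonempty (A.Path v₀ v) → A.Path v₀ v) :
    (V × Fin N) ⊕ E → A.FundamentalGroup v₀
  | .inl (v, i) => if h : Nonempty (A.Path v₀ v) then
      toGroup ((ofPath (q v h)).comp ((ofVertex (x v i)).comp (ofPath (q v h)).inv)) else 1
  | .inr e => if h : Nonempty (A.Path v₀ (A.o e)) then
      toGroup ((ofPath (q _ h)).comp ((ofEdge e).comp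
        (ofPath (q (A.t e) (h.map fun p => p.concat (.fwd e 1 (.nil 1))))).inv)) else 1

/-- The conjugation of a vertex group into the fundamental group. -/
def conjVertex {v₀ v : V} (q : A.PathClass v₀ v) : A.vertexGroup v →* A.FundamentalGroup v₀ where
  toFun a := toGroup (q.comp ((ofVertex a).comp q.inv))
  map_one' := by rw [ofVertex_one_comp, comp_inv, toGroup_one]
  map_mul' a b := by simp [toGroup_mul, comp_assoc]

theorem conjVertex_apply {v₀ v : V} (q : A.PathClass v₀ v) (a : A.vertexGroup v) :
    conjVertex q a = toGroup (q.comp ((ofVertex a).comp q.inv)) := rfl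

theorem wordEval_pathGenerator_vertexWord {v₀ : V} (x : ∀ v, Fin N → A.vertexGroup v)
    (q : ∀ v, Nonempty (A.Path v₀ v) → A.Path v₀ v) {v : V} (h : Nonempty (A.Path v₀ v))
    (w : List (Fin N × Bool)) :
    wordEval (pathGenerator x q) (vertexWord v w) =
      toGroup ((ofPath (q v h)).comp ((ofVertex (wordEval (x v) w)).comp (ofPath (q v h)).inv)) := by
  rw [wordEval_vertexWord]
  refine Eq.trans ?_ (map_wordEval (conjVertex (ofPath (q v h))) (x v) w).symm
  congr 1
  funext i
  simp only [pathGenerator, h, dif_pos, conjVertex_apply]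

theorem wordEval_pathGenerator_edge {v₀ : V} (x : ∀ v, Fin N → A.vertexGroup v)
    (q : ∀ v, Nonempty (A.Path v₀ v) → A.Path v₀ v) {e : E} (h : Nonempty (A.Path v₀ (A.o e)))
    (h' : Nonempty (A.Path v₀ (A.t e))) :
    wordEval (pathGenerator x q) [(Sum.inr e, true)] =
      toGroup ((ofPath (q _ h)).comp ((ofEdge e).comp (ofPath (q _ h')).inv)) := by
  simp only [wordEval_singleton, pathGenerator, h, dif_pos, cond_true]

theorem wordEval_pathGenerator_edge_inv {v₀ : V} (x : ∀ v, Fin N → A.vertexGroup v)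
    (q : ∀ v, Nonempty (A.Path v₀ v) → A.Path v₀ v) {e : E} (h : Nonempty (A.Path v₀ (A.o e)))
    (h' : Nonempty (A.Path v₀ (A.t e))) :
    wordEval (pathGenerator x q) [(Sum.inr e, false)] =
      toGroup ((ofPath (q _ h')).comp ((ofEdge e).inv.comp (ofPath (q _ h)).inv)) := by
  have : wordEval (pathGenerator x q) [(Sum.inr e, false)] =
      (wordEval (pathGenerator x q) [(Sum.inr e, true)])⁻¹ := by simp [wordEval_singleton]
  rw [this, wordEval_pathGenerator_edge x q h h']
  refine inv_eq_of_mul_eq_one_right ?_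
  simp [toGroup_mul, comp_assoc, toGroup_one]

/-- The base paths at intermediate vertices cancel, and only those at the two ends remain. -/
theorem wordEval_pathGenerator_pathWord {v₀ : V} (hW : ∀ v a, wordEval (x v) (W v a) = a)
    (q : ∀ v, Nonempty (A.Path v₀ v) → A.Path v₀ v) {v w : V} (p : A.Path v w)
    (h : Nonempty (A.Path v₀ v)) (h' : Nonempty (A.Path v₀ w)) :
    wordEval (pathGenerator x q) (pathWord W p) =
      toGroup ((ofPath (q v h)).comp ((ofPath p).comp (ofPath (q w h')).inv)) := by
  induction p with
  | nil a => rw [pathWord, wordEval_pathGenerator_vertexWord x q h, hW]; rfl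
  | fwd e a p ih =>
    have ht : Nonempty (A.Path v₀ (A.t e)) := h.map fun p => p.concat (.fwd e 1 (.nil 1))
    rw [pathWord, wordEval_append, wordEval_append, wordEval_pathGenerator_vertexWord x q h, hW,
      wordEval_pathGenerator_edge x q h ht, ih ht h', ofPath_fwd]
    simp [toGroup_mul, comp_assoc]
  | bwd e a p ih =>
    have ho : Nonempty (A.Path v₀ (A.o e)) := h.map fun p => p.concat (.bwd e 1 (.nil 1))
    rw [pathWord, wordEval_append, wordEval_append, wordEval_pathGenerator_vertexWord x q h, hW,
      wordEval_pathGenerator_edge_inv x q ho h, ih ho h', ofPath_bwd]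
    simp [toGroup_mul, comp_assoc]

/-- The relators that make the words for the base paths trivial, and the letters that are not
connected to the base vertex. -/
def treeRelators {v₀ : V} (W : ∀ v, A.vertexGroup v → List (Fin N × Bool))
    (q : ∀ v, Nonempty (A.Path v₀ v) → A.Path v₀ v) : Set (List (((V × Fin N) ⊕ E) × Bool)) :=
  {r | ∃ v h, r = pathWord W (q v h)} ∪
    ({r | ∃ v i, IsEmpty (A.Path v₀ v) ∧ r = [(Sum.inl (v, i), true)]} ∪
      {r | ∃ e, IsEmpty (A.Path v₀ (A.o e)) ∧ r = [(Sum.inr e, true)]})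

theorem treeRelators_finite [Finite V] [Finite E] {v₀ : V}
    (q : ∀ v, Nonempty (A.Path v₀ v) → A.Path v₀ v) : (treeRelators W q).Finite := by
  refine (Set.Finite.subset (Set.finite_range
    (fun z : Σ v, PLift (Nonempty (A.Path v₀ v)) => pathWord W (q z.1 z.2.down))) ?_).union
    ((Set.Finite.subset (Set.finite_range (fun z : V × Fin N => [(Sum.inl z, true)])) ?_).union
    (Set.Finite.subset (Set.finite_range (fun e : E => [(Sum.inr e, true)])) ?_))
  · rintro r ⟨v, h, rfl⟩
    exact ⟨⟨v, ⟨h⟩⟩, rfl⟩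
  · rintro r ⟨v, i, -, rfl⟩
    exact ⟨(v, i), rfl⟩
  · rintro r ⟨e, -, rfl⟩
    exact ⟨e, rfl⟩

theorem wordEval_pathGenerator_eq_one {v₀ : V} (hW : ∀ v a, wordEval (x v) (W v a) = a)
    (q : ∀ v, Nonempty (A.Path v₀ v) → A.Path v₀ v) (hq : ∀ h, ofPath (q v₀ h) = ofVertex 1)
    {r : List (((V × Fin N) ⊕ E) × Bool)} (hr : PathRelator x W (treeRelators W q) r) :
    wordEval (pathGenerator x q) r = 1 := by
  have hv0 : Nonempty (A.Path v₀ v₀) := ⟨.nil 1⟩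
  have hne : ∀ v, ¬ Nonempty (A.Path v₀ v) → ∀ w, wordEval (pathGenerator x q)
      (vertexWord v w) = 1 := by
    intro v h w
    rw [wordEval_vertexWord]
    have := map_wordEval (1 : A.vertexGroup v →* A.FundamentalGroup v₀) (x v) w
    rw [MonoidHom.one_apply] at this
    rw [this]
    congr 1
    funext i
    simp only [pathGenerator, h, dif_neg, not_false_eq_true, MonoidHom.one_apply]
  rcases hr with ⟨v, w, hw, rfl⟩ | ⟨e, c, rfl⟩ | ⟨v, h, rfl⟩ | ⟨v, i, h, rfl⟩ | ⟨e, h, rfl⟩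
  · by_cases h : Nonempty (A.Path v₀ v)
    · rw [wordEval_pathGenerator_vertexWord x q h, hw, ofVertex_one_comp, comp_inv, toGroup_one]
    · exact hne v h w
  · by_cases h : Nonempty (A.Path v₀ (A.o e))
    · have h' : Nonempty (A.Path v₀ (A.t e)) := h.map fun p => p.concat (.fwd e 1 (.nil 1))
      rw [wordEval_append, wordEval_append, wordEval_append,
        wordEval_pathGenerator_vertexWord x q h, wordEval_pathGenerator_vertexWord x q h',
        wordEval_pathGenerator_edge x q h h', wordEval_pathGenerator_edge_inv x q h h', hW, hW]
      simp only [toGroup_mul, comp_assoc, inv_comp_comp]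
      rw [← comp_assoc (ofEdge e) (ofVertex _), ← ofVertex_α_comp_ofEdge]
      simp only [comp_assoc, comp_inv_comp]
      rw [← comp_assoc (ofVertex (A.α e c)), ← ofVertex_mul, mul_inv_cancel, ofVertex_one_comp,
        comp_inv, toGroup_one]
    · have h' : ¬ Nonempty (A.Path v₀ (A.t e)) := fun h' => h (h'.map fun p =>
        p.concat (.bwd e 1 (.nil 1)))
      have he : wordEval (pathGenerator x q) [(Sum.inr e, true)] = 1 := by
        simp only [wordEval_singleton, pathGenerator, h, dif_neg, not_false_eq_true, cond_true]
      have he' : wordEval (pathGenerator x q) [(Sum.inr e, false)] = 1 := by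
        rw [← inv_inj, inv_one, ← he]
        simp [wordEval_singleton]
      simp only [wordEval_append, hne _ h, hne _ h', he, he', mul_one]
  · rw [wordEval_pathGenerator_pathWord hW q _ hv0 h, hq]
    simp [toGroup_one]
  · simp only [wordEval_singleton, pathGenerator, not_nonempty_iff.2 h, dif_neg,
      not_false_eq_true, cond_true]
  · simp only [wordEval_singleton, pathGenerator, not_nonempty_iff.2 h, dif_neg,
      not_false_eq_true, cond_true]

theorem lift_pathGenerator_surjective {v₀ : V} (hW : ∀ v a, wordEval (x v) (W v a) = a)
    (q : ∀ v, Nonempty (A.Path v₀ v) → A.Path v₀ v) (hq : ∀ h, ofPath (q v₀ h) = ofVertex 1) :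
    Function.Surjective (FreeGroup.lift (pathGenerator x q)) := by
  intro g
  obtain ⟨p, rfl⟩ := ofPath_surjective g
  refine ⟨FreeGroup.mk (pathWord W p), ?_⟩
  change wordEval (pathGenerator x q) (pathWord W p) = _
  rw [wordEval_pathGenerator_pathWord hW q p ⟨p⟩ ⟨p⟩, hq, ofVertex_one_comp]
  have : (ofVertex 1 : A.PathClass v₀ v₀).inv = ofVertex 1 := by
    rw [← ofVertex_one_comp (ofVertex 1).inv, comp_inv]
  rw [this, comp_ofVertex_one]
  rfl

/-- Spelling loops defines a homomorphism from the fundamental group to the quotient of the free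
group by the relators. Its composite with the evaluation of words agrees with the quotient map on
every letter, because the words for the base paths are relators; so the kernel is no larger than the
normal closure. -/
theorem ker_lift_pathGenerator {v₀ : V} (hW : ∀ v a, wordEval (x v) (W v a) = a)
    (q : ∀ v, Nonempty (A.Path v₀ v) → A.Path v₀ v) (hq : ∀ h, ofPath (q v₀ h) = ofVertex 1) :
    (FreeGroup.lift (pathGenerator x q)).ker = Subgroup.normalClosure
      {g | ∃ r, PathRelator x W (treeRelators W q) r ∧ FreeGroup.mk r = g} := by
  refine le_antisymm ?_ (Subgroup.normalClosure_le_normal ?_)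
  · set K := Subgroup.normalClosure
      {g | ∃ r, PathRelator x W (treeRelators W q) r ∧ FreeGroup.mk r = g} with hK
    let y : (V × Fin N) ⊕ E → FreeGroup ((V × Fin N) ⊕ E) ⧸ K := fun s => FreeGroup.of s
    have hy' : FreeGroup.lift y = QuotientGroup.mk' K := by ext; simp [y]
    have hy : ∀ r, PathRelator x W (treeRelators W q) r → wordEval y r = 1 := by
      intro r hr
      rw [wordEval, hy']
      exact (QuotientGroup.eq_one_iff _).2 (Subgroup.subset_normalClosure ⟨r, hr, rfl⟩)
    let C : ∀ {v w : V}, A.PathClass v w → FreeGroup ((V × Fin N) ⊕ E) ⧸ K := fun p =>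
      Quotient.lift (fun p => wordEval y (pathWord W p))
        (fun _ _ h => wordEval_pathWord_eq_of_rel hW hy h) p
    have hCmk : ∀ {v w : V} (p : A.Path v w), C (ofPath p) = wordEval y (pathWord W p) :=
      fun _ => rfl
    have hCcomp : ∀ {u v w : V} (p : A.PathClass u v) (r : A.PathClass v w),
        C (p.comp r) = C p * C r := by
      intro u v w p r
      obtain ⟨p, rfl⟩ := ofPath_surjective p
      obtain ⟨r, rfl⟩ := ofPath_surjective r
      exact wordEval_pathWord_concat hW hy p r
    have hC1 : ∀ v : V, C (ofVertex (1 : A.vertexGroup v)) = 1 := by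
      intro v
      have := hCcomp (ofVertex (1 : A.vertexGroup v)) (ofVertex 1)
      simpa using this
    have hCinv : ∀ {v w : V} (p : A.PathClass v w), C p.inv = (C p)⁻¹ := by
      intro v w p
      refine (inv_eq_of_mul_eq_one_right ?_).symm
      rw [← hCcomp, comp_inv, hC1]
    have hCq : ∀ v h, C (ofPath (q v h)) = 1 := fun v h =>
      hy _ (Or.inr (Or.inr (Or.inl ⟨v, h, rfl⟩)))
    let Ch : A.FundamentalGroup v₀ →* FreeGroup ((V × Fin N) ⊕ E) ⧸ K :=
      { toFun := C, map_one' := hC1 v₀, map_mul' := hCcomp }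
    have hCh : ∀ p : A.PathClass v₀ v₀, Ch (toGroup p) = C p := fun _ => rfl
    have key : Ch.comp (FreeGroup.lift (pathGenerator x q)) = QuotientGroup.mk' K := by
      rw [← hy']
      ext s
      simp only [MonoidHom.comp_apply, FreeGroup.lift_apply_of]
      rcases s with ⟨v, i⟩ | e
      · by_cases h : Nonempty (A.Path v₀ v)
        · simp only [pathGenerator, h, dif_pos]
          rw [hCh, hCcomp, hCcomp, hCinv, hCq]
          simp only [one_mul, inv_one, mul_one]
          have := wordEval_vertexWord_eq hy (v := v) (w := W v (x v i)) (w' := [(i, true)])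
            (by rw [hW]; simp [wordEval_singleton])
          refine Eq.trans this ?_
          simp [vertexWord, wordEval_singleton]
        · simp only [pathGenerator, h, dif_neg, not_false_eq_true]
          rw [map_one]
          have := hy _ (Or.inr (Or.inr (Or.inr (Or.inl ⟨v, i, not_nonempty_iff.1 h, rfl⟩))))
          simpa [wordEval_singleton] using this.symm
      · by_cases h : Nonempty (A.Path v₀ (A.o e))
        · simp only [pathGenerator, h, dif_pos]
          rw [hCh, hCcomp, hCcomp, hCinv, hCq, hCq]
          simp only [one_mul, inv_one, mul_one]
          have h1 : ∀ v, wordEval y (vertexWord v (W v 1)) = 1 := fun v => hC1 v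
          rw [ofEdge, hCmk, pathWord, pathWord, wordEval_append, wordEval_append, h1, h1]
          simp [wordEval_singleton]
        · simp only [pathGenerator, h, dif_neg, not_false_eq_true]
          rw [map_one]
          have := hy _ (Or.inr (Or.inr (Or.inr (Or.inr ⟨e, not_nonempty_iff.1 h, rfl⟩))))
          simpa [wordEval_singleton] using this.symm
    intro g hg
    have := DFunLike.congr_fun key g
    rw [MonoidHom.comp_apply, hg, map_one] at this
    exact (QuotientGroup.eq_one_iff g).1 this.symm
  · rintro g ⟨r, hr, rfl⟩
    exact wordEval_pathGenerator_eq_one hW q hq hr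

end Presentation

end GraphOfGroups

/-! ### Uniform membership in the vertex groups and the word problem of the fundamental group -/

theorem Semidecidable.mem_finite {α : Type*} [Primcodable α] {s : Set α} (hs : s.Finite) :
    Semidecidable fun a => a ∈ s := by
  refine (mem (f := fun a => a) (l := fun _ => hs.toFinset.toList) (by fun_prop)
    (by fun_prop)).of_eq fun a => by simp

section

variable {α β γ : Type*} [Primcodable α] [Primcodable β] [Primcodable γ]

theorem primrec_fun_inl {f : α → β} (hf : Primrec f) :
    Primrec (fun a => (Sum.inl (f a) : β ⊕ γ)) := Primrec.sumInl.comp hf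

theorem primrec_fun_invRev {f : α → List (β × Bool)} (hf : Primrec f) :
    Primrec (fun a => FreeGroup.invRev (f a)) := by
  unfold FreeGroup.invRev
  fun_prop

attribute [fun_prop] primrec_fun_inl primrec_fun_invRev

end

/-- A finite family of finitely generated groups has generating tuples over a common alphabet. -/
theorem exists_common_alphabet {V : Type u₁} [Finite V] (G : V → Type u₂) [∀ v, Group (G v)]
    (h : ∀ v, HasSolvableMembershipProblem (G v)) :
    ∃ (N : ℕ) (x : ∀ v, Fin N → G v), ∀ v, Subgroup.closure (Set.range (x v)) = ⊤ := by
  classical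
  choose n y hy _ using h
  obtain ⟨N, hN⟩ := (Set.finite_range n).bddAbove
  refine ⟨N, fun v i => if h : i < n v then y v ⟨i, h⟩ else 1, fun v => top_unique ?_⟩
  rw [← hy v]
  refine Subgroup.closure_mono ?_
  rintro _ ⟨i, rfl⟩
  exact ⟨⟨i, i.2.trans_le (hN ⟨v, rfl⟩)⟩, by simp⟩

/-- Membership in finitely generated subgroups is decidable, uniformly in `v`. -/
structure UniformMembership {V : Type u₁} [Primcodable V] {G : V → Type u₂} [∀ v, Group (G v)]
    {N : ℕ} (x : ∀ v, Fin N → G v) : Prop where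
  mem : Semidecidable fun z : V × List (Fin N × Bool) × List (List (Fin N × Bool)) =>
    wordEval (x z.1) z.2.1 ∈ wordSubgroup (x z.1) z.2.2
  not_mem : Semidecidable fun z : V × List (Fin N × Bool) × List (List (Fin N × Bool)) =>
    wordEval (x z.1) z.2.1 ∉ wordSubgroup (x z.1) z.2.2

theorem uniformMembership {V : Type u₁} [Primcodable V] [Finite V] {G : V → Type u₂}
    [∀ v, Group (G v)] {N : ℕ} (x : ∀ v, Fin N → G v)
    (h : ∀ v, HasSolvableMembershipProblem (G v)) : UniformMembership x where
  mem := by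
    have key (v : V) := Semidecidable.of_computablePred ((h v).membershipDecidable (x v))
    exact Semidecidable.of_finite key
  not_mem := by
    have key (v : V) := Semidecidable.of_computablePred ((h v).membershipDecidable (x v)).not
    exact Semidecidable.of_finite key

theorem UniformMembership.wordEval_eq_one {V : Type u₁} [Primcodable V] {G : V → Type u₂}
    [∀ v, Group (G v)] {N : ℕ} {x : ∀ v, Fin N → G v} (h : UniformMembership x) :
    Semidecidable fun z : V × List (Fin N × Bool) => wordEval (x z.1) z.2 = 1 :=
  (h.mem.comp (f := fun z : V × List (Fin N × Bool) => (z.1, z.2, [])) (by fun_prop)).of_eq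
    fun _ => wordEval_eq_one_iff_mem _ _

namespace GraphOfGroups

variable {V : Type u₁} {E : Type u₂} {A : GraphOfGroups.{u₁, u₂, u₃, u₄} V E}

open PathClass

theorem semidecidable_pathRelator [Primcodable V] [Primcodable E] [Finite E] {N : ℕ}
    {x : ∀ v, Fin N → A.vertexGroup v} (W : ∀ v, A.vertexGroup v → List (Fin N × Bool))
    (hx : UniformMembership x) (hE : ∀ e, Finite (A.edgeGroup e))
    {F : Set (List (((V × Fin N) ⊕ E) × Bool))} (hF : F.Finite) :
    Semidecidable (PathRelator x W F) := by
  unfold PathRelator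
  refine .or (.ex (.ex (.and ?_ (.eq (by fun_prop) ?_)))) (.or ?_ (Semidecidable.mem_finite hF))
  · exact hx.wordEval_eq_one.comp (f := fun z : (List (((V × Fin N) ⊕ E) × Bool) × V) ×
      List (Fin N × Bool) => (z.1.2, z.2)) (by fun_prop)
  · unfold vertexWord
    fun_prop
  · refine (Semidecidable.mem_finite (Set.finite_range fun z : Σ e, A.edgeGroup e =>
      [(Sum.inr z.1, true)] ++ vertexWord (A.t z.1) (W _ (A.ω z.1 z.2)) ++ [(Sum.inr z.1, false)] ++
        vertexWord (A.o z.1) (W _ (A.α z.1 z.2)⁻¹))).of_eq fun r => ?_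
    simp only [Set.mem_range, Sigma.exists]
    exact exists_congr fun e => exists_congr fun c => eq_comm

/-- The generators are kept as explicit paths and not only as group elements, since certificates
trace paths. -/
theorem exists_generators [Primcodable V] [Finite V] [Primcodable E] [Finite E] {N : ℕ}
    {x : ∀ v, Fin N → A.vertexGroup v} (hgen : ∀ v, Subgroup.closure (Set.range (x v)) = ⊤)
    (hx : UniformMembership x) (hE : ∀ e, Finite (A.edgeGroup e)) (v₀ : V) :
    ∃ (n : ℕ) (P : Fin n → A.Path v₀ v₀),
      Subgroup.closure (Set.range fun j => toGroup (ofPath (P j))) = ⊤ ∧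
      Semidecidable fun w : List (Fin n × Bool) =>
        wordEval (fun j => toGroup (ofPath (P j))) w = 1 := by
  choose W hW using fun v => exists_wordEval_eq (hgen v)
  obtain ⟨q, hq⟩ := exists_base_paths A v₀
  obtain ⟨n, ⟨f⟩⟩ := Finite.exists_equiv_fin ((V × Fin N) ⊕ E)
  choose P hP using fun j : Fin n => ofPath_surjective (A := A) (v := v₀) (w := v₀)
    (pathGenerator x q (f.symm j))
  have hP' : (fun j => toGroup (ofPath (P j))) = fun j => pathGenerator x q (f.symm j) :=
    funext fun j => hP j
  refine ⟨n, P, ?_, ?_⟩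
  · rw [hP']
    have : (Set.range fun j => pathGenerator x q (f.symm j)) = Set.range (pathGenerator x q) :=
      f.symm.surjective.range_comp (pathGenerator x q)
    rw [this, ← FreeGroup.range_lift_eq_closure]
    exact MonoidHom.range_eq_top.2 (lift_pathGenerator_surjective hW q hq)
  · rw [hP']
    have hR := Semidecidable.mem_normalClosure (σ := Unit)
      (R := fun _ => PathRelator x W (treeRelators W q))
      ((semidecidable_pathRelator W hx hE (treeRelators_finite q)).comp (f := Prod.snd)
        (by fun_prop))
    have hf : Primrec f.symm := Primrec.dom_finite _
    refine (hR.comp (f := fun w : List (Fin n × Bool) =>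
      ((), w.map fun t => (f.symm t.1, t.2))) (by fun_prop)).of_eq fun w => ?_
    rw [← ker_lift_pathGenerator hW q hq, MonoidHom.mem_ker]
    exact (wordEval_map_letters (pathGenerator x q) f.symm w) ▸ Iff.rfl

end GraphOfGroups

/-! ### Groups with finitely many generators and relators, presented on the letters in `ℕ` -/

/-- The relators in the list `K.2`, and the letters `i ≥ K.1`. -/
def TruncatedRelator (K : ℕ × List (List (ℕ × Bool))) (r : List (ℕ × Bool)) : Prop :=
  r ∈ K.2 ∨ ∃ i, K.1 ≤ i ∧ r = [(i, true)]

/-- The group with generators `0, …, K.1 - 1` and relators `K.2`. -/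
abbrev TruncatedGroup (K : ℕ × List (List (ℕ × Bool))) : Type :=
  FreeGroup ℕ ⧸ Subgroup.normalClosure {g | ∃ r, TruncatedRelator K r ∧ FreeGroup.mk r = g}

/-- The generators of `TruncatedGroup K`. -/
def truncatedOf (K : ℕ × List (List (ℕ × Bool))) (i : ℕ) : TruncatedGroup K :=
  (FreeGroup.of i : FreeGroup ℕ)

theorem lift_truncatedOf (K : ℕ × List (List (ℕ × Bool))) :
    FreeGroup.lift (truncatedOf K) = QuotientGroup.mk' _ := by
  ext i
  simp [truncatedOf]

theorem wordEval_truncatedOf_eq_one_iff (K : ℕ × List (List (ℕ × Bool))) (w : List (ℕ × Bool)) :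
    wordEval (truncatedOf K) w = 1 ↔ FreeGroup.mk w ∈
      Subgroup.normalClosure {g | ∃ r, TruncatedRelator K r ∧ FreeGroup.mk r = g} := by
  rw [wordEval, lift_truncatedOf]
  exact QuotientGroup.eq_one_iff _

theorem semidecidable_truncatedOf :
    Semidecidable fun z : (ℕ × List (List (ℕ × Bool))) × List (ℕ × Bool) =>
      wordEval (truncatedOf z.1) z.2 = 1 := by
  refine (Semidecidable.mem_normalClosure (R := TruncatedRelator) ?_).of_eq
    fun z => wordEval_truncatedOf_eq_one_iff z.1 z.2
  unfold TruncatedRelator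
  exact .or (.mem (by fun_prop) (by fun_prop))
    (.ex (.and (.le (by fun_prop) (by fun_prop)) (.eq (by fun_prop) (by fun_prop))))

theorem wordEval_eq_iff {G : Type*} [Group G] {ι : Type*} (y : ι → G) (w w' : List (ι × Bool)) :
    wordEval y w = wordEval y w' ↔ wordEval y (w ++ FreeGroup.invRev w') = 1 := by
  rw [wordEval_append, wordEval_invRev, mul_inv_eq_one]

/-! ### Substituting words for letters -/

/-- The word obtained by substituting `f t` for the letter `t`. -/
def substWord {ι κ : Type*} (f : ι → List (κ × Bool)) (w : List (ι × Bool)) : List (κ × Bool) :=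
  w.flatMap fun s => bif s.2 then f s.1 else FreeGroup.invRev (f s.1)

theorem wordEval_substWord {G : Type*} [Group G] {ι κ : Type*} (y : κ → G)
    (f : ι → List (κ × Bool)) (w : List (ι × Bool)) :
    wordEval y (substWord f w) = wordEval (fun t => wordEval y (f t)) w := by
  induction w with
  | nil => simp [substWord, wordEval_nil]
  | cons s w ih =>
    rw [← List.singleton_append (x := s) (l := w), wordEval_append, ← ih, wordEval_singleton]
    obtain ⟨t, b⟩ := s
    cases b <;> simp [substWord, wordEval_append, wordEval_invRev]

theorem primrec_fun_substWord {α ι κ : Type*} [Primcodable α] [Primcodable ι] [Primcodable κ]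
    {f : α → ι → List (κ × Bool)} {w : α → List (ι × Bool)}
    (hf : Primrec fun p : α × ι => f p.1 p.2) (hw : Primrec w) :
    Primrec fun a => substWord (f a) (w a) := by
  unfold substWord
  have h : Primrec fun p : α × (ι × Bool) => f p.1 p.2.1 :=
    hf.comp (g := fun p : α × (ι × Bool) => (p.1, p.2.1)) (by fun_prop)
  fun_prop

attribute [fun_prop] primrec_fun_substWord

theorem mem_closure_image_iff {G : Type*} [Group G] {ι : Type*} (y : ι → G) (s : ι → Prop) (g : G) :
    g ∈ Subgroup.closure {h | ∃ t, s t ∧ y t = h} ↔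
      ∃ r : List (ι × Bool), (∀ t ∈ r, s t.1) ∧ wordEval y r = g := by
  constructor
  · intro h
    induction h using Subgroup.closure_induction with
    | mem g hg =>
      obtain ⟨t, ht, rfl⟩ := hg
      exact ⟨[(t, true)], by simpa using ht, by simp [wordEval_singleton]⟩
    | one => exact ⟨[], by simp, wordEval_nil y⟩
    | mul g h _ _ hg hh =>
      obtain ⟨r, hr, rfl⟩ := hg
      obtain ⟨r', hr', rfl⟩ := hh
      refine ⟨r ++ r', fun t ht => ?_, wordEval_append y r r'⟩
      rcases List.mem_append.1 ht with h | h
      · exact hr t h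
      · exact hr' t h
    | inv g _ hg =>
      obtain ⟨r, hr, rfl⟩ := hg
      refine ⟨FreeGroup.invRev r, fun t ht => ?_, wordEval_invRev y r⟩
      simp only [FreeGroup.invRev, List.mem_reverse, List.mem_map] at ht
      obtain ⟨t', ht', rfl⟩ := ht
      exact hr t' ht'
  · rintro ⟨r, hr, rfl⟩
    induction r with
    | nil => rw [wordEval_nil]; exact one_mem _
    | cons t r ih =>
      rw [← List.singleton_append, wordEval_append]
      refine mul_mem ?_ (ih fun t ht => hr t (by simp [ht]))
      have h1 : y t.1 ∈ Subgroup.closure {h | ∃ t, s t ∧ y t = h} :=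
        Subgroup.subset_closure ⟨t.1, hr t (by simp), rfl⟩
      rw [wordEval_singleton]
      cases t.2
      · exact inv_mem h1
      · exact h1

theorem wordEval_prod {G H : Type*} [Group G] [Group H] {ι : Type*} (y : ι → G) (z : ι → H)
    (w : List (ι × Bool)) :
    wordEval (fun i => (y i, z i)) w = (wordEval y w, wordEval z w) :=
  Prod.ext (map_wordEval (MonoidHom.fst G H) _ w) (map_wordEval (MonoidHom.snd G H) _ w)

/-! ### Certificates -/

/-- A point `(u, l, g)` of a certificate: the translate by `(l, g)` of the base point of the
orbit `u`. -/
abbrev CertPoint (N : ℕ) := ℕ × List (ℕ × Bool) × List (Fin N × Bool)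

/-- The generators of the stabilizers of the base points of the orbits `(v, u)`, and the pairs of
points that are joined by edges. -/
abbrev Certificate (V E : Type*) (N : ℕ) :=
  List ((V × ℕ) × List (List (Fin N × Bool) × List (ℕ × Bool))) ×
    List (E × CertPoint N × CertPoint N)

/-- The translate of a point. -/
def CertPoint.shift {N : ℕ} (l : List (ℕ × Bool)) (g : List (Fin N × Bool)) (p : CertPoint N) :
    CertPoint N :=
  (p.1, l ++ p.2.1, g ++ p.2.2)

theorem primrec_fun_shift {α : Type*} [Primcodable α] {N : ℕ} {l : α → List (ℕ × Bool)}
    {g : α → List (Fin N × Bool)} {p : α → CertPoint N} (hl : Primrec l) (hg : Primrec g)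
    (hp : Primrec p) : Primrec fun a => CertPoint.shift (l a) (g a) (p a) := by
  unfold CertPoint.shift
  fun_prop

attribute [fun_prop] primrec_fun_shift

namespace Certificate

section Stabilizers

variable {V : Type u₁} {E : Type u₂} {N : ℕ} {G : V → Type u₃} [∀ v, Group (G v)]
  (x : ∀ v, Fin N → G v) {L : Type u₅} [Group L] (y : ℕ → L) (C : Certificate V E N)

/-- `t` is one of the generators of the stabilizer of the base point of the orbit `(v, u)`. -/
def Gen (v : V) (u : ℕ) (t : List (Fin N × Bool) × List (ℕ × Bool)) : Prop :=
  ∃ B ∈ C.1, B.1 = (v, u) ∧ t ∈ B.2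

/-- The stabilizer of the base point of the orbit `(v, u)`. -/
def stab (v : V) (u : ℕ) : Subgroup (L × G v) :=
  Subgroup.closure {q | ∃ t, C.Gen v u t ∧ (wordEval y t.2, wordEval (x v) t.1) = q}

/-- Two points are equal. -/
def Same (v : V) (p p' : CertPoint N) : Prop :=
  p.1 = p'.1 ∧ (wordEval y (FreeGroup.invRev p'.2.1 ++ p.2.1),
    wordEval (x v) (FreeGroup.invRev p'.2.2 ++ p.2.2)) ∈ C.stab x y v p'.1

/-- Two points are in different orbits of `L`. -/
def Distinct (v : V) (p p' : CertPoint N) : Prop :=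
  p.1 ≠ p'.1 ∨ ∃ bs : List (List (Fin N × Bool)),
    (∀ B ∈ C.1, B.1 ≠ (v, p'.1) ∨ ∀ t ∈ B.2, t.1 ∈ bs) ∧
    wordEval (x v) (FreeGroup.invRev p'.2.2 ++ p.2.2) ∉ wordSubgroup (x v) bs

/-- `L` acts freely. -/
def Faithful : Prop := ∀ v u l, (l, 1) ∈ C.stab x y v u → l = 1

/-- One word `r` in the listed pairs has to yield both coordinates, so membership is a search over
`r` subject to one equation in `L` and one in `G v`. -/
theorem mem_stab_iff (v : V) (u : ℕ) (l : L) (g : G v) :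
    (l, g) ∈ C.stab x y v u ↔ ∃ r : List ((List (Fin N × Bool) × List (ℕ × Bool)) × Bool),
      (∀ t ∈ r, C.Gen v u t.1) ∧ wordEval y (substWord Prod.snd r) = l ∧
        wordEval (x v) (substWord Prod.fst r) = g := by
  rw [stab, mem_closure_image_iff]
  simp only [wordEval_prod, wordEval_substWord, Prod.mk.injEq]

variable {x} in
theorem semidecidable_same [Primcodable V] [Primcodable E] (hx : UniformMembership x) :
    Semidecidable fun z : (ℕ × List (List (ℕ × Bool))) × Certificate V E N × V × CertPoint N ×
      CertPoint N => z.2.1.Same x (truncatedOf z.1) z.2.2.1 z.2.2.2.1 z.2.2.2.2 := by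
  unfold Same
  simp only [mem_stab_iff]
  refine .and (.eq (by fun_prop) (by fun_prop)) (.ex (.and ?_ (.and ?_ ?_)))
  · refine .forall_mem (by fun_prop) ?_
    unfold Gen
    exact .exists_mem (by fun_prop) (.and (.eq (by fun_prop) (by fun_prop))
      (.mem (by fun_prop) (by fun_prop)))
  · refine (semidecidable_truncatedOf.comp (f := fun z : ((ℕ × List (List (ℕ × Bool))) ×
      Certificate V E N × V × CertPoint N × CertPoint N) ×
      List ((List (Fin N × Bool) × List (ℕ × Bool)) × Bool) =>
        (z.1.1, substWord Prod.snd z.2 ++ FreeGroup.invRev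
          (FreeGroup.invRev z.1.2.2.2.2.2.1 ++ z.1.2.2.2.1.2.1))) (by fun_prop)).of_eq
        fun z => wordEval_eq_iff _ _ _
  · refine (hx.wordEval_eq_one.comp (f := fun z : ((ℕ × List (List (ℕ × Bool))) ×
      Certificate V E N × V × CertPoint N × CertPoint N) ×
      List ((List (Fin N × Bool) × List (ℕ × Bool)) × Bool) =>
        (z.1.2.2.1, substWord Prod.fst z.2 ++ FreeGroup.invRev
          (FreeGroup.invRev z.1.2.2.2.2.2.2 ++ z.1.2.2.2.1.2.2))) (by fun_prop)).of_eq
        fun z => wordEval_eq_iff _ _ _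

variable {x} in
-- The word problem of `L` is only known to be semidecidable, so inequality cannot be tested there.
-- `Distinct` avoids `L`: it asks that an element of `G v` lie outside a subgroup containing the
-- projection of the stabilizer, which the membership problem of `G v` decides.
theorem semidecidable_distinct [Primcodable V] [Primcodable E] (hx : UniformMembership x) :
    Semidecidable fun z : Certificate V E N × V × CertPoint N × CertPoint N =>
      z.1.Distinct x z.2.1 z.2.2.1 z.2.2.2 := by
  unfold Distinct
  refine .or (.ne (by fun_prop) (by fun_prop)) (.ex (.and (.forall_mem (by fun_prop) (.or
    (.ne (by fun_prop) (by fun_prop)) (.forall_mem (by fun_prop)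
      (.mem (by fun_prop) (by fun_prop))))) ?_))
  exact hx.not_mem.comp (f := fun z : (Certificate V E N × V × CertPoint N × CertPoint N) ×
    List (List (Fin N × Bool)) =>
      (z.1.2.1, FreeGroup.invRev z.1.2.2.2.2.2 ++ z.1.2.2.1.2.2, z.2)) (by fun_prop)

end Stabilizers

end Certificate

/-! ### Conditions on the edges and blocks of a certificate, and tracing words -/

namespace Certificate

variable {V : Type u₁} {E : Type u₂} {A : GraphOfGroups.{u₁, u₂, u₃, u₄} V E} {N : ℕ}
  (x : ∀ v, Fin N → A.vertexGroup v) (W : ∀ v, A.vertexGroup v → List (Fin N × Bool))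
  (Q : E → List (List (Fin N × Bool) × List (Fin N × Bool)))
  {L : Type u₅} [Group L] (y : ℕ → L) (C : Certificate V E N)

/-- The edges of the certificate define partial bijections. The list `Q e` consists of pairs of
words for the images in the two vertex groups of the elements of the group of `e`. -/
def EdgesValid : Prop :=
  ∀ f ∈ C.2, ∀ f' ∈ C.2, f.1 ≠ f'.1 ∨ ∀ p ∈ Q f.1,
    (∃ l, C.Same x y (A.o f.1) (f.2.1.shift l p.1) f'.2.1 ∧
      C.Same x y (A.t f.1) (f.2.2.shift l p.2) f'.2.2) ∨
    (C.Distinct x (A.o f.1) (f.2.1.shift [] p.1) f'.2.1 ∧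
      C.Distinct x (A.t f.1) (f.2.2.shift [] p.2) f'.2.2)

/-- The path leads from the point `p` to the point `p'`. -/
def Reads : ∀ {v w : V}, A.Path v w → CertPoint N → CertPoint N → Prop
  | v, _, .nil a, p, p' => C.Same x y v (p.shift [] (W v a⁻¹)) p'
  | _, _, .fwd e a q, p, p' => ∃ f ∈ C.2, f.1 = e ∧
      C.Same x y (A.o e) (p.shift [] (W _ a⁻¹)) f.2.1 ∧ Reads q f.2.2 p'
  | _, _, .bwd e a q, p, p' => ∃ f ∈ C.2, f.1 = e ∧
      C.Same x y (A.t e) (p.shift [] (W _ a⁻¹)) f.2.2 ∧ Reads q f.2.1 p'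

/-- The path for a letter. -/
def letterPath {v₀ : V} {n : ℕ} (P : Fin n → A.Path v₀ v₀) (j : Fin n × Bool) : A.Path v₀ v₀ :=
  bif j.2 then P j.1 else (P j.1).reverse

/-- The first letter of a word leads from one point to another. -/
def ReadStep {v₀ : V} {n : ℕ} (P : Fin n → A.Path v₀ v₀)
    (s s' : List (Fin n × Bool) × CertPoint N) : Prop :=
  ∃ j, s.1 = j :: s'.1 ∧ C.Reads x W y (letterPath P j) s.2 s'.2

/-- The word leads from the point `p` to the point `p'`. -/
def ReadsWord {v₀ : V} {n : ℕ} (P : Fin n → A.Path v₀ v₀) (w : List (Fin n × Bool))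
    (p p' : CertPoint N) : Prop :=
  Relation.ReflTransGen (C.ReadStep x W y P) (w, p) ([], p')

/-- The `i`-th word of the list `S` leads from `p` to its translate by the letter `i`. -/
def ReadsGenerators {v₀ : V} {n : ℕ} (P : Fin n → A.Path v₀ v₀)
    (S : List (List (Fin n × Bool))) (p : CertPoint N) : Prop :=
  ∀ i ∈ List.range S.length, ∃ p', C.ReadsWord x W y P (S.getD i []) p p' ∧
    C.Same x y v₀ p' (p.shift [(i, true)] [])

/-- The generators of each stabilizer are those of a presentation whose relators are trivial
in `L`. -/
def BlocksPresented
    (F : ∀ _ : V, List (List (Fin N × Bool)) →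
      List (List (Fin N × Bool)) × List (List (ℕ × Bool))) : Prop :=
  (∀ B ∈ C.1, ∀ B' ∈ C.1, B.1 ≠ B'.1 ∨ B = B') ∧
  ∀ B ∈ C.1, ∃ w R, F B.1.1 w = R ∧ B.2.map Prod.fst = R.1 ∧
    ∀ r ∈ R.2, wordEval y (substWord (fun i => (B.2.map Prod.snd).getD i []) r) = 1

variable {x} [Primcodable V] [Primcodable E]

section

variable [Finite E]

theorem semidecidable_edgesValid (hx : UniformMembership x) :
    Semidecidable fun z : (ℕ × List (List (ℕ × Bool))) × Certificate V E N =>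
      z.2.EdgesValid x Q (truncatedOf z.1) := by
  have hQ : Primrec Q := Primrec.dom_finite Q
  have ho : Primrec A.o := Primrec.dom_finite _
  have ht : Primrec A.t := Primrec.dom_finite _
  unfold EdgesValid
  refine .forall_mem (by fun_prop) (.forall_mem (by fun_prop) (.or (.ne (by fun_prop)
    (by fun_prop)) (.forall_mem (by fun_prop) (.or (.ex (.and ?_ ?_)) (.and ?_ ?_)))))
  · exact (semidecidable_same (E := E) hx).comp (f := fun z : (((((ℕ × List (List (ℕ × Bool))) ×
      Certificate V E N) × E × CertPoint N × CertPoint N) × E × CertPoint N × CertPoint N) ×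
      List (Fin N × Bool) × List (Fin N × Bool)) × List (ℕ × Bool) =>
        (z.1.1.1.1.1, z.1.1.1.1.2, A.o z.1.1.1.2.1, z.1.1.1.2.2.1.shift z.2 z.1.2.1,
          z.1.1.2.2.1)) (by fun_prop)
  · exact (semidecidable_same (E := E) hx).comp (f := fun z : (((((ℕ × List (List (ℕ × Bool))) ×
      Certificate V E N) × E × CertPoint N × CertPoint N) × E × CertPoint N × CertPoint N) ×
      List (Fin N × Bool) × List (Fin N × Bool)) × List (ℕ × Bool) =>
        (z.1.1.1.1.1, z.1.1.1.1.2, A.t z.1.1.1.2.1, z.1.1.1.2.2.2.shift z.2 z.1.2.2,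
          z.1.1.2.2.2)) (by fun_prop)
  · exact (semidecidable_distinct (E := E) hx).comp (f := fun z : ((((ℕ × List (List (ℕ × Bool))) ×
      Certificate V E N) × E × CertPoint N × CertPoint N) × E × CertPoint N × CertPoint N) ×
      List (Fin N × Bool) × List (Fin N × Bool) =>
        (z.1.1.1.2, A.o z.1.1.2.1, z.1.1.2.2.1.shift [] z.2.1, z.1.2.2.1)) (by fun_prop)
  · exact (semidecidable_distinct (E := E) hx).comp (f := fun z : ((((ℕ × List (List (ℕ × Bool))) ×
      Certificate V E N) × E × CertPoint N × CertPoint N) × E × CertPoint N × CertPoint N) ×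
      List (Fin N × Bool) × List (Fin N × Bool) =>
        (z.1.1.1.2, A.t z.1.1.2.1, z.1.1.2.2.2.shift [] z.2.2, z.1.2.2.2)) (by fun_prop)

end

theorem semidecidable_reads (hx : UniformMembership x) {v w : V} (q : A.Path v w) :
    Semidecidable fun z : (ℕ × List (List (ℕ × Bool))) × Certificate V E N × CertPoint N ×
      CertPoint N => z.2.1.Reads x W (truncatedOf z.1) q z.2.2.1 z.2.2.2 := by
  induction q with
  | @nil v a =>
    exact (semidecidable_same (E := E) hx).comp (f := fun z : (ℕ × List (List (ℕ × Bool))) ×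
      Certificate V E N × CertPoint N × CertPoint N =>
        (z.1, z.2.1, v, z.2.2.1.shift [] (W v a⁻¹), z.2.2.2)) (by fun_prop)
  | fwd e a q ih =>
    refine .exists_mem (by fun_prop) (.and (.eq (by fun_prop) (by fun_prop)) (.and ?_ ?_))
    · exact (semidecidable_same (E := E) hx).comp (f := fun z : ((ℕ × List (List (ℕ × Bool))) ×
        Certificate V E N × CertPoint N × CertPoint N) × E × CertPoint N × CertPoint N =>
          (z.1.1, z.1.2.1, A.o e, z.1.2.2.1.shift [] (W _ a⁻¹), z.2.2.1)) (by fun_prop)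
    · exact ih.comp (f := fun z : ((ℕ × List (List (ℕ × Bool))) ×
        Certificate V E N × CertPoint N × CertPoint N) × E × CertPoint N × CertPoint N =>
          (z.1.1, z.1.2.1, z.2.2.2, z.1.2.2.2)) (by fun_prop)
  | bwd e a q ih =>
    refine .exists_mem (by fun_prop) (.and (.eq (by fun_prop) (by fun_prop)) (.and ?_ ?_))
    · exact (semidecidable_same (E := E) hx).comp (f := fun z : ((ℕ × List (List (ℕ × Bool))) ×
        Certificate V E N × CertPoint N × CertPoint N) × E × CertPoint N × CertPoint N =>
          (z.1.1, z.1.2.1, A.t e, z.1.2.2.1.shift [] (W _ a⁻¹), z.2.2.2)) (by fun_prop)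
    · exact ih.comp (f := fun z : ((ℕ × List (List (ℕ × Bool))) ×
        Certificate V E N × CertPoint N × CertPoint N) × E × CertPoint N × CertPoint N =>
          (z.1.1, z.1.2.1, z.2.2.1, z.1.2.2.2)) (by fun_prop)

theorem semidecidable_readsWord (hx : UniformMembership x) {v₀ : V} {n : ℕ}
    (P : Fin n → A.Path v₀ v₀) :
    Semidecidable fun z : ((ℕ × List (List (ℕ × Bool))) × Certificate V E N) ×
      List (Fin n × Bool) × CertPoint N × CertPoint N =>
        z.1.2.ReadsWord x W (truncatedOf z.1.1) P z.2.1 z.2.2.1 z.2.2.2 := by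
  have hstep : Semidecidable fun z : ((ℕ × List (List (ℕ × Bool))) × Certificate V E N) ×
      (List (Fin n × Bool) × CertPoint N) × (List (Fin n × Bool) × CertPoint N) =>
        z.1.2.ReadStep x W (truncatedOf z.1.1) P z.2.1 z.2.2 := by
    unfold ReadStep
    refine .ex (.and (.eq (by fun_prop) (by fun_prop)) ?_)
    have h := Semidecidable.of_finite fun j : Fin n × Bool =>
      semidecidable_reads (W := W) hx (letterPath P j)
    exact h.comp (f := fun z : (((ℕ × List (List (ℕ × Bool))) × Certificate V E N) ×
      (List (Fin n × Bool) × CertPoint N) × (List (Fin n × Bool) × CertPoint N)) × Fin n × Bool =>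
        (z.2, z.1.1.1, z.1.1.2, z.1.2.1.2, z.1.2.2.2)) (by fun_prop)
  exact (Semidecidable.reflTransGen (r := fun s : (ℕ × List (List (ℕ × Bool))) ×
    Certificate V E N => s.2.ReadStep x W (truncatedOf s.1) P) hstep).comp
      (f := fun z : ((ℕ × List (List (ℕ × Bool))) × Certificate V E N) ×
      List (Fin n × Bool) × CertPoint N × CertPoint N =>
        (z.1, (z.2.1, z.2.2.1), ([], z.2.2.2))) (by fun_prop)

theorem semidecidable_readsGenerators (hx : UniformMembership x) {v₀ : V} {n : ℕ}
    (P : Fin n → A.Path v₀ v₀) :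
    Semidecidable fun z : ((ℕ × List (List (ℕ × Bool))) × Certificate V E N) ×
      List (List (Fin n × Bool)) × CertPoint N =>
        z.1.2.ReadsGenerators x W (truncatedOf z.1.1) P z.2.1 z.2.2 := by
  unfold ReadsGenerators
  refine .forall_mem (by fun_prop) (.ex (.and ?_ ?_))
  · exact (semidecidable_readsWord W hx P).comp (f := fun z : ((((ℕ × List (List (ℕ × Bool))) ×
      Certificate V E N) × List (List (Fin n × Bool)) × CertPoint N) × ℕ) × CertPoint N =>
        (z.1.1.1, z.1.1.2.1.getD z.1.2 [], z.1.1.2.2, z.2)) (by fun_prop)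
  · exact (semidecidable_same (E := E) hx).comp (f := fun z : ((((ℕ × List (List (ℕ × Bool))) ×
      Certificate V E N) × List (List (Fin n × Bool)) × CertPoint N) × ℕ) × CertPoint N =>
        (z.1.1.1.1, z.1.1.1.2, v₀, z.2, z.1.1.2.2.shift [(z.1.2, true)] [])) (by fun_prop)

theorem semidecidable_blocksPresented [Finite V]
    {F : ∀ _ : V, List (List (Fin N × Bool)) →
      List (List (Fin N × Bool)) × List (List (ℕ × Bool))} (hF : ∀ v, Computable (F v)) :
    Semidecidable fun z : (ℕ × List (List (ℕ × Bool))) × Certificate V E N =>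
      z.2.BlocksPresented (truncatedOf z.1) F := by
  unfold BlocksPresented
  refine .and (.forall_mem (by fun_prop) (.forall_mem (by fun_prop) (.or
    (.ne (by fun_prop) (by fun_prop)) (.eq (by fun_prop) (by fun_prop)))))
    (.forall_mem (by fun_prop) (.ex (.ex (.and ?_ (.and (.eq (by fun_prop) (by fun_prop))
      (.forall_mem (by fun_prop) ?_))))))
  · have h := Semidecidable.of_finite fun v => Semidecidable.graph (hF v)
    exact h.comp (f := fun z : ((((ℕ × List (List (ℕ × Bool))) × Certificate V E N) ×
      (V × ℕ) × List (List (Fin N × Bool) × List (ℕ × Bool))) × List (List (Fin N × Bool))) ×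
      List (List (Fin N × Bool)) × List (List (ℕ × Bool)) =>
        (z.1.1.2.1.1, z.1.2, z.2)) (by fun_prop)
  · exact semidecidable_truncatedOf.comp (f := fun z : (((((ℕ × List (List (ℕ × Bool))) ×
      Certificate V E N) ×
      (V × ℕ) × List (List (Fin N × Bool) × List (ℕ × Bool))) × List (List (Fin N × Bool))) ×
      List (List (Fin N × Bool)) × List (List (ℕ × Bool))) × List (ℕ × Bool) =>
        (z.1.1.1.1.1, substWord (fun i => (z.1.1.1.2.2.map Prod.snd).getD i []) z.2))
      (by fun_prop)

end Certificate

/-! ### The action defined by a certificate -/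

namespace Certificate

section Points

variable {V : Type u₁} {E : Type u₂} {N : ℕ} {G : V → Type u₃} [∀ v, Group (G v)]
  (x : ∀ v, Fin N → G v) {L : Type u₅} [Group L] (y : ℕ → L) (C : Certificate V E N)

/-- The union of the orbits of `L × G v` with the prescribed stabilizers. -/
abbrev Points (v : V) : Type (max u₃ u₅) := Σ u : ℕ, (L × G v) ⧸ C.stab x y v u

/-- The element of the union of orbits that a point of the certificate stands for. -/
def point (v : V) (p : CertPoint N) : C.Points x y v :=
  ⟨p.1, QuotientGroup.mk (wordEval y p.2.1, wordEval (x v) p.2.2)⟩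

theorem point_eq_iff (v : V) (p p' : CertPoint N) :
    C.point x y v p = C.point x y v p' ↔ C.Same x y v p p' := by
  obtain ⟨u, l, g⟩ := p
  obtain ⟨u', l', g'⟩ := p'
  simp only [point, Same, Sigma.mk.injEq]
  constructor
  · rintro ⟨rfl, h⟩
    refine ⟨rfl, ?_⟩
    rw [heq_iff_eq, eq_comm, QuotientGroup.eq] at h
    simpa [wordEval_append, wordEval_invRev] using h
  · rintro ⟨rfl, h⟩
    refine ⟨rfl, ?_⟩
    rw [heq_iff_eq, eq_comm, QuotientGroup.eq]
    simpa [wordEval_append, wordEval_invRev] using h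

theorem point_shift (v : V) (l : List (ℕ × Bool)) (g : List (Fin N × Bool)) (p : CertPoint N) :
    C.point x y v (p.shift l g) = (wordEval y l, wordEval (x v) g) • C.point x y v p := by
  simp only [point, CertPoint.shift, wordEval_append]
  rfl

variable {x y C}

/-- The stabilizer of a point is conjugate to that of the base point of its orbit, and conjugation
preserves `L × 1`. -/
theorem Faithful.eq_one (hC : C.Faithful x y) {v : V} {l : L} {z : C.Points x y v}
    (h : ((l, 1) : L × G v) • z = z) : l = 1 := by
  obtain ⟨u, z⟩ := z
  induction z using QuotientGroup.induction_on with
  | H q =>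
    obtain ⟨m, g⟩ := q
    have h' : QuotientGroup.mk (((l, 1) : L × G v) * (m, g)) =
        (QuotientGroup.mk (m, g) : (L × G v) ⧸ C.stab x y v u) := by
      exact eq_of_heq (Sigma.mk.inj h).2
    rw [eq_comm, QuotientGroup.eq] at h'
    have := hC v u (m⁻¹ * (l * m)) (by simpa using h')
    simpa [mul_eq_one_iff_eq_inv] using this

/-- Second coordinates of stabilizer elements lie in the subgroup generated by `bs`, and translation
by `l` does not change second coordinates. -/
theorem Distinct.smul_point_ne {v : V} {p p' : CertPoint N} (h : C.Distinct x v p p') (l : L) :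
    ((l, 1) : L × G v) • C.point x y v p ≠ C.point x y v p' := by
  intro heq
  obtain ⟨u, m, g⟩ := p
  obtain ⟨u', m', g'⟩ := p'
  obtain rfl : u = u' := congrArg Sigma.fst heq
  rcases h with h | ⟨bs, hbs, h⟩
  · exact h rfl
  have h' : QuotientGroup.mk (((l, 1) : L × G v) * (wordEval y m, wordEval (x v) g)) =
      (QuotientGroup.mk (wordEval y m', wordEval (x v) g') : (L × G v) ⧸ C.stab x y v u) :=
    eq_of_heq (Sigma.mk.inj heq).2
  rw [eq_comm, QuotientGroup.eq] at h'
  have hle : C.stab x y v u ≤ (wordSubgroup (x v) bs).comap (MonoidHom.snd L (G v)) := by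
    refine (Subgroup.closure_le _).2 ?_
    rintro _ ⟨t, ⟨B, hB, hBu, ht⟩, rfl⟩
    exact Subgroup.subset_closure ⟨t.1, ((hbs B hB).resolve_left (not_not.2 hBu)) t ht, rfl⟩
  refine h ?_
  have := hle h'
  simpa [wordEval_append, wordEval_invRev] using this

end Points

section Action

variable {V : Type u₁} {E : Type u₂} {A : GraphOfGroups.{u₁, u₂, u₃, u₄} V E} {N : ℕ}
  {x : ∀ v, Fin N → A.vertexGroup v} {W : ∀ v, A.vertexGroup v → List (Fin N × Bool)}
  {Q : E → List (List (Fin N × Bool) × List (Fin N × Bool))}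
  {L : Type u₅} [Group L] {y : ℕ → L} {C : Certificate V E N}

/-- For a given `c`, freeness leaves at most one `l` carrying one point to another. If the points
are joined by some `m`, the same `m` works at both ends of the edge, so both sides say `l = wordEval
y m`; if they are distinct, both sides fail for every `l`. -/
theorem EdgesValid.smul_eq_iff
    (hQ : ∀ e c, ∃ p ∈ Q e, wordEval (x _) p.1 = A.α e c ∧ wordEval (x _) p.2 = A.ω e c)
    (h : C.EdgesValid x Q y) (hC : C.Faithful x y) {e : E} {p q p' q' : CertPoint N}
    (hf : (e, p, q) ∈ C.2) (hf' : (e, p', q') ∈ C.2) (l : L) (c : A.edgeGroup e) :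
    (l, A.α e c) • C.point x y (A.o e) p = C.point x y (A.o e) p' ↔
      (l, A.ω e c) • C.point x y (A.t e) q = C.point x y (A.t e) q' := by
  obtain ⟨r, hr, hr1, hr2⟩ := hQ e c
  rcases ((h _ hf _ hf').resolve_left (by simp)) r hr with ⟨m, hm1, hm2⟩ | ⟨h1, h2⟩
  · rw [← point_eq_iff, point_shift] at hm1 hm2
    simp only [hr1, hr2] at hm1 hm2
    have aux : ∀ {v : V} {b : A.vertexGroup v} {z z' : C.Points x y v},
        (wordEval y m, b) • z = z' → ((l, b) • z = z' ↔ l = wordEval y m) := by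
      intro v b z z' hz
      refine ⟨fun h => ?_, fun h => by rw [h, hz]⟩
      have : ((l * (wordEval y m)⁻¹, 1) : L × A.vertexGroup v) • z' = z' := by
        rw [← hz, smul_smul, hz]
        simpa using h
      simpa [mul_eq_one_iff_eq_inv] using hC.eq_one this
    rw [aux hm1, aux hm2]
  · have aux : ∀ {v : V} {b : A.vertexGroup v} {w : List (Fin N × Bool)} {p p' : CertPoint N},
        wordEval (x v) w = b → C.Distinct x v (p.shift [] w) p' →
        ¬(l, b) • C.point x y v p = C.point x y v p' := by
      intro v b w p p' hb hd heq
      refine hd.smul_point_ne (y := y) l ?_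
      rw [point_shift, smul_smul, ← heq, hb]
      simp [wordEval_nil]
    simp only [aux hr1 h1, aux hr2 h2]

/-- A certificate defines an action of the fundamental group. -/
theorem EdgesValid.exists_action
    (hQ : ∀ e c, ∃ p ∈ Q e, wordEval (x _) p.1 = A.α e c ∧ wordEval (x _) p.2 = A.ω e c)
    (hW : ∀ v a, wordEval (x v) (W v a) = a)
    (h : C.EdgesValid x Q y) (hC : C.Faithful x y) :
    ∃ (B : GraphOfGroups.EquivariantAction.{u₁, u₂, u₃, u₄, u₅, max u₁ u₃ u₅} A L)
      (ι : ∀ v, C.Points x y v → B.carrier v), (∀ v, Function.Injective (ι v)) ∧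
      (∀ v (q : L × A.vertexGroup v) z, ι v (q • z) = q • ι v z) ∧
      ∀ {v w : V} (q : A.Path v w) (p p' : CertPoint N), C.Reads x W y q p p' →
        B.act q (ι v (C.point x y v p)) = ι w (C.point x y w p') := by
  obtain ⟨B, ι, hι, hιs, hτ⟩ :=
    GraphOfGroups.exists_completion.{u₁, u₂, u₃, u₄, u₅, max u₃ u₅} (A := A)
      (fun v => C.Points x y v) (I := fun e => {f : CertPoint N × CertPoint N // (e, f) ∈ C.2})
      (fun e f => C.point x y _ f.1.1) (fun e f => C.point x y _ f.1.2)
      (fun e i j l c => EdgesValid.smul_eq_iff hQ h hC i.2 j.2 l c)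
  refine ⟨B, ι, hι, hιs, ?_⟩
  have key : ∀ {v : V} (a : A.vertexGroup v) (p p' : CertPoint N),
      C.Same x y v (p.shift [] (W v a⁻¹)) p' →
      ((1, a⁻¹) : L × A.vertexGroup v) • ι v (C.point x y v p) = ι v (C.point x y v p') := by
    intro v a p p' hs
    rw [← point_eq_iff, point_shift, hW, wordEval_nil] at hs
    rw [← hs, hιs]
  intro v w q
  induction q with
  | nil a => exact fun p p' hs => key a p p' hs
  | fwd e a q ih =>
    rintro p p' ⟨⟨_, p1, p2⟩, hf, rfl, hs, hr⟩
    rw [GraphOfGroups.EquivariantAction.act, key a _ _ hs, hτ _ ⟨(p1, p2), hf⟩]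
    exact ih _ _ hr
  | bwd e a q ih =>
    rintro p p' ⟨⟨_, p1, p2⟩, hf, rfl, hs, hr⟩
    rw [GraphOfGroups.EquivariantAction.act, key a _ _ hs, ← hτ _ ⟨(p1, p2), hf⟩,
      Equiv.symm_apply_apply]
    exact ih _ _ hr

open GraphOfGroups GraphOfGroups.PathClass in
theorem act_readsWord {B : EquivariantAction.{u₁, u₂, u₃, u₄, u₅, u₆} A L}
    {ι : ∀ v, C.Points x y v → B.carrier v}
    (hB : ∀ {v w : V} (q : A.Path v w) (p p' : CertPoint N), C.Reads x W y q p p' →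
      B.act q (ι v (C.point x y v p)) = ι w (C.point x y w p'))
    {v₀ : V} {n : ℕ} (P : Fin n → A.Path v₀ v₀) (w : List (Fin n × Bool)) (p p' : CertPoint N)
    (h : C.ReadsWord x W y P w p p') :
    B.rightAct (wordEval (fun j => toGroup (ofPath (P j))) w) (ι v₀ (C.point x y v₀ p)) =
      ι v₀ (C.point x y v₀ p') := by
  suffices H : ∀ s : List (Fin n × Bool) × CertPoint N,
      Relation.ReflTransGen (C.ReadStep x W y P) s ([], p') →
      B.rightAct (wordEval (fun j => toGroup (ofPath (P j))) s.1) (ι v₀ (C.point x y v₀ s.2)) =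
        ι v₀ (C.point x y v₀ p') from H _ h
  intro s hs
  induction hs using Relation.ReflTransGen.head_induction_on with
  | refl => simp only [wordEval_nil, B.rightAct_one]
  | head h1 _ ih =>
    obtain ⟨j, hj, hr⟩ := h1
    rw [hj, ← List.singleton_append, wordEval_append, B.rightAct_mul, ← ih, ← hB _ _ _ hr]
    congr 1
    rw [wordEval_singleton]
    obtain ⟨i, b⟩ := j
    cases b <;> rfl

end Action

end Certificate

/-! ### Comparison of the actions of the auxiliary group and of the fundamental group -/

namespace GraphOfGroups.EquivariantAction

variable {V : Type u₁} {E : Type u₂} {A : GraphOfGroups.{u₁, u₂, u₃, u₄} V E}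
  {L : Type u₅} [Group L] (B : EquivariantAction.{u₁, u₂, u₃, u₄, u₅, u₆} A L)

/-- The pairs of elements that act in the same way on the point `z`. -/
def translations {v₀ : V} (z : B.carrier v₀) : Subgroup (L × A.FundamentalGroup v₀) where
  carrier := {q | B.rightAct q.2 z = ((q.1, 1) : L × A.vertexGroup v₀) • z}
  one_mem' := by
    simp only [Set.mem_ofPred_eq, Prod.snd_one, Prod.fst_one, B.rightAct_one]
    exact (one_smul _ z).symm
  mul_mem' {q q'} h h' := by
    simp only [Set.mem_ofPred_eq, Prod.snd_mul, Prod.fst_mul] at h h' ⊢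
    rw [B.rightAct_mul, h, B.rightAct_smul, h', smul_smul, Prod.mk_mul_mk, one_mul]
  inv_mem' {q} h := by
    simp only [Set.mem_ofPred_eq, Prod.snd_inv, Prod.fst_inv] at h ⊢
    have h1 := B.rightAct_mul q.2 q.2⁻¹ z
    rw [mul_inv_cancel, B.rightAct_one, h, B.rightAct_smul] at h1
    rw [← one_smul (L × A.vertexGroup v₀) (B.rightAct q.2⁻¹ z)]
    conv_rhs => rw [h1]
    simp [smul_smul, ← Prod.one_eq_mk]

theorem mem_translations {v₀ : V} {z : B.carrier v₀} {q : L × A.FundamentalGroup v₀} :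
    q ∈ B.translations z ↔ B.rightAct q.2 z = ((q.1, 1) : L × A.vertexGroup v₀) • z := Iff.rfl

end GraphOfGroups.EquivariantAction

namespace Certificate

open GraphOfGroups GraphOfGroups.PathClass

variable {V : Type u₁} {E : Type u₂} {A : GraphOfGroups.{u₁, u₂, u₃, u₄} V E} {N : ℕ}
  {x : ∀ v, Fin N → A.vertexGroup v} {W : ∀ v, A.vertexGroup v → List (Fin N × Bool)}
  {Q : E → List (List (Fin N × Bool) × List (Fin N × Bool))}
  {L : Type u₅} [Group L] {y : ℕ → L} {C : Certificate V E N}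
  {v₀ : V} {n : ℕ} {P : Fin n → A.Path v₀ v₀}

theorem wordEval_mem_translations {B : EquivariantAction.{u₁, u₂, u₃, u₄, u₅, u₆} A L}
    {ι : ∀ v, C.Points x y v → B.carrier v}
    (hι : ∀ v (q : L × A.vertexGroup v) z, ι v (q • z) = q • ι v z)
    (hB : ∀ {v w : V} (q : A.Path v w) (p p' : CertPoint N), C.Reads x W y q p p' →
      B.act q (ι v (C.point x y v p)) = ι w (C.point x y w p'))
    {S : List (List (Fin n × Bool))} {p : CertPoint N}
    (hS : C.ReadsGenerators x W y P S p) (hy : ∀ i, S.length ≤ i → y i = 1)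
    (w : List (ℕ × Bool)) :
    (wordEval y w, wordEval (fun i => wordEval (fun j => toGroup (ofPath (P j)))
      (S.getD i [])) w) ∈ B.translations (ι v₀ (C.point x y v₀ p)) := by
  have hgen : ∀ i, (y i, wordEval (fun j => toGroup (ofPath (P j))) (S.getD i [])) ∈
      B.translations (ι v₀ (C.point x y v₀ p)) := by
    intro i
    rcases lt_or_ge i S.length with hi | hi
    · obtain ⟨p', hr, hs⟩ := hS i (List.mem_range.2 hi)
      rw [EquivariantAction.mem_translations, act_readsWord hB P _ _ _ hr,
        (C.point_eq_iff x y v₀ _ _).2 hs, point_shift, hι, wordEval_nil, wordEval_singleton]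
      rfl
    -- Letters beyond the list are trivial on both sides: `y i` by assumption, the word as the
    -- default `[]`.
    · rw [hy i hi, List.getD_eq_default _ _ hi, wordEval_nil]
      exact one_mem _
  rw [← wordEval_prod]
  have hle : (FreeGroup.lift fun i => (y i, wordEval (fun j => toGroup (ofPath (P j)))
      (S.getD i []))).range ≤ B.translations (ι v₀ (C.point x y v₀ p)) := by
    rw [FreeGroup.range_lift_eq_closure, Subgroup.closure_le]
    rintro _ ⟨i, rfl⟩
    exact hgen i
  exact hle ⟨_, rfl⟩

/-- The trivial element of the fundamental group moves `p` by `wordEval y w`, which is therefore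
trivial by freeness. So every relation among the words in `S` already holds among the `y i`. -/
theorem EdgesValid.wordEval_eq_one
    (hQ : ∀ e c, ∃ p ∈ Q e, wordEval (x _) p.1 = A.α e c ∧ wordEval (x _) p.2 = A.ω e c)
    (hW : ∀ v a, wordEval (x v) (W v a) = a)
    (h : C.EdgesValid x Q y) (hC : C.Faithful x y)
    {S : List (List (Fin n × Bool))} {p : CertPoint N}
    (hS : C.ReadsGenerators x W y P S p) (hy : ∀ i, S.length ≤ i → y i = 1)
    {w : List (ℕ × Bool)}
    (hw : wordEval (fun i => wordEval (fun j => toGroup (ofPath (P j))) (S.getD i [])) w = 1) :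
    wordEval y w = 1 := by
  obtain ⟨B, ι, hι, hιs, hB⟩ := h.exists_action hQ hW hC
  have := wordEval_mem_translations hιs hB hS hy w
  rw [hw, EquivariantAction.mem_translations, B.rightAct_one, ← hιs] at this
  exact hC.eq_one (hι _ this).symm

/-- Elements of the subgroup keep the point `p` within its `L`-orbit, whereas `u` leads it to
another orbit. -/
theorem EdgesValid.not_mem_wordSubgroup
    (hQ : ∀ e c, ∃ p ∈ Q e, wordEval (x _) p.1 = A.α e c ∧ wordEval (x _) p.2 = A.ω e c)
    (hW : ∀ v a, wordEval (x v) (W v a) = a)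
    (h : C.EdgesValid x Q y) (hC : C.Faithful x y)
    {S : List (List (Fin n × Bool))} {p p' : CertPoint N}
    (hS : C.ReadsGenerators x W y P S p) (hy : ∀ i, S.length ≤ i → y i = 1)
    {u : List (Fin n × Bool)} (hu : C.ReadsWord x W y P u p p') (hd : C.Distinct x v₀ p p') :
    wordEval (fun j => toGroup (ofPath (P j))) u ∉
      wordSubgroup (fun j => toGroup (ofPath (P j))) S := by
  intro hmem
  obtain ⟨B, ι, hι, hιs, hB⟩ := h.exists_action hQ hW hC
  have hle : wordSubgroup (fun j => toGroup (ofPath (P j))) S ≤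
      (B.translations (ι v₀ (C.point x y v₀ p))).map (MonoidHom.snd L _) := by
    refine (Subgroup.closure_le _).2 ?_
    rintro _ ⟨w, hw, rfl⟩
    obtain ⟨i, hi, rfl⟩ := List.getElem_of_mem hw
    have := wordEval_mem_translations hιs hB hS hy [(i, true)]
    refine ⟨_, this, ?_⟩
    simp [wordEval_singleton, List.getElem?_eq_getElem hi]
  obtain ⟨⟨l, g⟩, hl, hg⟩ := hle hmem
  obtain rfl : g = _ := hg
  replace hl := B.mem_translations.1 hl
  rw [act_readsWord hB P _ _ _ hu, ← hιs] at hl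
  exact hd.smul_point_ne l (hι _ hl).symm

/-- An element `(l, 1)` of a stabilizer comes from a free group element that is trivial in the
vertex group. By the presentation this is a product of conjugates of relators and their inverses,
and the relators are trivial in `L`; hence `l = 1`. -/
theorem BlocksPresented.faithful
    {F : ∀ _ : V, List (List (Fin N × Bool)) →
      List (List (Fin N × Bool)) × List (List (ℕ × Bool))}
    (hF : ∀ v w, IsFinitePresentationOf (x v) (F v w) (wordSubgroup (x v) w))
    (h : C.BlocksPresented y F) : C.Faithful x y := by
  intro v u l hl
  by_cases hB : ∃ B ∈ C.1, B.1 = (v, u)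
  · obtain ⟨B, hB, hvu⟩ := hB
    obtain ⟨w, T, hT, hfst, hrel⟩ := h.2 B hB
    rw [hvu] at hT
    have hFT := hF v w
    rw [show F v w = T from hT] at hFT
    obtain ⟨-, R, hR, hker⟩ := hFT
    have hle : C.stab x y v u ≤ (FreeGroup.lift fun i : Fin T.1.length =>
        (wordEval y ((B.2.map Prod.snd).getD i []), wordEval (x v) (T.1.get i))).range := by
      refine (Subgroup.closure_le _).2 ?_
      rintro _ ⟨t, ⟨B', hB', hvu', ht⟩, rfl⟩
      obtain rfl : B' = B :=
        (h.1 B' hB' B hB).resolve_left (not_not.2 (hvu'.trans hvu.symm))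
      obtain ⟨i, hi, rfl⟩ := List.getElem_of_mem ht
      have hi' : i < T.1.length := by rw [← hfst]; simpa using hi
      refine ⟨FreeGroup.of ⟨i, hi'⟩, ?_⟩
      simp [← hfst, hi]
    obtain ⟨a, ha⟩ := hle hl
    have hpair := fun a => congrArg (fun f => f a) (FreeGroup.ext_hom
      (FreeGroup.lift fun i : Fin T.1.length =>
        (wordEval y ((B.2.map Prod.snd).getD i []), wordEval (x v) (T.1.get i)))
      ((FreeGroup.lift fun i : Fin T.1.length =>
        wordEval y ((B.2.map Prod.snd).getD i [])).prod
        (FreeGroup.lift fun i => wordEval (x v) (T.1.get i))) fun i => by simp)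
    have ha' := (hpair a).symm.trans ha
    obtain ⟨ha1, ha2⟩ := Prod.mk.inj ha'
    have hmem : a ∈ Subgroup.normalClosure {r | ∃ w ∈ R, FreeGroup.mk w = r} := by
      rw [← hker]
      exact ha2
    rw [← ha1]
    refine (Subgroup.normalClosure_le_normal (N := MonoidHom.ker (FreeGroup.lift
      fun i : Fin T.1.length => wordEval y ((B.2.map Prod.snd).getD i []))) ?_) hmem
    rintro _ ⟨r, hr, rfl⟩
    have := hrel (r.map (Prod.map Fin.val id)) (by rw [hR]; exact List.mem_map_of_mem hr)
    rw [wordEval_substWord] at this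
    rw [SetLike.mem_coe, MonoidHom.mem_ker, ← this]
    exact (wordEval_map_letters (fun i => wordEval y ((B.2.map Prod.snd).getD i [])) Fin.val r).symm
  · have hle : C.stab x y v u ≤ ⊥ := by
      refine (Subgroup.closure_le _).2 ?_
      rintro _ ⟨t, ⟨B, hB', hvu, ht⟩, rfl⟩
      exact absurd ⟨B, hB', hvu⟩ hB
    exact congrArg Prod.fst (Subgroup.mem_bot.1 (hle hl))

end Certificate

/-! ### Certificates for a given free action -/

namespace Certificate

/-- Finitely many required stabilizer elements, listed in `I`, are turned into blocks with
generators as prescribed by `F`, at the cost of finitely many relations `R` that hold in `H`. Any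
group `L` satisfying `R` then inherits the requirements. Only the validity of the relators of `F` is
used, not their completeness, so `F` may also return its input with no relators. -/
theorem exists_blocks {V : Type u₁} {E : Type u₂} {N : ℕ} {G : V → Type u₃} [∀ v, Group (G v)]
    (x : ∀ v, Fin N → G v) {H : Type u₅} [Group H] (η : ℕ → H) (D : ∀ v, ℕ → Subgroup (H × G v))
    (F : ∀ _ : V, List (List (Fin N × Bool)) →
      List (List (Fin N × Bool)) × List (List (ℕ × Bool)))
    (hF₁ : ∀ v w, wordSubgroup (x v) (F v w).1 = wordSubgroup (x v) w)
    (hF₂ : ∀ v w, ∀ r ∈ (F v w).2,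
      wordEval (fun i => wordEval (x v) ((F v w).1.getD i [])) r = 1)
    (I : List ((V × ℕ) × List (Fin N × Bool) × List (ℕ × Bool)))
    (hI : ∀ q ∈ I, (wordEval η q.2.2, wordEval (x _) q.2.1) ∈ D q.1.1 q.1.2)
    (hD : ∀ q ∈ I, ∀ h, (h, 1) ∈ D q.1.1 q.1.2 → h = 1) :
    ∃ (blocks : List ((V × ℕ) × List (List (Fin N × Bool) × List (ℕ × Bool))))
      (R : List (List (ℕ × Bool))),
      (∀ B ∈ blocks, ∀ t ∈ B.2, (wordEval η t.2, wordEval (x _) t.1) ∈ D B.1.1 B.1.2) ∧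
      (∀ r ∈ R, wordEval η r = 1) ∧
      ∀ (Ed : List (E × CertPoint N × CertPoint N)) {L : Type u₆} [Group L] (y : ℕ → L),
        (∀ r ∈ R, wordEval y r = 1) →
        (∀ q ∈ I, (wordEval y q.2.2, wordEval (x _) q.2.1) ∈
          Certificate.stab x y (blocks, Ed) q.1.1 q.1.2) ∧
        Certificate.BlocksPresented y (blocks, Ed) F := by
  classical
  let T : V × ℕ → List (List (Fin N × Bool) × List (ℕ × Bool)) := fun κ =>
    (I.filter fun q => q.1 = κ).map Prod.snd
  have hT : ∀ κ t, t ∈ T κ ↔ (κ, t) ∈ I := by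
    rintro κ t
    simp only [T, List.mem_map, List.mem_filter, decide_eq_true_eq]
    constructor
    · rintro ⟨q, ⟨hq, rfl⟩, rfl⟩
      exact hq
    · exact fun h => ⟨_, ⟨h, rfl⟩, rfl⟩
  let Y : V × ℕ → List (List (Fin N × Bool)) := fun κ => (F κ.1 ((T κ).map Prod.fst)).1
  have hY : ∀ κ, wordSubgroup (x κ.1) (Y κ) = Subgroup.closure
      {g | ∃ t, t ∈ T κ ∧ wordEval (x κ.1) t.1 = g} := by
    intro κ
    change wordSubgroup _ (F _ _).1 = _
    rw [hF₁]
    simp only [wordSubgroup, List.mem_map]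
    congr 1
    ext g
    constructor
    · rintro ⟨_, ⟨t, ht, rfl⟩, rfl⟩
      exact ⟨t, ht, rfl⟩
    · rintro ⟨t, ht, rfl⟩
      exact ⟨_, ⟨t, ht, rfl⟩, rfl⟩
  have hDword : ∀ (κ : V × ℕ) (r : List ((List (Fin N × Bool) × List (ℕ × Bool)) × Bool)),
      (∀ t ∈ r, (wordEval η t.1.2, wordEval (x κ.1) t.1.1) ∈ D κ.1 κ.2) →
      (wordEval η (substWord Prod.snd r), wordEval (x κ.1) (substWord Prod.fst r)) ∈
        D κ.1 κ.2 := by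
    intro κ r hr
    rw [wordEval_substWord, wordEval_substWord, ← wordEval_prod]
    have h := (mem_closure_image_iff (fun t : List (Fin N × Bool) × List (ℕ × Bool) =>
      (wordEval η t.2, wordEval (x κ.1) t.1))
      (fun t => (wordEval η t.2, wordEval (x κ.1) t.1) ∈ D κ.1 κ.2) _).2 ⟨r, hr, rfl⟩
    refine (Subgroup.closure_le _).2 ?_ h
    rintro _ ⟨t, ht, rfl⟩
    exact ht
  -- Each generator `w` returned by `F` is a product of projections of required elements; the same
  -- product of their first coordinates lifts `w` to the stabilizer.
  have hθ : ∀ κ w, ∃ θ, w ∈ Y κ → (wordEval η θ, wordEval (x κ.1) w) ∈ D κ.1 κ.2 := by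
    intro κ w
    by_cases hw : w ∈ Y κ
    · have h1 : wordEval (x κ.1) w ∈ wordSubgroup (x κ.1) (Y κ) :=
        Subgroup.subset_closure ⟨w, hw, rfl⟩
      rw [hY, mem_closure_image_iff] at h1
      obtain ⟨r, hr, hrw⟩ := h1
      refine ⟨substWord Prod.snd r, fun _ => ?_⟩
      rw [← hrw, ← wordEval_substWord]
      exact hDword κ r fun t ht => hI _ ((hT _ _).1 (hr t ht))
    · exact ⟨[], fun h => absurd h hw⟩
  choose θ hθ using hθ
  let block : V × ℕ → (V × ℕ) × List (List (Fin N × Bool) × List (ℕ × Bool)) := fun κ =>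
    (κ, (Y κ).map fun w => (w, θ κ w))
  have hblock : ∀ κ, ∀ t ∈ (block κ).2, (wordEval η t.2, wordEval (x κ.1) t.1) ∈ D κ.1 κ.2 := by
    intro κ t ht
    obtain ⟨w, hw, rfl⟩ := List.mem_map.1 ht
    exact hθ κ w hw
  have hexpr : ∀ q : (V × ℕ) × List (Fin N × Bool) × List (ℕ × Bool), ∃ r, q ∈ I →
      (∀ t ∈ r, t.1 ∈ (block q.1).2) ∧
        wordEval (x q.1.1) (substWord Prod.fst r) = wordEval (x _) q.2.1 := by
    intro q
    by_cases hq : q ∈ I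
    · have h1 : wordEval (x q.1.1) q.2.1 ∈ wordSubgroup (x q.1.1) (Y q.1) := by
        rw [hY]
        exact Subgroup.subset_closure ⟨q.2, (hT _ _).2 hq, rfl⟩
      have h2 : wordSubgroup (x q.1.1) (Y q.1) = Subgroup.closure
          {g | ∃ t, t ∈ (block q.1).2 ∧ wordEval (x q.1.1) t.1 = g} := by
        simp only [wordSubgroup, block, List.mem_map]
        congr 1
        ext g
        constructor
        · rintro ⟨w, hw, rfl⟩
          exact ⟨_, ⟨w, hw, rfl⟩, rfl⟩
        · rintro ⟨_, ⟨w, hw, rfl⟩, rfl⟩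
          exact ⟨w, hw, rfl⟩
      rw [h2, mem_closure_image_iff] at h1
      obtain ⟨r, hr, hrw⟩ := h1
      exact ⟨r, fun _ => ⟨hr, by rw [wordEval_substWord, hrw]⟩⟩
    · exact ⟨[], fun h => absurd h hq⟩
  choose r hr using hexpr
  -- There are two kinds of relations. The first compares each required element with the product of
  -- block generators that has the same projection; the second evaluates the relators of `F` at the
  -- lifts. Both are first coordinates of elements of `D` with trivial second coordinate, so they
  -- hold in `H` by `hD`. Repeated blocks in the list are equal.
  refine ⟨I.map fun q => block q.1,
    (I.map fun q => FreeGroup.invRev (substWord Prod.snd (r q)) ++ q.2.2) ++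
    I.flatMap fun q => (F q.1.1 ((T q.1).map Prod.fst)).2.map
      (substWord fun i => ((block q.1).2.map Prod.snd).getD i []), ?_, ?_, ?_⟩
  · intro B hB
    obtain ⟨q, hq, rfl⟩ := List.mem_map.1 hB
    exact hblock q.1
  · intro ρ hρ
    rcases List.mem_append.1 hρ with hρ | hρ
    · obtain ⟨q, hq, rfl⟩ := List.mem_map.1 hρ
      refine hD q hq _ ?_
      have h1 := hDword q.1 (r q) fun t ht => hblock q.1 t.1 ((hr q hq).1 t ht)
      have h2 := mul_mem (inv_mem h1) (hI q hq)
      rw [(hr q hq).2] at h2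
      simpa [wordEval_append, wordEval_invRev] using h2
    · obtain ⟨q, hq, hρ⟩ := List.mem_flatMap.1 hρ
      obtain ⟨s, hs, rfl⟩ := List.mem_map.1 hρ
      refine hD q hq _ ?_
      rw [wordEval_substWord, ← hF₂ _ _ s hs, ← wordEval_prod]
      have hle : (FreeGroup.lift fun i => (wordEval η (((block q.1).2.map Prod.snd).getD i []),
          wordEval (x q.1.1) ((F q.1.1 ((T q.1).map Prod.fst)).1.getD i []))).range ≤
          D q.1.1 q.1.2 := by
        rw [FreeGroup.range_lift_eq_closure, Subgroup.closure_le]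
        rintro _ ⟨i, rfl⟩
        rcases lt_or_ge i (Y q.1).length with hi | hi
        · have h := hblock q.1 ((block q.1).2[i]'(by simpa [block] using hi))
            (List.getElem_mem _)
          simpa [block, hi, Y] using h
        · simp only [block, List.map_map]
          rw [List.getD_eq_default _ _ (by simpa using hi),
            List.getD_eq_default _ _ (by simpa using hi), wordEval_nil, wordEval_nil]
          exact one_mem _
      exact hle ⟨_, rfl⟩
  · intro Ed L _ y hy
    refine ⟨fun q hq => ?_, ?_, ?_⟩
    · rw [mem_stab_iff]
      refine ⟨r q, fun t ht => ⟨block q.1, List.mem_map_of_mem hq, rfl, (hr q hq).1 t ht⟩, ?_,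
        (hr q hq).2⟩
      have := hy _ (List.mem_append_left _ (List.mem_map_of_mem hq))
      rwa [wordEval_append, wordEval_invRev, inv_mul_eq_one] at this
    · intro B hB B' hB'
      obtain ⟨q, hq, rfl⟩ := List.mem_map.1 hB
      obtain ⟨q', hq', rfl⟩ := List.mem_map.1 hB'
      by_cases h : q.1 = q'.1
      · exact .inr (by rw [h])
      · exact .inl h
    · intro B hB
      obtain ⟨q, hq, rfl⟩ := List.mem_map.1 hB
      refine ⟨(T q.1).map Prod.fst, _, rfl, by simp [block, Y, Function.comp_def], fun s hs => hy _ ?_⟩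
      exact List.mem_append_right _ (List.mem_flatMap.2 ⟨q, hq, List.mem_map_of_mem hs⟩)

end Certificate

/-! ### Coordinates for a free action -/

section

open GraphOfGroups GraphOfGroups.PathClass Filter

variable {V : Type u₁} {E : Type u₂} {A : GraphOfGroups.{u₁, u₂, u₃, u₄} V E} {N : ℕ}
  {H : Type u₅} [Group H]

/-- Coordinates for the points of a free action of `H`, in terms of words in elements `η i` of `H`
and words in the generators of the vertex groups. -/
structure Coordinates (B : EquivariantAction.{u₁, u₂, u₃, u₄, u₅, u₆} A H)
    (x : ∀ v, Fin N → A.vertexGroup v) (η : ℕ → H) where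
  /-- the number of the orbit -/
  orbit : ∀ v, B.carrier v → ℕ
  /-- the base point of the orbit -/
  rep : ∀ v, B.carrier v → B.carrier v
  /-- the word in the letters `η i` -/
  left : ∀ v, B.carrier v → List (ℕ × Bool)
  /-- the word in the generators of the vertex group -/
  right : ∀ v, B.carrier v → List (Fin N × Bool)
  smul_rep : ∀ v z, (wordEval η (left v z), wordEval (x v) (right v z)) • rep v z = z
  orbit_smul : ∀ v l g z, orbit v ((wordEval η l, wordEval (x v) g) • z) = orbit v z
  rep_eq : ∀ v z z', orbit v z = orbit v z' → rep v z = rep v z'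

theorem exists_coordinates (B : EquivariantAction.{u₁, u₂, u₃, u₄, u₅, u₆} A H)
    [∀ v, Countable (B.carrier v)] (x : ∀ v, Fin N → A.vertexGroup v) (η : ℕ → H) :
    Nonempty (Coordinates B x η) := by
  let s : ∀ v, Setoid (B.carrier v) := fun v =>
    { r := fun z z' => ∃ l g, (wordEval η l, wordEval (x v) g) • z = z'
      iseqv := by
        refine ⟨fun z => ⟨[], [], ?_⟩, ?_, ?_⟩
        · rw [wordEval_nil, wordEval_nil]
          exact one_smul _ z
        · rintro z _ ⟨l, g, rfl⟩
          refine ⟨FreeGroup.invRev l, FreeGroup.invRev g, ?_⟩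
          rw [wordEval_invRev, wordEval_invRev, smul_smul, ← Prod.inv_mk, inv_mul_cancel, one_smul]
        · rintro z _ _ ⟨l, g, rfl⟩ ⟨l', g', rfl⟩
          exact ⟨l' ++ l, g' ++ g, by
            rw [wordEval_append, wordEval_append, smul_smul, Prod.mk_mul_mk]⟩ }
  have hid : ∀ v, ∃ f : Quotient (s v) → ℕ, Function.Injective f := fun v =>
    exists_injective_nat _
  choose f hf using hid
  have hrep : ∀ v z, ∃ l g, (wordEval η l, wordEval (x v) g) • (Quotient.mk (s v) z).out = z :=
    fun v z => Quotient.exact (s := s v) (Quotient.out_eq _)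
  choose l g hlg using hrep
  exact ⟨{
    orbit := fun v z => f v (Quotient.mk _ z)
    rep := fun v z => (Quotient.mk (s v) z).out
    left := l
    right := g
    smul_rep := hlg
    orbit_smul := fun v l g z => congrArg (f v) (Quotient.sound (s := s v) (Setoid.symm ⟨l, g, rfl⟩))
    rep_eq := fun v z z' h => by rw [hf v h] }⟩

namespace Coordinates

variable {B : EquivariantAction.{u₁, u₂, u₃, u₄, u₅, u₆} A H}
    {x : ∀ v, Fin N → A.vertexGroup v} {η : ℕ → H} (c : Coordinates B x η)

/-- The coordinates of a point. -/
def point (v : V) (z : B.carrier v) : CertPoint N := (c.orbit v z, c.left v z, c.right v z)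

/-- The stabilizer of the base point of an orbit. -/
def stab (v : V) (u : ℕ) : Subgroup (H × A.vertexGroup v) :=
  ⨅ z : {z // c.orbit v z = u}, MulAction.stabilizer _ (c.rep v z.1)

/-- All points of an orbit have the same base point, so the infimum runs over copies of a single
stabilizer. -/
theorem mem_stab {v : V} {z : B.carrier v} {q : H × A.vertexGroup v} :
    q ∈ c.stab v (c.orbit v z) ↔ q • c.rep v z = c.rep v z := by
  rw [stab, Subgroup.mem_iInf]
  refine ⟨fun h => h ⟨z, rfl⟩, fun h z' => ?_⟩
  rw [MulAction.mem_stabilizer_iff, c.rep_eq v z' z z'.2]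
  exact h

theorem mem_stab_iff_smul_eq {v : V} {z z' : B.carrier v} (horb : c.orbit v z = c.orbit v z')
    {q : H × A.vertexGroup v} {m : H} {b : A.vertexGroup v}
    (hm : m = (wordEval η (c.left v z'))⁻¹ * (q.1 * wordEval η (c.left v z)))
    (hb : b = (wordEval (x v) (c.right v z'))⁻¹ * (q.2 * wordEval (x v) (c.right v z))) :
    (m, b) ∈ c.stab v (c.orbit v z') ↔ q • z = z' := by
  have h1 := c.smul_rep v z
  have h2 := c.smul_rep v z'
  rw [c.rep_eq v _ _ horb] at h1
  rw [mem_stab, show (m, b) = (wordEval η (c.left v z'), wordEval (x v) (c.right v z'))⁻¹ *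
    (q * (wordEval η (c.left v z), wordEval (x v) (c.right v z))) from
    Prod.ext hm hb, mul_smul, inv_smul_eq_iff, h2, mul_smul, h1]

/-- The generators of the stabilizers that appear in `C` belong to the stabilizers for the given
action. -/
def Sound (C : Certificate V E N) : Prop :=
  ∀ Bl ∈ C.1, ∀ t ∈ Bl.2, (wordEval η t.2, wordEval (x _) t.1) ∈ c.stab Bl.1.1 Bl.1.2

variable {c} in
-- Take for `bs` the projections of the listed generators. If the element were in the subgroup they
-- generate, the corresponding product in the true stabilizer would have a word in the `η i` as
-- first coordinate, and this would supply a forbidden `l`.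
theorem Sound.distinct {C : Certificate V E N} (hC : c.Sound C) {v : V} {z z' : B.carrier v}
    {g : List (Fin N × Bool)}
    (h : ∀ l, (wordEval η l, wordEval (x v) g) • z ≠ z') :
    C.Distinct x v ((c.point v z).shift [] g) (c.point v z') := by
  classical
  by_cases horb : c.orbit v z = c.orbit v z'
  · let T := (C.1.filter fun Bl => Bl.1 = (v, c.orbit v z')).flatMap Prod.snd
    refine .inr ⟨T.map Prod.fst, fun Bl hBl => ?_, fun hmem => ?_⟩
    · by_cases hk : Bl.1 = (v, c.orbit v z')
      · refine .inr fun t ht => List.mem_map_of_mem (List.mem_flatMap.2 ⟨Bl, ?_, ht⟩)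
        exact List.mem_filter.2 ⟨hBl, by simpa using hk⟩
      · exact .inl hk
    · have hT : ∀ t ∈ T, (wordEval η t.2, wordEval (x v) t.1) ∈ c.stab v (c.orbit v z') := by
        intro t ht
        obtain ⟨⟨⟨v', u⟩, ts⟩, hBl, ht⟩ := List.mem_flatMap.1 ht
        obtain ⟨hBl, hk⟩ := List.mem_filter.1 hBl
        have := hC _ hBl t ht
        obtain ⟨rfl, rfl⟩ := Prod.mk.inj (of_decide_eq_true hk)
        exact this
      have hle : wordSubgroup (x v) (T.map Prod.fst) ≤
          ((c.stab v (c.orbit v z')) ⊓ ((FreeGroup.lift η).range.prod ⊤)).map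
            (MonoidHom.snd H _) := by
        refine (Subgroup.closure_le _).2 ?_
        rintro _ ⟨w, hw, rfl⟩
        obtain ⟨t, ht, rfl⟩ := List.mem_map.1 hw
        exact ⟨_, ⟨hT t ht, ⟨_, rfl⟩, trivial⟩, rfl⟩
      obtain ⟨⟨m, b⟩, ⟨hs, ⟨a, ha⟩, -⟩, hb⟩ := hle hmem
      obtain rfl : b = _ := hb
      obtain rfl : _ = m := ha
      refine h (c.left v z' ++ a.toWord ++ FreeGroup.invRev (c.left v z)) ?_
      have ha : wordEval η a.toWord = FreeGroup.lift η a := by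
        rw [wordEval, FreeGroup.mk_toWord]
      refine (c.mem_stab_iff_smul_eq horb ?_ ?_).1 hs
      · simp [wordEval_append, wordEval_invRev, ha, mul_assoc]
      · simp [wordEval_append, wordEval_invRev, CertPoint.shift, point]
  · exact .inl horb

/-- Requirements for stabilizers that the given action satisfies. -/
abbrev StabRequirement :=
  {q : (V × ℕ) × List (Fin N × Bool) × List (ℕ × Bool) //
    (wordEval η q.2.2, wordEval (x _) q.2.1) ∈ c.stab q.1.1 q.1.2 ∧
    ∀ h, (h, 1) ∈ c.stab q.1.1 q.1.2 → h = 1}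

/-- The filter of the certificates that satisfy the requirements for stabilizers. -/
def stabFilter : Filter (Certificate V E N × (ℕ × List (List (ℕ × Bool)))) :=
  ⨅ q : c.StabRequirement, 𝓟 {t | (wordEval (truncatedOf t.2) q.1.2.2, wordEval (x _) q.1.2.1) ∈
    t.1.stab x (truncatedOf t.2) q.1.1.1 q.1.1.2}

/-- One equality between points amounts to one requirement on a stabilizer. Working along the filter
allows finitely many such requirements to be accumulated without listing them. -/
theorem eventually_same
    (hB : ∀ v (z : B.carrier v) h, ((h, 1) : H × A.vertexGroup v) • z = z → h = 1)
    {v : V} {z z' : B.carrier v} {l : List (ℕ × Bool)} {g : List (Fin N × Bool)}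
    (h : (wordEval η l, wordEval (x v) g) • z = z') :
    ∀ᶠ t in c.stabFilter (E := E), t.1.Same x (truncatedOf t.2) v ((c.point v z).shift l g)
      (c.point v z') := by
  have horb : c.orbit v z = c.orbit v z' := by rw [← h, c.orbit_smul]
  let q : (V × ℕ) × List (Fin N × Bool) × List (ℕ × Bool) := ((v, c.orbit v z'),
    FreeGroup.invRev (c.right v z') ++ (g ++ c.right v z),
    FreeGroup.invRev (c.left v z') ++ (l ++ c.left v z))
  have hq : (wordEval η q.2.2, wordEval (x _) q.2.1) ∈ c.stab q.1.1 q.1.2 ∧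
      ∀ h, (h, 1) ∈ c.stab q.1.1 q.1.2 → h = 1 := by
    -- The second clause relies on the orbit having a point: for an unused orbit number, `c.stab` is
    -- the whole group.
    refine ⟨?_, fun h hh => hB _ _ _ (c.mem_stab.1 hh)⟩
    refine (c.mem_stab_iff_smul_eq horb ?_ ?_).2 h <;>
      simp [wordEval_append, wordEval_invRev, q]
  have hmem := mem_iInf_of_mem (f := fun q : c.StabRequirement =>
    𝓟 {t : Certificate V E N × (ℕ × List (List (ℕ × Bool))) |
      (wordEval (truncatedOf t.2) q.1.2.2, wordEval (x _) q.1.2.1) ∈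
        t.1.stab x (truncatedOf t.2) q.1.1.1 q.1.1.2}) ⟨q, hq⟩ (mem_principal_self _)
  filter_upwards [hmem] with t ht
  exact ⟨horb, ht⟩

/-- The edge of a certificate that starts in a given point. -/
def edge (a : Σ e, B.carrier (A.o e)) : E × CertPoint N × CertPoint N :=
  (a.1, c.point _ a.2, c.point _ (B.τ a.1 a.2))

/-- For each pair of edges and each entry of `Q`, either some `l` joins the points, which then
persists along the filter at both ends, or none does, and soundness alone gives `Distinct`. There
are finitely many cases as `Ed` and `Q e` are lists. -/
theorem eventually_edgesValid
    (hB : ∀ v (z : B.carrier v) h, ((h, 1) : H × A.vertexGroup v) • z = z → h = 1)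
    {Q : E → List (List (Fin N × Bool) × List (Fin N × Bool))}
    (hQ : ∀ e, ∀ p ∈ Q e, ∃ c, wordEval (x _) p.1 = A.α e c ∧ wordEval (x _) p.2 = A.ω e c)
    (Ed : List (Σ e, B.carrier (A.o e))) :
    ∀ᶠ t in c.stabFilter (E := E), t.1.2 = Ed.map c.edge → c.Sound t.1 →
      t.1.EdgesValid x Q (truncatedOf t.2) := by
  have key : ∀ e, ∀ z z' : B.carrier (A.o e), ∀ p ∈ Q e, ∀ᶠ t in c.stabFilter (E := E),
      c.Sound t.1 →
      (∃ l, t.1.Same x (truncatedOf t.2) (A.o e) ((c.point _ z).shift l p.1) (c.point _ z') ∧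
        t.1.Same x (truncatedOf t.2) (A.t e) ((c.point _ (B.τ e z)).shift l p.2)
          (c.point _ (B.τ e z'))) ∨
      (t.1.Distinct x (A.o e) ((c.point _ z).shift [] p.1) (c.point _ z') ∧
        t.1.Distinct x (A.t e) ((c.point _ (B.τ e z)).shift [] p.2) (c.point _ (B.τ e z'))) := by
    intro e z z' p hp
    obtain ⟨g, hg1, hg2⟩ := hQ e p hp
    by_cases h : ∃ l, (wordEval η l, A.α e g) • z = z'
    · obtain ⟨l, hl⟩ := h
      have hl' : (wordEval η l, A.ω e g) • B.τ e z = B.τ e z' := by rw [← hl, B.τ_smul]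
      rw [← hg1] at hl
      rw [← hg2] at hl'
      filter_upwards [c.eventually_same hB hl, c.eventually_same hB hl'] with t h1 h2 _
      exact .inl ⟨l, h1, h2⟩
    · push Not at h
      refine Eventually.of_forall fun t ht => .inr ⟨ht.distinct fun l => ?_, ht.distinct fun l => ?_⟩
      · rw [hg1]
        exact h l
      · rw [hg2, ← B.τ_smul]
        exact fun heq => h l ((B.τ e).injective heq)
  have hall : ∀ᶠ t in c.stabFilter (E := E), ∀ a ∈ {a | a ∈ Ed}, ∀ a' ∈ {a | a ∈ Ed},
      ∀ h : a.1 = a'.1, ∀ p ∈ {p | p ∈ Q a.1}, c.Sound t.1 →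
      (∃ l, t.1.Same x (truncatedOf t.2) (A.o a.1) ((c.point _ a.2).shift l p.1)
          (c.edge a').2.1 ∧
        t.1.Same x (truncatedOf t.2) (A.t a.1) ((c.point _ (B.τ a.1 a.2)).shift l p.2)
          (c.edge a').2.2) ∨
      (t.1.Distinct x (A.o a.1) ((c.point _ a.2).shift [] p.1) (c.edge a').2.1 ∧
        t.1.Distinct x (A.t a.1) ((c.point _ (B.τ a.1 a.2)).shift [] p.2) (c.edge a').2.2) := by
    refine (eventually_all_finite Ed.finite_toSet).2 fun a _ =>
      (eventually_all_finite Ed.finite_toSet).2 fun a' _ => ?_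
    obtain ⟨e, z⟩ := a
    obtain ⟨e', z'⟩ := a'
    by_cases h : e = e'
    · subst h
      refine ((eventually_all_finite (Q e).finite_toSet).2 fun p hp => key e z z' p hp).mono ?_
      exact fun t ht _ => ht
    · exact Eventually.of_forall fun t h' => absurd h' h
  filter_upwards [hall] with t ht hEd hS f hf f' hf'
  rw [hEd] at hf hf'
  obtain ⟨a, ha, rfl⟩ := List.mem_map.1 hf
  obtain ⟨a', ha', rfl⟩ := List.mem_map.1 hf'
  by_cases h : a.1 = a'.1
  · exact .inr fun p hp => ht a ha a' ha' h p hp hS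
  · exact .inl h

/-- The filter of the certificates that satisfy requirements for stabilizers and edges. -/
def certificateFilter : Filter (Certificate V E N × (ℕ × List (List (ℕ × Bool)))) :=
  c.stabFilter ⊓ ⨅ a, 𝓟 {t | c.edge a ∈ t.1.2}

theorem eventually_edge (a : Σ e, B.carrier (A.o e)) :
    ∀ᶠ t in c.certificateFilter, c.edge a ∈ t.1.2 :=
  mem_inf_of_right (mem_iInf_of_mem a (mem_principal_self _))

theorem eventually_reads
    (hB : ∀ v (z : B.carrier v) h, ((h, 1) : H × A.vertexGroup v) • z = z → h = 1)
    {W : ∀ v, A.vertexGroup v → List (Fin N × Bool)} (hW : ∀ v a, wordEval (x v) (W v a) = a)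
    {v w : V} (p : A.Path v w) (z : B.carrier v) :
    ∀ᶠ t in c.certificateFilter,
      t.1.Reads x W (truncatedOf t.2) p (c.point v z) (c.point w (B.act p z)) := by
  have key : ∀ {v : V} (z : B.carrier v) (a : A.vertexGroup v), ∀ᶠ t in c.certificateFilter,
      t.1.Same x (truncatedOf t.2) v ((c.point v z).shift [] (W v a⁻¹))
        (c.point v (((1, a⁻¹) : H × A.vertexGroup v) • z)) := fun z a =>
    (c.eventually_same hB (by rw [wordEval_nil, hW])).filter_mono inf_le_left
  induction p with
  | nil a => exact key z a
  | fwd e a p ih =>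
    filter_upwards [key z a, ih (B.τ e (((1, a⁻¹) : H × A.vertexGroup (A.o e)) • z)),
      c.eventually_edge ⟨e, ((1, a⁻¹) : H × A.vertexGroup (A.o e)) • z⟩] with t h1 h2 h3
    exact ⟨_, h3, rfl, h1, h2⟩
  | bwd e a p ih =>
    filter_upwards [key z a, ih ((B.τ e).symm (((1, a⁻¹) : H × A.vertexGroup (A.t e)) • z)),
      c.eventually_edge ⟨e, (B.τ e).symm (((1, a⁻¹) : H × A.vertexGroup (A.t e)) • z)⟩]
      with t h1 h2 h3
    refine ⟨_, h3, rfl, ?_, h2⟩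
    simpa only [edge, Equiv.apply_symm_apply] using h1

variable {v₀ : V} {n : ℕ} {P : Fin n → A.Path v₀ v₀}

theorem eventually_readsWord
    (hB : ∀ v (z : B.carrier v) h, ((h, 1) : H × A.vertexGroup v) • z = z → h = 1)
    {W : ∀ v, A.vertexGroup v → List (Fin N × Bool)} (hW : ∀ v a, wordEval (x v) (W v a) = a)
    (w : List (Fin n × Bool)) (z : B.carrier v₀) :
    ∀ᶠ t in c.certificateFilter, t.1.ReadsWord x W (truncatedOf t.2) P w (c.point v₀ z)
      (c.point v₀ (B.rightAct (wordEval (fun j => toGroup (ofPath (P j))) w) z)) := by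
  induction w generalizing z with
  | nil =>
    simp only [wordEval_nil, B.rightAct_one]
    exact Eventually.of_forall fun t => .refl
  | cons j w ih =>
    have hj : B.rightAct (wordEval (fun j => toGroup (ofPath (P j))) [j]) z =
        B.act (Certificate.letterPath P j) z := by
      rw [wordEval_singleton]
      obtain ⟨i, b⟩ := j
      cases b <;> rfl
    rw [← List.singleton_append, wordEval_append, B.rightAct_mul, hj]
    filter_upwards [c.eventually_reads hB hW (Certificate.letterPath P j) z,
      ih (B.act (Certificate.letterPath P j) z)] with t h1 h2
    exact .head ⟨j, rfl, h1⟩ h2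

theorem eventually_readsGenerators
    (hB : ∀ v (z : B.carrier v) h, ((h, 1) : H × A.vertexGroup v) • z = z → h = 1)
    {W : ∀ v, A.vertexGroup v → List (Fin N × Bool)} (hW : ∀ v a, wordEval (x v) (W v a) = a)
    (S : List (List (Fin n × Bool))) (z : B.carrier v₀)
    (hz : ∀ i, B.rightAct (wordEval (fun j => toGroup (ofPath (P j))) (S.getD i [])) z =
      ((η i, 1) : H × A.vertexGroup v₀) • z) :
    ∀ᶠ t in c.certificateFilter,
      t.1.ReadsGenerators x W (truncatedOf t.2) P S (c.point v₀ z) := by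
  refine (eventually_all_finite (List.range S.length).finite_toSet).2 fun i _ => ?_
  have h := c.eventually_same (E := E) hB (v := v₀)
    (z := z) (l := [(i, true)]) (g := []) (z' := ((η i, 1) : H × A.vertexGroup v₀) • z)
    (by simp [wordEval_singleton, wordEval_nil])
  filter_upwards [h.filter_mono inf_le_left, c.eventually_readsWord hB hW (S.getD i []) z]
    with t h1 h2
  rw [hz] at h2
  refine ⟨_, h2, ?_⟩
  rw [← Certificate.point_eq_iff] at h1 ⊢
  exact h1.symm

/-- A basis of the filter yields finite sets of requirements `I` and edges `J` sufficient for
tracing the words. With the edges fixed, their validity costs finitely many further requirements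
`I'` but no new edges, so the process stops; `Certificate.exists_blocks` then realizes the
requirements in both sets. -/
theorem exists_certificate
    (hB : ∀ v (z : B.carrier v) h, ((h, 1) : H × A.vertexGroup v) • z = z → h = 1)
    {W : ∀ v, A.vertexGroup v → List (Fin N × Bool)} (hW : ∀ v a, wordEval (x v) (W v a) = a)
    {Q : E → List (List (Fin N × Bool) × List (Fin N × Bool))}
    (hQ : ∀ e, ∀ p ∈ Q e, ∃ c, wordEval (x _) p.1 = A.α e c ∧ wordEval (x _) p.2 = A.ω e c)
    {F : ∀ _ : V, List (List (Fin N × Bool)) →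
      List (List (Fin N × Bool)) × List (List (ℕ × Bool))}
    (hF₁ : ∀ v w, wordSubgroup (x v) (F v w).1 = wordSubgroup (x v) w)
    (hF₂ : ∀ v w, ∀ r ∈ (F v w).2,
      wordEval (fun i => wordEval (x v) ((F v w).1.getD i [])) r = 1)
    (S : List (List (Fin n × Bool))) (z : B.carrier v₀)
    (hz : ∀ i, B.rightAct (wordEval (fun j => toGroup (ofPath (P j))) (S.getD i [])) z =
      ((η i, 1) : H × A.vertexGroup v₀) • z) (w : List (Fin n × Bool)) :
    ∃ (C : Certificate V E N) (R : List (List (ℕ × Bool))), c.Sound C ∧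
      (∀ r ∈ R, wordEval η r = 1) ∧ ∀ K, (∀ r ∈ R, wordEval (truncatedOf K) r = 1) →
        C.EdgesValid x Q (truncatedOf K) ∧
        C.ReadsGenerators x W (truncatedOf K) P S (c.point v₀ z) ∧
        C.ReadsWord x W (truncatedOf K) P w (c.point v₀ z)
          (c.point v₀ (B.rightAct (wordEval (fun j => toGroup (ofPath (P j))) w) z)) ∧
        C.BlocksPresented (truncatedOf K) F := by
  classical
  obtain ⟨⟨I, J⟩, ⟨hI, hJ⟩, h⟩ := ((hasBasis_iInf_principal_finite _).inf
    (hasBasis_iInf_principal_finite _)).eventually_iff.1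
    ((c.eventually_readsGenerators hB hW S z hz).and (c.eventually_readsWord (P := P) hB hW w z))
  obtain ⟨I', hI', h'⟩ := (hasBasis_iInf_principal_finite _).eventually_iff.1
    (c.eventually_edgesValid hB hQ hJ.toFinset.toList)
  obtain ⟨blocks, R, hsound, hR, hK⟩ := Certificate.exists_blocks (E := E) x η c.stab F hF₁ hF₂
    ((hI.toFinset ∪ hI'.toFinset).toList.map Subtype.val)
    (fun q hq => by
      obtain ⟨q, -, rfl⟩ := List.mem_map.1 hq
      exact q.2.1)
    (fun q hq => by
      obtain ⟨q, -, rfl⟩ := List.mem_map.1 hq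
      exact q.2.2)
  have hS : c.Sound (blocks, hJ.toFinset.toList.map c.edge) := hsound
  refine ⟨(blocks, hJ.toFinset.toList.map c.edge), R, hS, hR, fun K hKR => ?_⟩
  obtain ⟨hreq, hpres⟩ := hK (hJ.toFinset.toList.map c.edge) (truncatedOf K) hKR
  have h1 := @h ((blocks, hJ.toFinset.toList.map c.edge), K) ⟨?_, ?_⟩
  · refine ⟨@h' ((blocks, hJ.toFinset.toList.map c.edge), K) ?_ rfl hS, h1.1, h1.2, hpres⟩
    simp only [Set.mem_iInter]
    exact fun q hq => hreq _ (List.mem_map_of_mem (by simp [hq]))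
  · simp only [Set.mem_iInter]
    exact fun q hq => hreq _ (List.mem_map_of_mem (by simp [hq]))
  · simp only [Set.mem_iInter]
    exact fun a ha => List.mem_map_of_mem (by simp [ha])

end Coordinates

/-! ### The action on classes of paths -/

namespace GraphOfGroups

namespace PathClass

/-- The class of loops that an element of the fundamental group is. -/
def ofGroup {v₀ : V} (g : A.FundamentalGroup v₀) : A.PathClass v₀ v₀ := g

theorem ofGroup_mul {v₀ : V} (g h : A.FundamentalGroup v₀) :
    ofGroup (g * h) = (ofGroup g).comp (ofGroup h) := rfl

theorem ofGroup_one {v₀ : V} : ofGroup (1 : A.FundamentalGroup v₀) = ofVertex 1 := rfl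

theorem ofGroup_injective {v₀ : V} :
    Function.Injective (ofGroup : A.FundamentalGroup v₀ → A.PathClass v₀ v₀) := fun _ _ h => h

end PathClass

/-- The fundamental group acts on classes of paths on the left, the vertex groups on the right. -/
instance instMulActionPathClass (v₀ v : V) :
    MulAction (A.FundamentalGroup v₀ × A.vertexGroup v) (A.PathClass v₀ v) where
  smul q z := (ofGroup q.1).comp (z.comp (ofVertex q.2⁻¹))
  one_smul z := by
    change (ofVertex 1).comp (z.comp (ofVertex 1⁻¹)) = z
    simp
  mul_smul q r z := by
    change (ofGroup (q.1 * r.1)).comp (z.comp (ofVertex (q.2 * r.2)⁻¹)) =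
      (ofGroup q.1).comp (((ofGroup r.1).comp (z.comp (ofVertex r.2⁻¹))).comp (ofVertex q.2⁻¹))
    simp only [comp_assoc, mul_inv_rev, ofVertex_mul, ofGroup_mul]

theorem PathClass.smul_def {v₀ v : V} (q : A.FundamentalGroup v₀ × A.vertexGroup v)
    (z : A.PathClass v₀ v) :
    q • z = (ofGroup q.1).comp (z.comp (ofVertex q.2⁻¹)) := rfl

variable (A) in
/-- The action on classes of paths. -/
def pathAction (v₀ : V) : EquivariantAction A (A.FundamentalGroup v₀) where
  carrier v := A.PathClass v₀ v
  τ e :=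
    { toFun := fun z => z.comp (ofEdge e)
      invFun := fun z => z.comp (ofEdge e).inv
      left_inv := fun z => by simp only [comp_assoc, comp_inv, comp_ofVertex_one]
      right_inv := fun z => by simp only [comp_assoc, inv_comp, comp_ofVertex_one] }
  τ_smul e l g z := by
    simp only [PathClass.smul_def, Equiv.coe_fn_mk, comp_assoc, ← map_inv, ofVertex_α_comp_ofEdge]

theorem pathAction_free {v₀ v : V} (z : (A.pathAction v₀).carrier v) (h : A.FundamentalGroup v₀)
    (hz : ((h, 1) : A.FundamentalGroup v₀ × A.vertexGroup v) • z = z) : h = 1 := by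
  let z' : A.PathClass v₀ v := z
  have hz' : (ofGroup h).comp (z'.comp (ofVertex 1⁻¹)) = z' := hz
  rw [inv_one, comp_ofVertex_one] at hz'
  have := congrArg (fun y => comp y z'.inv) hz'
  simp only [comp_assoc, comp_inv, comp_ofVertex_one] at this
  exact ofGroup_injective this

theorem pathAction_act {v₀ v w : V} (p : A.Path v w) (z : A.PathClass v₀ v) :
    (A.pathAction v₀).act p z = z.comp (ofPath p) := by
  have key : ∀ {v : V} (z : A.PathClass v₀ v) (a : A.vertexGroup v),
      (ofGroup (1 : A.FundamentalGroup v₀)).comp (z.comp (ofVertex a⁻¹⁻¹)) =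
        z.comp (ofVertex a) := by
    intro v z a
    rw [ofGroup_one, ofVertex_one_comp, inv_inv]
  induction p with
  | nil a => exact key z a
  | fwd e a p ih =>
    refine (ih _).trans ?_
    rw [ofPath_fwd, ← comp_assoc, ← key z a, ← comp_assoc]
    rfl
  | bwd e a p ih =>
    refine (ih _).trans ?_
    rw [ofPath_bwd, ← comp_assoc, ← key z a, ← comp_assoc]
    rfl

variable (A) in
/-- The class of the trivial path. -/
def pathActionBase (v₀ : V) : (A.pathAction v₀).carrier v₀ := (ofVertex 1 : A.PathClass v₀ v₀)

/-- This makes each word of `S` lead the base point to its translate by the element that it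
represents, as certificates require. -/
theorem pathAction_rightAct_base {v₀ : V} (g : A.FundamentalGroup v₀) :
    (A.pathAction v₀).rightAct g (A.pathActionBase v₀) =
      ((g, 1) : A.FundamentalGroup v₀ × A.vertexGroup v₀) • A.pathActionBase v₀ := by
  have h1 : (A.pathAction v₀).rightAct g (A.pathActionBase v₀) = ofGroup g := by
    induction g using Quotient.inductionOn
    exact (pathAction_act _ _).trans (ofVertex_one_comp _)
  rw [h1]
  change _ = (ofGroup g).comp ((ofVertex 1).comp (ofVertex 1⁻¹))
  simp

/-- Composition with the inverse of a fixed class embeds the classes of paths into the fundamental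
group. -/
theorem pathClass_countable {v₀ v : V} [Countable (A.FundamentalGroup v₀)] :
    Countable (A.PathClass v₀ v) := by
  rcases isEmpty_or_nonempty (A.PathClass v₀ v) with h | ⟨⟨z⟩⟩
  · infer_instance
  · refine Function.Injective.countable (f := fun y : A.PathClass v₀ v =>
      toGroup (y.comp z.inv)) fun y y' h => ?_
    have := congrArg (fun g => comp (ofGroup g) z) h
    change (y.comp z.inv).comp z = (y'.comp z.inv).comp z at this
    simpa [comp_assoc] using this

end GraphOfGroups

end

/-! ### Subgroups and presentations given by lists of words -/

theorem range_lift_get {G : Type*} [Group G] {ι : Type*} (x : ι → G) (S : List (List (ι × Bool))) :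
    (FreeGroup.lift fun i : Fin S.length => wordEval x (S.get i)).range = wordSubgroup x S := by
  rw [FreeGroup.range_lift_eq_closure, wordSubgroup]
  congr 1
  ext g
  constructor
  · rintro ⟨i, rfl⟩
    exact ⟨_, S.get_mem i, rfl⟩
  · rintro ⟨w, hw, rfl⟩
    obtain ⟨i, rfl⟩ := List.mem_iff_get.1 hw
    exact ⟨i, rfl⟩

theorem mem_wordSubgroup_iff {G : Type*} [Group G] {ι : Type*} (x : ι → G)
    (S : List (List (ι × Bool))) (g : G) :
    g ∈ wordSubgroup x S ↔ ∃ w, wordEval (fun i : ℕ => wordEval x (S.getD i [])) w = g := by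
  rw [← range_lift_get]
  constructor
  · rintro ⟨a, rfl⟩
    refine ⟨a.toWord.map fun t => (t.1.val, t.2), ?_⟩
    rw [wordEval_map_letters, wordEval, FreeGroup.mk_toWord]
    congr 2
    ext i
    simp
  · rintro ⟨w, rfl⟩
    rw [range_lift_get]
    have hle : (FreeGroup.lift fun i : ℕ => wordEval x (S.getD i [])).range ≤
        wordSubgroup x S := by
      rw [FreeGroup.range_lift_eq_closure, Subgroup.closure_le]
      rintro _ ⟨i, rfl⟩
      rcases lt_or_ge i S.length with hi | hi
      · refine Subgroup.subset_closure ⟨S[i], S.getElem_mem hi, ?_⟩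
        simp [List.getElem?_eq_getElem hi]
      · simp only [List.getD_eq_default _ _ hi, wordEval_nil]
        exact one_mem _
    exact hle ⟨_, rfl⟩

theorem wordEval_truncatedOf_of_mem {K : ℕ × List (List (ℕ × Bool))} {r : List (ℕ × Bool)}
    (hr : r ∈ K.2) : wordEval (truncatedOf K) r = 1 :=
  (wordEval_truncatedOf_eq_one_iff K r).2 (Subgroup.subset_normalClosure ⟨r, .inl hr, rfl⟩)

theorem truncatedOf_of_le {K : ℕ × List (List (ℕ × Bool))} {i : ℕ} (hi : K.1 ≤ i) :
    truncatedOf K i = 1 := by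
  have := (wordEval_truncatedOf_eq_one_iff K [(i, true)]).2
    (Subgroup.subset_normalClosure ⟨_, .inr ⟨i, hi, rfl⟩, rfl⟩)
  simpa [wordEval_singleton] using this

/-- This supplies the trivial group `L` for certificates of non-membership. -/
theorem truncatedGroup_subsingleton (R : List (List (ℕ × Bool))) :
    Subsingleton (TruncatedGroup (0, R)) := by
  have h : (QuotientGroup.mk' _ : FreeGroup ℕ →* TruncatedGroup (0, R)) = 1 := by
    rw [← lift_truncatedOf]
    ext i
    simp [truncatedOf_of_le (K := (0, R)) (Nat.zero_le i)]
  refine subsingleton_of_forall_eq 1 fun g => ?_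
  obtain ⟨a, rfl⟩ := QuotientGroup.mk'_surjective _ g
  exact congrArg (fun f => f a) h

/-- Deletes the letters `i ≥ m`. -/
def truncateWord (m : ℕ) (r : List (ℕ × Bool)) : List (ℕ × Bool) :=
  r.flatMap fun t => bif decide (t.1 < m) then [t] else []

theorem primrec_truncateWord : Primrec fun z : ℕ × List (ℕ × Bool) => truncateWord z.1 z.2 := by
  unfold truncateWord
  have h : Primrec fun p : (ℕ × List (ℕ × Bool)) × ℕ × Bool => decide (p.2.1 < p.1.1) :=
    (Primrec.nat_lt.comp (f := fun p : (ℕ × List (ℕ × Bool)) × ℕ × Bool => p.2.1)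
      (g := fun p => p.1.1) (by fun_prop) (by fun_prop)).decide
  fun_prop

/-- The word in the letters `i < m` that remains when the other letters are deleted. -/
def finTruncateWord (m : ℕ) (r : List (ℕ × Bool)) : List (Fin m × Bool) :=
  r.flatMap fun t => if h : t.1 < m then [(⟨t.1, h⟩, t.2)] else []

theorem map_finTruncateWord (m : ℕ) (r : List (ℕ × Bool)) :
    (finTruncateWord m r).map (Prod.map Fin.val id) = truncateWord m r := by
  simp only [finTruncateWord, truncateWord, List.map_flatMap]
  congr 1
  ext1 t
  by_cases h : t.1 < m <;> simp [h]

theorem mk_finTruncateWord (m : ℕ) (r : List (ℕ × Bool)) :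
    FreeGroup.mk (finTruncateWord m r) = FreeGroup.lift
      (fun i => if h : i < m then FreeGroup.of (⟨i, h⟩ : Fin m) else 1) (FreeGroup.mk r) := by
  change _ = wordEval _ r
  induction r with
  | nil => rw [wordEval_nil]; rfl
  | cons t r ih =>
    rw [← List.singleton_append, wordEval_append, ← ih, wordEval_singleton, finTruncateWord,
      List.flatMap_append, ← FreeGroup.mul_mk]
    congr 1
    obtain ⟨i, b⟩ := t
    by_cases h : i < m <;> cases b <;> simp [h, FreeGroup.of, ← FreeGroup.one_eq_mk, FreeGroup.invRev]

/-- Deleting the letters `i ≥ S.length` is a retraction `ρ` of the free group on `ℕ` onto the free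
group on `Fin S.length`. It sends the additional relators to 1 and the others to their truncations,
so a kernel element, included into the free group on `ℕ` and retracted, lies in the required normal
closure. -/
theorem isFinitePresentationOf_truncate {G : Type*} [Group G] {ι : Type*} (x : ι → G)
    (S : List (List (ι × Bool))) (R : List (List (ℕ × Bool)))
    (hR : ∀ r ∈ R, wordEval (fun i => wordEval x (S.getD i [])) r = 1)
    (h : ∀ w, wordEval (fun i => wordEval x (S.getD i [])) w = 1 →
      wordEval (truncatedOf (S.length, R)) w = 1) :
    IsFinitePresentationOf x (S, R.map (truncateWord S.length)) (wordSubgroup x S) := by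
  set ρ : FreeGroup ℕ →* FreeGroup (Fin S.length) := FreeGroup.lift
      (fun i => if h : i < S.length then FreeGroup.of (⟨i, h⟩ : Fin S.length) else 1) with hρ
  set φ := FreeGroup.lift fun i : Fin S.length => wordEval x (S.get i) with hφ
  have hφρ : φ.comp ρ = FreeGroup.lift fun i => wordEval x (S.getD i []) := by
    ext i
    by_cases hi : i < S.length
    · simp [hρ, hφ, hi]
    · simp [hρ, hi, wordEval_nil]
  have hρmap : ρ.comp (FreeGroup.map Fin.val) = MonoidHom.id _ := by
    ext i
    simp [hρ]
  refine ⟨range_lift_get x S, R.map (finTruncateWord S.length), ?_, le_antisymm ?_ ?_⟩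
  · simp [Function.comp_def, map_finTruncateWord]
  · intro a ha
    replace ha : φ a = 1 := ha
    have h1 : φ (ρ (FreeGroup.map Fin.val a)) = 1 := by
      rw [← MonoidHom.comp_apply ρ, hρmap]
      exact ha
    rw [← MonoidHom.comp_apply, hφρ] at h1
    have h2 := h (FreeGroup.map Fin.val a).toWord (by rw [wordEval, FreeGroup.mk_toWord, h1])
    rw [wordEval_truncatedOf_eq_one_iff, FreeGroup.mk_toWord] at h2
    have h3 : ρ (FreeGroup.map Fin.val a) = a := by
      rw [← MonoidHom.comp_apply, hρmap, MonoidHom.id_apply]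
    rw [← h3, ← Subgroup.mem_comap]
    refine Subgroup.normalClosure_le_normal ?_ h2
    rintro _ ⟨r, hr, rfl⟩
    rw [SetLike.mem_coe, Subgroup.mem_comap, hρ, ← mk_finTruncateWord]
    rcases hr with hr | ⟨i, hi, rfl⟩
    · exact Subgroup.subset_normalClosure ⟨_, List.mem_map_of_mem hr, rfl⟩
    · rw [show finTruncateWord S.length [(i, true)] = [] by
        simp [finTruncateWord, not_lt.2 hi], ← FreeGroup.one_eq_mk]
      exact one_mem _
  · refine Subgroup.normalClosure_le_normal ?_
    rintro _ ⟨_, hw, rfl⟩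
    obtain ⟨r, hr, rfl⟩ := List.mem_map.1 hw
    rw [SetLike.mem_coe, MonoidHom.mem_ker, mk_finTruncateWord, ← hρ, ← MonoidHom.comp_apply, hφρ]
    exact hR r hr

/-! ### The algorithms -/

section

open GraphOfGroups GraphOfGroups.PathClass

variable {V : Type u₁} {E : Type u₂} {A : GraphOfGroups.{u₁, u₂, u₃, u₄} V E} {N : ℕ}
  {x : ∀ v, Fin N → A.vertexGroup v} {W : ∀ v, A.vertexGroup v → List (Fin N × Bool)}
  {Q : E → List (List (Fin N × Bool) × List (Fin N × Bool))}
  {v₀ : V} {n : ℕ} {P : Fin n → A.Path v₀ v₀}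

/-- A certificate for a subgroup of the fundamental group exists, and so does one for an element
outside of the subgroup. -/
theorem exists_subgroup_certificate
    (hP : Subgroup.closure (Set.range fun j => toGroup (ofPath (P j))) = ⊤)
    (hW : ∀ v a, wordEval (x v) (W v a) = a)
    (hQ : ∀ e, ∀ p ∈ Q e, ∃ c, wordEval (x _) p.1 = A.α e c ∧ wordEval (x _) p.2 = A.ω e c)
    {F : ∀ _ : V, List (List (Fin N × Bool)) →
      List (List (Fin N × Bool)) × List (List (ℕ × Bool))}
    (hF₁ : ∀ v w, wordSubgroup (x v) (F v w).1 = wordSubgroup (x v) w)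
    (hF₂ : ∀ v w, ∀ r ∈ (F v w).2,
      wordEval (fun i => wordEval (x v) ((F v w).1.getD i [])) r = 1)
    (S : List (List (Fin n × Bool))) (w : List (Fin n × Bool)) :
    ∃ (C : Certificate V E N) (R : List (List (ℕ × Bool))) (p p' : CertPoint N),
      (∀ r ∈ R, wordEval (fun i => wordEval (fun j => toGroup (ofPath (P j)))
        (S.getD i [])) r = 1) ∧
      (∀ K, (∀ r ∈ R, wordEval (truncatedOf K) r = 1) →
        C.EdgesValid x Q (truncatedOf K) ∧ C.ReadsGenerators x W (truncatedOf K) P S p ∧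
        C.ReadsWord x W (truncatedOf K) P w p p' ∧ C.BlocksPresented (truncatedOf K) F) ∧
      (wordEval (fun j => toGroup (ofPath (P j))) w ∉
        wordSubgroup (fun j => toGroup (ofPath (P j))) S → C.Distinct x v₀ p p') := by
  have : Countable (A.FundamentalGroup v₀) :=
    Function.Surjective.countable (f := wordEval fun j => toGroup (ofPath (P j)))
      (exists_wordEval_eq hP)
  have : ∀ v, Countable ((A.pathAction v₀).carrier v) := fun v => pathClass_countable
  -- The elements `η i` are those represented by the words of `S`, so the orbits counted are those
  -- of the subgroup times the vertex groups.
  obtain ⟨c⟩ := exists_coordinates (A.pathAction v₀) x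
    (fun i => wordEval (fun j => toGroup (ofPath (P j))) (S.getD i []))
  obtain ⟨C, R, hS, hR, hK⟩ := c.exists_certificate
    (fun v z h => pathAction_free z h) hW hQ hF₁ hF₂ S (A.pathActionBase v₀)
    (fun i => pathAction_rightAct_base _) w
  -- If the endpoint were a translate of the base point by a word `l` in the generators of the
  -- subgroup, freeness would identify the element with that of `l`.
  refine ⟨C, R, _, _, hR, hK, fun hw => hS.distinct (g := []) fun l hl => hw ?_⟩
  rw [pathAction_rightAct_base, wordEval_nil, eq_comm, ← inv_smul_eq_iff, smul_smul,
    Prod.inv_mk, Prod.mk_mul_mk, inv_one, one_mul] at hl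
  have := pathAction_free _ _ hl
  rw [inv_mul_eq_one] at this
  exact (mem_wordSubgroup_iff _ _ _).2 ⟨l, this⟩

variable [Primcodable V] [Primcodable E] [Finite E]

theorem membershipDecidable_fundamentalGroup (hx : UniformMembership x)
    (hP : Subgroup.closure (Set.range fun j => toGroup (ofPath (P j))) = ⊤)
    (hword : Semidecidable fun w : List (Fin n × Bool) =>
      wordEval (fun j => toGroup (ofPath (P j))) w = 1)
    (hW : ∀ v a, wordEval (x v) (W v a) = a)
    (hQ : ∀ e, ∀ p ∈ Q e, ∃ c, wordEval (x _) p.1 = A.α e c ∧ wordEval (x _) p.2 = A.ω e c)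
    (hQ' : ∀ e c, ∃ p ∈ Q e, wordEval (x _) p.1 = A.α e c ∧ wordEval (x _) p.2 = A.ω e c) :
    MembershipDecidable fun j => toGroup (ofPath (P j)) := by
  refine Semidecidable.computablePred ?_ ?_
  · refine (Semidecidable.ex (p := fun z w => wordEval (fun j => toGroup (ofPath (P j)))
      (substWord (fun i => z.2.getD i []) w ++ FreeGroup.invRev z.1) = 1) (hword.comp (f := fun z : (List (Fin n × Bool) ×
      List (List (Fin n × Bool))) × List (ℕ × Bool) =>
        substWord (fun i => z.1.2.getD i []) z.2 ++ FreeGroup.invRev z.1.1) (by fun_prop))).of_eq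
      fun z => ?_
    rw [mem_wordSubgroup_iff]
    simp only [← wordEval_eq_iff, wordEval_substWord]
  · refine (Semidecidable.ex (β := Certificate V E N × CertPoint N × CertPoint N) (p := fun z c =>
      c.1.EdgesValid x Q (truncatedOf (0, [])) ∧
        c.1.ReadsGenerators x W (truncatedOf (0, [])) P z.2 c.2.1 ∧
        c.1.ReadsWord x W (truncatedOf (0, [])) P z.1 c.2.1 c.2.2 ∧
        c.1.Distinct x v₀ c.2.1 c.2.2) (.and ?_ (.and ?_ (.and ?_ ?_)))).of_eq fun z => ?_
    · exact (Certificate.semidecidable_edgesValid Q hx).comp (f := fun z :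
        (List (Fin n × Bool) × List (List (Fin n × Bool))) × Certificate V E N × CertPoint N ×
        CertPoint N => ((0, []), z.2.1)) (by fun_prop)
    · exact (Certificate.semidecidable_readsGenerators W hx P).comp (f := fun z :
        (List (Fin n × Bool) × List (List (Fin n × Bool))) × Certificate V E N × CertPoint N ×
        CertPoint N => (((0, []), z.2.1), z.1.2, z.2.2.1)) (by fun_prop)
    · exact (Certificate.semidecidable_readsWord W hx P).comp (f := fun z :
        (List (Fin n × Bool) × List (List (Fin n × Bool))) × Certificate V E N × CertPoint N ×
        CertPoint N => (((0, []), z.2.1), z.1.1, z.2.2.1, z.2.2.2)) (by fun_prop)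
    · exact (Certificate.semidecidable_distinct (E := E) hx).comp (f := fun z :
        (List (Fin n × Bool) × List (List (Fin n × Bool))) × Certificate V E N × CertPoint N ×
        CertPoint N => (z.2.1, v₀, z.2.2.1, z.2.2.2)) (by fun_prop)
    · have := truncatedGroup_subsingleton []
      constructor
      · intro hz
        -- Over the trivial group all relations hold and freeness is automatic, so no presentations
        -- in the vertex groups are needed, and `F` returns its input with no relators.
        obtain ⟨C, R, p, p', -, hK, hd⟩ := exists_subgroup_certificate (F := fun _ w => (w, []))
          hP hW hQ (fun _ _ => rfl) (fun _ _ r hr => by simp at hr) z.2 z.1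
        obtain ⟨h1, h2, h3, -⟩ := hK (0, []) fun r _ => Subsingleton.elim _ _
        exact ⟨(C, p, p'), h1, h2, h3, hd hz⟩
      · rintro ⟨⟨C, p, p'⟩, h1, h2, h3, h4⟩
        exact Certificate.EdgesValid.not_mem_wordSubgroup hQ' hW h1
          (fun _ _ _ _ => Subsingleton.elim _ _) h2 (fun _ _ => Subsingleton.elim _ _) h3 h4

/-- The search is for relators `R` that hold in the subgroup, together with a certificate over the
group that they define. Such a certificate proves that `R` suffices. -/
theorem presentationsComputable_fundamentalGroup [Finite V] (hx : UniformMembership x)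
    (hcoh : ∀ v, PresentationsComputable (x v))
    (hP : Subgroup.closure (Set.range fun j => toGroup (ofPath (P j))) = ⊤)
    (hword : Semidecidable fun w : List (Fin n × Bool) =>
      wordEval (fun j => toGroup (ofPath (P j))) w = 1)
    (hW : ∀ v a, wordEval (x v) (W v a) = a)
    (hQ : ∀ e, ∀ p ∈ Q e, ∃ c, wordEval (x _) p.1 = A.α e c ∧ wordEval (x _) p.2 = A.ω e c)
    (hQ' : ∀ e c, ∃ p ∈ Q e, wordEval (x _) p.1 = A.α e c ∧ wordEval (x _) p.2 = A.ω e c) :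
    PresentationsComputable fun j => toGroup (ofPath (P j)) := by
  choose F hF hpres using hcoh
  have hF₁ : ∀ v w, wordSubgroup (x v) (F v w).1 = wordSubgroup (x v) w := fun v w => by
    rw [← (hpres v w).1, range_lift_get]
  have hF₂ : ∀ v w, ∀ r ∈ (F v w).2,
      wordEval (fun i => wordEval (x v) ((F v w).1.getD i [])) r = 1 := by
    intro v w r hr
    obtain ⟨-, R, hR, hker⟩ := hpres v w
    rw [hR] at hr
    obtain ⟨s, hs, rfl⟩ := List.mem_map.1 hr
    have h1 : FreeGroup.mk s ∈ (FreeGroup.lift fun i : Fin (F v w).1.length =>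
        wordEval (x v) ((F v w).1.get i)).ker := by
      rw [hker]
      exact Subgroup.subset_normalClosure ⟨s, hs, rfl⟩
    refine (wordEval_map_letters _ Fin.val s).trans (Eq.trans ?_ h1)
    unfold wordEval
    congr 2
    ext i
    simp
  have hsemi : Semidecidable fun z : List (List (Fin n × Bool)) × List (List (ℕ × Bool)) =>
      (∀ r ∈ z.2, wordEval (fun j => toGroup (ofPath (P j)))
        (substWord (fun i => z.1.getD i []) r) = 1) ∧
      ∃ c : Certificate V E N × CertPoint N,
        c.1.EdgesValid x Q (truncatedOf (z.1.length, z.2)) ∧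
        c.1.ReadsGenerators x W (truncatedOf (z.1.length, z.2)) P z.1 c.2 ∧
        c.1.BlocksPresented (truncatedOf (z.1.length, z.2)) F := by
    refine .and (.forall_mem (by fun_prop) ?_) (.ex (.and ?_ (.and ?_ ?_)))
    · exact hword.comp (f := fun z : (List (List (Fin n × Bool)) × List (List (ℕ × Bool))) ×
        List (ℕ × Bool) => substWord (fun i => z.1.1.getD i []) z.2) (by fun_prop)
    · exact (Certificate.semidecidable_edgesValid Q hx).comp (f := fun z :
        (List (List (Fin n × Bool)) × List (List (ℕ × Bool))) × Certificate V E N × CertPoint N =>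
          ((z.1.1.length, z.1.2), z.2.1)) (by fun_prop)
    · exact (Certificate.semidecidable_readsGenerators W hx P).comp (f := fun z :
        (List (List (Fin n × Bool)) × List (List (ℕ × Bool))) × Certificate V E N × CertPoint N =>
          (((z.1.1.length, z.1.2), z.2.1), z.1.1, z.2.2)) (by fun_prop)
    · exact (Certificate.semidecidable_blocksPresented (E := E) hF).comp (f := fun z :
        (List (List (Fin n × Bool)) × List (List (ℕ × Bool))) × Certificate V E N × CertPoint N =>
          ((z.1.1.length, z.1.2), z.2.1)) (by fun_prop)
  obtain ⟨f, hf, hfS⟩ := hsemi.exists_computable fun S => by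
    -- No word outside the subgroup has to be traced here, hence the empty word.
    obtain ⟨C, R, p, p', hR, hK, -⟩ := exists_subgroup_certificate hP hW hQ hF₁ hF₂ S []
    obtain ⟨h1, h2, -, h3⟩ := hK (S.length, R) fun r hr => wordEval_truncatedOf_of_mem hr
    exact ⟨R, fun r hr => by rw [wordEval_substWord]; exact hR r hr, (C, p), h1, h2, h3⟩
  have htr : Primrec fun z : List (List (Fin n × Bool)) × List (List (ℕ × Bool)) =>
      (z.1, z.2.map (truncateWord z.1.length)) := by
    have := primrec_truncateWord.comp (g := fun p : (List (List (Fin n × Bool)) ×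
      List (List (ℕ × Bool))) × List (ℕ × Bool) => (p.1.1.length, p.2)) (by fun_prop)
    fun_prop
  refine ⟨fun S => (S, (f S).map (truncateWord S.length)),
    htr.to_comp.comp (Computable.id.pair hf), fun S => ?_⟩
  obtain ⟨hR, ⟨C, p⟩, h1, h2, h3⟩ := hfS S
  refine isFinitePresentationOf_truncate _ S (f S) (fun r hr => ?_) fun w hw => ?_
  · rw [← wordEval_substWord]
    exact hR r hr
  · exact h1.wordEval_eq_one hQ' hW (h3.faithful hpres) h2 (fun i hi => truncatedOf_of_le hi) hw

end

/-! ### The main theorem -/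

theorem mainTheorem5 {V : Type u₁} {E : Type u₂} [Finite V] [Finite E]
    (A : GraphOfGroups.{u₁, u₂, u₃, u₄} V E) (v₀ : V)
    (hE : ∀ e, Finite (A.edgeGroup e))
    (hV : ∀ v, HasSolvableMembershipProblem (A.vertexGroup v)) :
    HasSolvableMembershipProblem (A.FundamentalGroup v₀) ∧
    ((∀ v, EffectivelyCoherent (A.vertexGroup v)) →
      EffectivelyCoherent (A.FundamentalGroup v₀)) := by
  obtain ⟨k, ⟨eV⟩⟩ := Finite.exists_equiv_fin V
  obtain ⟨k', ⟨eE⟩⟩ := Finite.exists_equiv_fin E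
  let _ : Primcodable V := Primcodable.ofEquiv _ eV
  let _ : Primcodable E := Primcodable.ofEquiv _ eE
  obtain ⟨N, x, hgen⟩ := exists_common_alphabet A.vertexGroup hV
  have hx := uniformMembership x hV
  obtain ⟨n, P, hP, hword⟩ := GraphOfGroups.exists_generators hgen hx hE v₀
  -- The choice of words need not be computable: the algorithms use it only for the finitely many
  -- vertex group elements given by the edge groups and by the paths `P` and their reverses.
  choose W hW using fun v a => exists_wordEval_eq (hgen v) a
  have : ∀ e, Fintype (A.edgeGroup e) := fun e => Fintype.ofFinite _
  let Q : E → List (List (Fin N × Bool) × List (Fin N × Bool)) := fun e =>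
    (Finset.univ.toList).map fun c => (W _ (A.α e c), W _ (A.ω e c))
  have hQ : ∀ e, ∀ p ∈ Q e, ∃ c, wordEval (x _) p.1 = A.α e c ∧ wordEval (x _) p.2 = A.ω e c := by
    intro e p hp
    obtain ⟨c, -, rfl⟩ := List.mem_map.1 hp
    exact ⟨c, hW _ _, hW _ _⟩
  have hQ' : ∀ e c, ∃ p ∈ Q e, wordEval (x _) p.1 = A.α e c ∧ wordEval (x _) p.2 = A.ω e c :=
    fun e c => ⟨_, List.mem_map_of_mem (Finset.mem_toList.2 (Finset.mem_univ c)), hW _ _, hW _ _⟩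
  refine ⟨⟨n, _, hP, membershipDecidable_fundamentalGroup hx hP hword hW hQ hQ'⟩, fun hcoh =>
    ⟨n, _, hP, presentationsComputable_fundamentalGroup hx
      (fun v => (hcoh v).presentationsComputable (x v) (hgen v)) hP hword hW hQ hQ'⟩⟩
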